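/- **Theorem 3.5 (Splitting Theorem).** Let $(M,\Omega,\omega)$ be a compact locally conformally symplectic manifold of dimension $2n$ (without boundary): $\omega$ is a closed 1-form and $\Omega$ a nondegenerate 2-form with $d\Omega=-\omega\wedge\Omega$. *Setting.* Put $d^\omega\alpha=d\alpha+\omega\wedge\alpha$ and $H^1_\omega(M)=\{\alpha\in\Omega^1(M): d^\omega\alpha=0\}/\{d^\omega f: f\in C^\infty(M)\}$, with the quotient of the $C^\infty$ topology. Let $\ker\Phi$ be the set of smooth vector fields $X$ with $L_X\Omega=-f\Omega$ and $L_X\omega=df$ for a smooth function $f$ such that $\omega(X)-f=0$. Consider the smooth isotopies $\{g_t\}$ of $M$ with $g_0=\mathrm{id}$ and $\frac{d}{dt}g_t=X_t\circ g_t$ with $X_t\in\ker\Phi$ for all $t$. Their time-one maps $g_1$ form the group $(\ker\Phi)_0$, which carries the quotient topology of the $C^\infty$ topology on isotopies under $\{g_t\}\mapsto g_1$. The flux of an isotopy is $\widetilde\Psi(\{g_t\})=\big[\int_0^1 i_{X_t}\Omega\,dt\big]\in H^1_\omega(M)$. Let $\Delta\subset H^1_\omega(M)$ be the group of fluxes of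 isotopies with $g_1=\mathrm{id}$, let $\mathcal F:(\ker\Phi)_0\to H^1_\omega(M)/\Delta$, $\mathcal F(g_1)=\widetilde\Psi(\{g_t\})+\Delta$, be the induced flux, and let $\mathrm{Ham}_\Omega(M)=\{g_1:\widetilde\Psi(\{g_t\})=0\}$. *Statement.* Suppose that $\Delta$ is discrete, and that $s:H^1_\omega(M)/\Delta\to(\ker\Phi)_0$ is a continuous map with $\mathcal F\circ s=\mathrm{id}$. Then $\mathrm{Ham}_\Omega(M)$ is a normal subgroup of $(\ker\Phi)_0$, and $$\mathrm{Ham}_\Omega(M)\times s\big(H^1_\omega(M)/\Delta\big)\to(\ker\Phi)_0,\qquad (h,k)\mapsto hk,$$ is a homeomorphism. If $s$ is moreover a section in the sense of groups, i.e. $s(a+b)=s(a)s(b)$, then $s(H^1_\omega(M)/\Delta)$ is a subgroup acting on $\mathrm{Ham}_\Omega(M)$ by conjugation, $k\cdot h=khk^{-1}$, and the same map is an isomorphism of groups and a homeomorphism $$\mathrm{Ham}_\Omega(M)\rtimes s\big(H^1_\omega(M)/\Delta\big)\;\cong\;(\ker\Phi)_0 .$$ -/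

import Mathlib

open scoped Manifold ContDiff Bundle
open Bundle

/-! ## The group of smooth diffeomorphisms -/

section DiffeoGroup

/-- The diffeomorphisms of `M` form a group under composition, `(g * h) x = g (h x)`. -/
noncomputable instance diffeoGroup {m : ℕ} {M : Type*} [TopologicalSpace M]
    [ChartedSpace (EuclideanSpace ℝ (Fin m)) M] : Group (M ≃ₘ⟮𝓡 m, 𝓡 m⟯ M) where
  mul g h := h.trans g
  one := Diffeomorph.refl (𝓡 m) M ∞
  inv g := g.symm
  mul_assoc _ _ _ := Diffeomorph.ext fun _ => rfl
  one_mul _ := Diffeomorph.ext fun _ => rfl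
  mul_one _ := Diffeomorph.ext fun _ => rfl
  inv_mul_cancel g := Diffeomorph.ext fun x => g.symm_apply_apply x

end DiffeoGroup

/-! ## The `C^∞` compact-open topology -/

/-- The compact-open `C^k` topology on maps `N → N'` between manifolds (used for smooth maps only):
for `k = 0` the compact-open topology, generated by the sets `{f | f(K) ⊆ U}` with `K` compact and
`U` open; for `k + 1` the topology induced from the `C^k` topology by `f ↦ T f`, where
`T f : T N → T N'` is the tangent map. -/
noncomputable def ckTopology : (k : ℕ) →
    {E : Type} → [NormedAddCommGroup E] → [NormedSpace ℝ E] → {H : Type} → [TopologicalSpace H] →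
    (I : ModelWithCorners ℝ E H) →
    {E' : Type} → [NormedAddCommGroup E'] → [NormedSpace ℝ E'] → {H' : Type} →
    [TopologicalSpace H'] → (I' : ModelWithCorners ℝ E' H') →
    (N : Type*) → [TopologicalSpace N] → [ChartedSpace H N] → [IsManifold I ∞ N] →
    (N' : Type*) → [TopologicalSpace N'] → [ChartedSpace H' N'] → [IsManifold I' ∞ N'] →
    TopologicalSpace (N → N')
  | 0, _, _, _, _, _, _, _, _, _, _, _, _, N, _, _, _, N', _, _, _ =>
      .generateFrom {S | ∃ (K : Set N) (U : Set N'), IsCompact K ∧ IsOpen U ∧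
        S = {f | Set.MapsTo f K U}}
  | k + 1, _, _, _, _, _, I, _, _, _, _, _, I', N, _, _, _, N', _, _, _ =>
      (ckTopology k I.tangent I'.tangent (TangentBundle I N) (TangentBundle I' N')).induced
        (fun f => tangentMap I I' f)

/-- The `C^∞` compact-open topology: all iterated tangent maps `T^k f` converge uniformly on compact
sets. -/
noncomputable def smoothTopology {E : Type} [NormedAddCommGroup E] [NormedSpace ℝ E] {H : Type}
    [TopologicalSpace H] (I : ModelWithCorners ℝ E H)
    {E' : Type} [NormedAddCommGroup E'] [NormedSpace ℝ E'] {H' : Type}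
    [TopologicalSpace H'] (I' : ModelWithCorners ℝ E' H')
    (N : Type*) [TopologicalSpace N] [ChartedSpace H N] [IsManifold I ∞ N]
    (N' : Type*) [TopologicalSpace N'] [ChartedSpace H' N'] [IsManifold I' ∞ N'] :
    TopologicalSpace (N → N') :=
  ⨅ k : ℕ, ckTopology k I I' N N'

/-! ## Differential forms of degree at most two -/

section Forms

variable (m : ℕ) (M : Type*) [TopologicalSpace M] [ChartedSpace (EuclideanSpace ℝ (Fin m)) M]
  [IsManifold (𝓡 m) ∞ M]

/-- Smooth 1-forms on `M`: smooth sections of the cotangent bundle. -/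
abbrev OneForm : Type _ :=
  Cₛ^∞⟮𝓡 m; EuclideanSpace ℝ (Fin m) →L[ℝ] ℝ, fun x : M => TangentSpace (𝓡 m) x →L[ℝ] ℝ⟯

/-- Smooth covariant 2-tensors on `M`. A 2-form is one that vanishes on all pairs `(v, v)`. -/
abbrev TwoTensor : Type _ :=
  Cₛ^∞⟮𝓡 m; EuclideanSpace ℝ (Fin m) →L[ℝ] EuclideanSpace ℝ (Fin m) →L[ℝ] ℝ,
    fun x : M => TangentSpace (𝓡 m) x →L[ℝ] TangentSpace (𝓡 m) x →L[ℝ] ℝ⟯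

/-- The `C^∞` topology on 1-forms, a 1-form being seen as the smooth function `(x, v) ↦ α_x(v)` on
the tangent bundle. -/
noncomputable instance oneFormTopology : TopologicalSpace (OneForm m M) :=
  (smoothTopology (𝓡 m).tangent 𝓘(ℝ, ℝ) (TangentBundle (𝓡 m) M) ℝ).induced
    (fun α p => α p.1 p.2)

variable {m M}

/-- `coordField x v` is the vector field with constant coefficients in the chart around `x` which
takes the value `v` at `x`; it is written as a function of the coordinate `y`, with value at the
point `φ⁻¹ y`, where `φ` is the chart. -/
noncomputable def coordField (x : M) (v : TangentSpace (𝓡 m) x) (y : EuclideanSpace ℝ (Fin m)) :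
    TangentSpace (𝓡 m) ((extChartAt (𝓡 m) x).symm y) :=
  mfderivWithin 𝓘(ℝ, EuclideanSpace ℝ (Fin m)) (𝓡 m) (extChartAt (𝓡 m) x).symm
    (Set.range (𝓡 m)) y (mfderiv (𝓡 m) 𝓘(ℝ, EuclideanSpace ℝ (Fin m)) (extChartAt (𝓡 m) x) x v)

/-- `chartDeriv x u F` is the derivative at `x`, in the direction `u`, of a function `F` given in
the coordinates of the chart around `x`. -/
noncomputable def chartDeriv (x : M) (u : TangentSpace (𝓡 m) x)
    (F : EuclideanSpace ℝ (Fin m) → ℝ) : ℝ :=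
  fderiv ℝ F (extChartAt (𝓡 m) x x)
    (mfderiv (𝓡 m) 𝓘(ℝ, EuclideanSpace ℝ (Fin m)) (extChartAt (𝓡 m) x) x u)

/-- Differential of a function. -/
noncomputable def dFun (f : M → ℝ) (x : M) (v : TangentSpace (𝓡 m) x) : ℝ :=
  mfderiv (𝓡 m) 𝓘(ℝ, ℝ) f x v

/-- Exterior derivative of a 1-form, computed in the chart around `x`: in coordinates
`(dα)_{ij} = ∂_i α_j - ∂_j α_i`. -/
noncomputable def dOne (α : ∀ x : M, TangentSpace (𝓡 m) x →L[ℝ] ℝ) (x : M)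
    (u v : TangentSpace (𝓡 m) x) : ℝ :=
  chartDeriv x u (fun y => α ((extChartAt (𝓡 m) x).symm y) (coordField x v y))
    - chartDeriv x v (fun y => α ((extChartAt (𝓡 m) x).symm y) (coordField x u y))

/-- Exterior derivative of a 2-form, computed in the chart around `x`: in coordinates
`(dΩ)_{ijk} = ∂_i Ω_{jk} - ∂_j Ω_{ik} + ∂_k Ω_{ij}`. -/
noncomputable def dTwo
    (Ω : ∀ x : M, TangentSpace (𝓡 m) x →L[ℝ] TangentSpace (𝓡 m) x →L[ℝ] ℝ) (x : M)
    (u v w : TangentSpace (𝓡 m) x) : ℝ :=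
  chartDeriv x u
      (fun y => Ω ((extChartAt (𝓡 m) x).symm y) (coordField x v y) (coordField x w y))
    - chartDeriv x v
      (fun y => Ω ((extChartAt (𝓡 m) x).symm y) (coordField x u y) (coordField x w y))
    + chartDeriv x w
      (fun y => Ω ((extChartAt (𝓡 m) x).symm y) (coordField x u y) (coordField x v y))

theorem chartDeriv_add (x : M) (u : TangentSpace (𝓡 m) x) {F G : EuclideanSpace ℝ (Fin m) → ℝ}
    (hF : DifferentiableAt ℝ F (extChartAt (𝓡 m) x x))
    (hG : DifferentiableAt ℝ G (extChartAt (𝓡 m) x x)) :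
    chartDeriv x u (F + G) = chartDeriv x u F + chartDeriv x u G := by
  unfold chartDeriv
  rw [fderiv_add hF hG]
  rfl

theorem chartDeriv_smul (x : M) (u : TangentSpace (𝓡 m) x) {F : EuclideanSpace ℝ (Fin m) → ℝ}
    (c : ℝ) (hF : DifferentiableAt ℝ F (extChartAt (𝓡 m) x x)) :
    chartDeriv x u (c • F) = c * chartDeriv x u F := by
  unfold chartDeriv
  rw [fderiv_const_smul hF]
  rfl

/-- A smooth 1-form has differentiable coefficients in a chart. -/
theorem differentiableAt_coeff (α : OneForm m M) (x : M) (v : TangentSpace (𝓡 m) x) :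
    DifferentiableAt ℝ (fun y => α ((extChartAt (𝓡 m) x).symm y) (coordField x v y))
      (extChartAt (𝓡 m) x x) := by
  set w : EuclideanSpace ℝ (Fin m) :=
    mfderiv (𝓡 m) 𝓘(ℝ, EuclideanSpace ℝ (Fin m)) (extChartAt (𝓡 m) x) x v with hw
  have hfield : ContMDiffAt (𝓡 m) (𝓡 m).tangent ∞
      (fun p : M => TotalSpace.mk' (EuclideanSpace ℝ (Fin m))
        (E := (TangentSpace (𝓡 m) : M → Type _)) p
        ((trivializationAt (EuclideanSpace ℝ (Fin m)) (TangentSpace (𝓡 m)) x).symmL ℝ p w)) x := by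
    have h := (trivializationAt (EuclideanSpace ℝ (Fin m)) (TangentSpace (𝓡 m) : M → Type _)
      x).contMDiffAt_symmL (IB := 𝓡 m) (n := ∞)
      (FiberBundle.mem_baseSet_trivializationAt' x)
    exact h.clm_bundle_apply (E₁ := Bundle.Trivial M (EuclideanSpace ℝ (Fin m)))
      (E₂ := (TangentSpace (𝓡 m) : M → Type _)) (v := fun _ => w)
      (contMDiffAt_totalSpace.2 ⟨contMDiffAt_id, contMDiffAt_const⟩)
  have hα := (α.contMDiff_toFun x).clm_bundle_apply (E₁ := (TangentSpace (𝓡 m) : M → Type _))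
    (E₂ := Bundle.Trivial M ℝ) hfield
  have hf : ContMDiffAt (𝓡 m) 𝓘(ℝ, ℝ) ∞ (fun p : M => α p
      ((trivializationAt (EuclideanSpace ℝ (Fin m)) (TangentSpace (𝓡 m)) x).symmL ℝ p w)) x :=
    (contMDiffAt_totalSpace.1 hα).2
  have hc : ContDiffWithinAt ℝ ∞ (fun y => α ((extChartAt (𝓡 m) x).symm y)
      ((trivializationAt (EuclideanSpace ℝ (Fin m)) (TangentSpace (𝓡 m)) x).symmL ℝ
        ((extChartAt (𝓡 m) x).symm y) w)) (Set.range (𝓡 m)) (extChartAt (𝓡 m) x x) :=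
    (contMDiffAt_iff.1 hf).2
  rw [ModelWithCorners.range_eq_univ, contDiffWithinAt_univ] at hc
  have hd := hc.differentiableAt (by simp)
  refine hd.congr_of_eventuallyEq ?_
  filter_upwards [extChartAt_target_mem_nhds (I := 𝓡 m) x] with y hy
  have h1 : (extChartAt (𝓡 m) x).symm y ∈ (chartAt (EuclideanSpace ℝ (Fin m)) x).source := by
    simpa using (extChartAt (𝓡 m) x).map_target hy
  have h2 := TangentBundle.symmL_trivializationAt (𝕜 := ℝ) (I := 𝓡 m) h1
  rw [(extChartAt (𝓡 m) x).right_inv hy] at h2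
  rw [h2]
  rfl

end Forms

/-! ## Locally conformally symplectic structures -/

/-- A locally conformally symplectic structure on an `m`-dimensional manifold: a closed 1-form `ω`
(the Lee form) and a nondegenerate 2-form `Ω` with `dΩ = -ω ∧ Ω`. -/
structure LCSStructure (m : ℕ) (M : Type*) [TopologicalSpace M]
    [ChartedSpace (EuclideanSpace ℝ (Fin m)) M] [IsManifold (𝓡 m) ∞ M] where
  /-- the Lee form -/
  lee : OneForm m M
  /-- the locally conformally symplectic form -/
  form : TwoTensor m M
  alternating : ∀ (x : M) (v : TangentSpace (𝓡 m) x), form x v v = 0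
  nondegenerate : ∀ (x : M) (v : TangentSpace (𝓡 m) x), (∀ w, form x v w = 0) → v = 0
  closed : ∀ (x : M) (u v : TangentSpace (𝓡 m) x), dOne lee x u v = 0
  structure_eq : ∀ (x : M) (u v w : TangentSpace (𝓡 m) x),
    dTwo form x u v w
      = -(lee x u * form x v w - lee x v * form x u w + lee x w * form x u v)

namespace LCSStructure

variable {m : ℕ} {M : Type*} [TopologicalSpace M] [ChartedSpace (EuclideanSpace ℝ (Fin m)) M]
  [IsManifold (𝓡 m) ∞ M] (L : LCSStructure m M)

/-! ### Lichnerowicz cohomology in degree one -/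

/-- The Lichnerowicz differential `d^ω f = df + f ω` of a function. -/
noncomputable def dTwistFun (f : M → ℝ) (x : M) (v : TangentSpace (𝓡 m) x) : ℝ :=
  dFun f x v + f x * L.lee x v

/-- The Lichnerowicz differential `d^ω α = dα + ω ∧ α` of a 1-form. -/
noncomputable def dTwistOne (α : ∀ x : M, TangentSpace (𝓡 m) x →L[ℝ] ℝ) (x : M)
    (u v : TangentSpace (𝓡 m) x) : ℝ :=
  dOne α x u v + (L.lee x u * α x v - L.lee x v * α x u)

/-- `Z¹_ω(M)`, the smooth 1-forms `α` with `d^ω α = 0`. -/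
def cocycles : Submodule ℝ (OneForm m M) where
  carrier := {α | ∀ (x : M) (u v : TangentSpace (𝓡 m) x), L.dTwistOne α x u v = 0}
  zero_mem' := by
    intro x u v
    have h : ∀ w : TangentSpace (𝓡 m) x,
        (fun y => (0 : OneForm m M) ((extChartAt (𝓡 m) x).symm y) (coordField x w y)) =
        (0 : ℝ) • (fun y =>
          (0 : OneForm m M) ((extChartAt (𝓡 m) x).symm y) (coordField x w y)) := by
      intro w; rw [zero_smul]; rfl
    have h0 : ∀ w : TangentSpace (𝓡 m) x, (0 : OneForm m M) x w = 0 := fun _ => rfl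
    simp only [dTwistOne, dOne, h0]
    rw [h u, h v, chartDeriv_smul x u 0 (differentiableAt_coeff 0 x v),
      chartDeriv_smul x v 0 (differentiableAt_coeff 0 x u)]
    ring
  add_mem' := by
    intro α β hα hβ x u v
    have h1 := hα x u v
    have h2 := hβ x u v
    have e : ∀ w : TangentSpace (𝓡 m) x,
        (fun y => (α + β) ((extChartAt (𝓡 m) x).symm y) (coordField x w y)) =
        (fun y => α ((extChartAt (𝓡 m) x).symm y) (coordField x w y)) +
        (fun y => β ((extChartAt (𝓡 m) x).symm y) (coordField x w y)) := fun _ => rfl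
    have e0 : ∀ w : TangentSpace (𝓡 m) x, (α + β) x w = α x w + β x w := fun _ => rfl
    simp only [dTwistOne, dOne] at h1 h2 ⊢
    rw [e, e, chartDeriv_add x u (differentiableAt_coeff α x v) (differentiableAt_coeff β x v),
      chartDeriv_add x v (differentiableAt_coeff α x u) (differentiableAt_coeff β x u), e0, e0]
    linear_combination h1 + h2
  smul_mem' := by
    intro c α hα x u v
    have h1 := hα x u v
    have e : ∀ w : TangentSpace (𝓡 m) x,
        (fun y => (c • α) ((extChartAt (𝓡 m) x).symm y) (coordField x w y)) =
        c • (fun y => α ((extChartAt (𝓡 m) x).symm y) (coordField x w y)) := fun _ => rfl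
    have e0 : ∀ w : TangentSpace (𝓡 m) x, (c • α) x w = c * α x w := fun _ => rfl
    simp only [dTwistOne, dOne] at h1 ⊢
    rw [e, e, chartDeriv_smul x u c (differentiableAt_coeff α x v),
      chartDeriv_smul x v c (differentiableAt_coeff α x u), e0, e0]
    linear_combination c * h1

/-- `B¹_ω(M) = {d^ω f}` for smooth functions `f`, as a subspace of `Z¹_ω(M)`. -/
def coboundaries : Submodule ℝ L.cocycles where
  carrier := {α | ∃ f : M → ℝ, ContMDiff (𝓡 m) 𝓘(ℝ, ℝ) ∞ f ∧
    ∀ (x : M) (v : TangentSpace (𝓡 m) x), α.1 x v = L.dTwistFun f x v}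
  zero_mem' := by
    refine ⟨fun _ => 0, contMDiff_const, fun x v => ?_⟩
    have h : dFun (fun _ : M => (0 : ℝ)) x v = 0 := by
      unfold dFun
      rw [mfderiv_const]
      rfl
    rw [dTwistFun, h, zero_mul, zero_add]
    rfl
  add_mem' := by
    rintro α β ⟨f, hf, hα⟩ ⟨g, hg, hβ⟩
    refine ⟨f + g, hf.add hg, fun x v => ?_⟩
    have h := mfderiv_add (hf.mdifferentiableAt (by simp) : MDifferentiableAt _ _ f x)
      (hg.mdifferentiableAt (by simp) : MDifferentiableAt _ _ g x)
    have e : dFun (f + g) x v = dFun f x v + dFun g x v := by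
      simp only [dFun, h]; rfl
    have e' : (α + β).1 x v = α.1 x v + β.1 x v := rfl
    rw [e', hα, hβ]
    simp only [dTwistFun, e, Pi.add_apply]
    ring
  smul_mem' := by
    rintro c α ⟨f, hf, hα⟩
    refine ⟨c • f, (contDiff_const_smul (𝕜 := ℝ) (F := ℝ) c).comp_contMDiff hf, fun x v => ?_⟩
    have h := const_smul_mfderiv (hf.mdifferentiableAt (by simp) : MDifferentiableAt _ _ f x) c
    have e : dFun (c • f) x v = c * dFun f x v := by
      simp only [dFun, h]; rfl
    have e' : (c • α).1 x v = c * α.1 x v := rfl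
    rw [e', hα]
    simp only [dTwistFun, e, Pi.smul_apply, smul_eq_mul]
    ring

/-- The first Lichnerowicz cohomology `H¹_ω(M) = Z¹_ω(M) / B¹_ω(M)`, with the quotient of the `C^∞`
topology. -/
abbrev H1 : Type _ := L.cocycles ⧸ L.coboundaries

/-! ### Locally conformally symplectic vector fields and the kernel of `Φ` -/

/-- `X` is a smooth vector field and `f` a smooth function with `L_X Ω = -f Ω` and `L_X ω = df`.
Lie derivatives of forms are given by Cartan's formula `L_X = d i_X + i_X d`. -/
structure IsLCSField (X : ∀ x : M, TangentSpace (𝓡 m) x) (f : M → ℝ) : Prop where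
  smooth_field : ContMDiff (𝓡 m) (𝓡 m).tangent ∞
    (fun x => (⟨x, X x⟩ : TangentBundle (𝓡 m) M))
  smooth_factor : ContMDiff (𝓡 m) 𝓘(ℝ, ℝ) ∞ f
  lie_form : ∀ (x : M) (u v : TangentSpace (𝓡 m) x),
    dOne (fun y => L.form y (X y)) x u v + dTwo L.form x (X x) u v = -(f x * L.form x u v)
  lie_lee : ∀ (x : M) (v : TangentSpace (𝓡 m) x),
    dFun (fun y => L.lee y (X y)) x v + dOne L.lee x (X x) v = dFun f x v

/-- The kernel of the extended Lee homomorphism `Φ`, which sends an LCS field `X` with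
infinitesimal conformality factor `f` to the locally constant function `Φ(X) = ω(X) - f`. -/
def kerPhi : Set (∀ x : M, TangentSpace (𝓡 m) x) :=
  {X | ∃ f : M → ℝ, L.IsLCSField X f ∧ ∀ x, L.lee x (X x) - f x = 0}

/-- The time-dependent vector field `X_t` generating a family of diffeomorphisms `g_t`,
`(d/dt) g_t = X_t ∘ g_t`; that is, `X_t(x)` is the derivative at time `t` of
`s ↦ g_s (g_t⁻¹ x)`. -/
noncomputable def velocity (g : ℝ → (M ≃ₘ⟮𝓡 m, 𝓡 m⟯ M)) (t : ℝ) (x : M) :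
    TangentSpace (𝓡 m) x :=
  mfderiv 𝓘(ℝ, ℝ) (𝓡 m) (fun s => g s ((g t).symm x)) t (1 : ℝ)

/-- A smooth isotopy `g_t` starting at the identity and generated by fields `X_t ∈ ker Φ`.
The time parameter runs over `ℝ`; only the path over `[0, 1]` matters, and every isotopy over
`[0, 1]` becomes one over `ℝ`, with the same endpoint and flux, after a smooth reparametrization
which is constant outside `[0, 1]`. The smoothness of the inverses is automatic. -/
structure KerPhiIsotopy where
  /-- the diffeomorphism `g_t` -/
  toFun : ℝ → (M ≃ₘ⟮𝓡 m, 𝓡 m⟯ M)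
  smooth : ContMDiff (𝓘(ℝ, ℝ).prod (𝓡 m)) (𝓡 m) ∞ (fun p : ℝ × M => toFun p.1 p.2)
  smooth_symm : ContMDiff (𝓘(ℝ, ℝ).prod (𝓡 m)) (𝓡 m) ∞
    (fun p : ℝ × M => (toFun p.1).symm p.2)
  start : toFun 0 = 1
  velocity_mem : ∀ t, velocity toFun t ∈ L.kerPhi

/-- The `C^∞` topology on isotopies: `C^∞` convergence on compact sets of the maps
`(t, x) ↦ g_t x` and `(t, x) ↦ g_t⁻¹ x`. (The second follows from the first.) -/
noncomputable instance : TopologicalSpace L.KerPhiIsotopy :=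
  (smoothTopology (𝓘(ℝ, ℝ).prod (𝓡 m)) (𝓡 m) (ℝ × M) M).induced
      (fun γ p => γ.toFun p.1 p.2) ⊓
    (smoothTopology (𝓘(ℝ, ℝ).prod (𝓡 m)) (𝓡 m) (ℝ × M) M).induced
      (fun γ p => (γ.toFun p.1).symm p.2)

/-! ### The group `(ker Φ)_0` -/

/-- The group `(ker Φ)_0`, the connected group of diffeomorphisms with Lie algebra `ker Φ`: it is
generated by (and in fact consists of) the endpoints of the isotopies generated by `ker Φ`. -/
noncomputable def kerPhiGroup : Subgroup (M ≃ₘ⟮𝓡 m, 𝓡 m⟯ M) :=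
  Subgroup.closure (Set.range fun γ : L.KerPhiIsotopy => γ.toFun 1)

/-- The evaluation `ev₁ : {g_t} ↦ g_1`. -/
noncomputable def evOne (γ : L.KerPhiIsotopy) : L.kerPhiGroup :=
  ⟨γ.toFun 1, Subgroup.subset_closure ⟨γ, rfl⟩⟩

/-- The topology of `(ker Φ)_0`: the quotient of the `C^∞` topology on isotopies under `ev₁`. -/
noncomputable instance : TopologicalSpace L.kerPhiGroup :=
  TopologicalSpace.coinduced L.evOne inferInstance

/-! ### Flux, periods and Hamiltonian diffeomorphisms -/

open Classical in
/-- The flux `Ψ̃({g_t}) = [∫₀¹ i_{X_t} Ω dt]_ω ∈ H¹_ω(M)` of an isotopy. (The integrated form is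
always a smooth `d^ω`-closed 1-form; the alternative `0` never occurs.) -/
noncomputable def pathFlux (γ : L.KerPhiIsotopy) : L.H1 :=
  if h : ∃ α : L.cocycles, ∀ (x : M) (v : TangentSpace (𝓡 m) x),
      α.1 x v = ∫ t in (0 : ℝ)..1, L.form x (velocity γ.toFun t x) v
  then L.coboundaries.mkQ h.choose else 0

/-- The period group `Δ`: the fluxes of loops in `(ker Φ)_0` based at the identity. (These fluxes
form a group, so that taking the generated subgroup adds nothing.) -/
noncomputable def periodGroup : AddSubgroup L.H1 :=
  AddSubgroup.closure {c | ∃ γ : L.KerPhiIsotopy, γ.toFun 1 = 1 ∧ L.pathFlux γ = c}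

/-- `Δ` is discrete: some neighbourhood of `0` in `H¹_ω(M)` meets it only in `0`. -/
def HasDiscretePeriods : Prop :=
  ∃ U : Set L.H1, IsOpen U ∧ (0 : L.H1) ∈ U ∧ U ∩ (L.periodGroup : Set L.H1) = {0}

/-- `Ham_Ω(M)`: the endpoints of isotopies with zero flux. (They form a group, so that taking the
generated subgroup adds nothing.) -/
noncomputable def Ham : Subgroup L.kerPhiGroup :=
  Subgroup.closure {g | ∃ γ : L.KerPhiIsotopy, L.pathFlux γ = 0 ∧ L.evOne γ = g}

open Classical in
/-- The induced flux `F : (ker Φ)_0 → H¹_ω(M)/Δ`, the class modulo `Δ` of the flux of any isotopy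
from the identity to `g`. (Such an isotopy always exists; the alternative `0` never occurs.) -/
noncomputable def flux (g : L.kerPhiGroup) : L.H1 ⧸ L.periodGroup :=
  if h : ∃ γ : L.KerPhiIsotopy, L.evOne γ = g
  then QuotientAddGroup.mk (L.pathFlux h.choose) else 0

end LCSStructure

/-!
The whole statement follows from four facts about `G = (ker Φ)_0` with its quotient topology: it
is a topological group, it consists of endpoints of isotopies, the flux `F : G → H¹_ω(M)/Δ` is a
continuous homomorphism, and `Ham_Ω(M)` is the kernel of `F`. Given these, `Ham_Ω(M)` is normal,
and for a continuous section `s` the map `g ↦ (g s(F g)⁻¹, s(F g))` is a continuous inverse of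
`(h, k) ↦ h k` (`LCSStructure.isHomeomorph_mul_of_section`). If `s` is multiplicative, its image is
a complement of the kernel and the same map is the semidirect product decomposition.

*The topological group.* Isotopies form a topological group `P` under pointwise composition, and
`ev₁ : P → G` is a surjective homomorphism and a quotient map, hence open, so that `G` inherits
continuous operations. That `P` is closed under products, inverses and reparametrization is not
visible from the condition `X_t ∈ ker Φ` on velocities. It becomes so through the notion of a
conformal path (`LCSStructure.IsConformalPath`): a path `g_t` together with a function `φ` on
`ℝ × M` such that `g_t^* Ω = e^{φ_t} Ω` and `dφ = ω - G^* ω`, where `G(t, x) = g_t x`. These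
conditions are plainly stable under the operations, with the cocycle rule for `φ`. By Cartan's
formula for `d/dt g_t^*`, the velocities of a conformal path lie in `ker Φ`; conversely an isotopy
generated by `ker Φ` is conformal with `φ(t, x) = -∫₀ᵗ ω(X_s)(g_s x) ds`
(`LCSStructure.isConformalPath_potential`). Continuity of the operations is continuity of
composition of smooth maps in the `C^∞` compact-open topology, which by induction on the order
of the tangent functor reduces to the compact-open topology.

*The flux.* For `X ∈ ker Φ` the form `i_X Ω` is `d^ω`-closed, and differentiation under the
integral sign shows that `∫₀¹ i_{X_t} Ω dt` is a smooth closed form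
(`LCSStructure.KerPhiIsotopy.fluxForm`). It depends continuously on the isotopy, because the
velocity is obtained from the isotopy and its inverse by tangent maps and compositions, and
integration over time is continuous for the `C^∞` topology. Reversing an isotopy changes the sign
of its flux; running two isotopies one after the other, with a smooth reparametrization that makes
each constant while the other moves, adds their fluxes and multiplies their endpoints. Hence
fluxes of loops form a group, the flux modulo `Δ` depends only on the endpoint and is a
homomorphism, and an element of its kernel can be joined to the identity with zero flux, after
correction by a loop. Continuity of `F` is that of the flux on `P`, because `ev₁` is a quotient
map.
-/

open scoped Topology

/-! ### The `C^∞` compact-open topology and smooth families of maps -/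

section CkFamilies

theorem continuous_ckTopology_zero_iff {Z : Type*} [TopologicalSpace Z]
    {E : Type} [NormedAddCommGroup E] [NormedSpace ℝ E] {H : Type} [TopologicalSpace H]
    (I : ModelWithCorners ℝ E H) {E' : Type} [NormedAddCommGroup E'] [NormedSpace ℝ E']
    {H' : Type} [TopologicalSpace H'] (I' : ModelWithCorners ℝ E' H')
    {N : Type*} [TopologicalSpace N] [ChartedSpace H N] [IsManifold I ∞ N]
    {N' : Type*} [TopologicalSpace N'] [ChartedSpace H' N'] [IsManifold I' ∞ N']
    (f : Z → C(N, N')) :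
    Continuous[_, ckTopology 0 I I' N N'] (fun z => (f z : N → N')) ↔ Continuous f := by
  rw [ckTopology, continuous_generateFrom_iff, ContinuousMap.continuous_compactOpen]
  constructor
  · intro h K hK U hU
    exact h _ ⟨K, U, hK, hU, rfl⟩
  · rintro h _ ⟨K, U, hK, hU, rfl⟩
    exact h K hK U hU

theorem continuous_ckTopology_succ_iff {Z : Type*} [TopologicalSpace Z]
    {E : Type} [NormedAddCommGroup E] [NormedSpace ℝ E] {H : Type} [TopologicalSpace H]
    (I : ModelWithCorners ℝ E H) {E' : Type} [NormedAddCommGroup E'] [NormedSpace ℝ E']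
    {H' : Type} [TopologicalSpace H'] (I' : ModelWithCorners ℝ E' H')
    {N : Type*} [TopologicalSpace N] [ChartedSpace H N] [IsManifold I ∞ N]
    {N' : Type*} [TopologicalSpace N'] [ChartedSpace H' N'] [IsManifold I' ∞ N']
    (k : ℕ) (f : Z → N → N') :
    Continuous[_, ckTopology (k + 1) I I' N N'] f ↔
      Continuous[_, ckTopology k I.tangent I'.tangent (TangentBundle I N) (TangentBundle I' N')]
        (fun z => tangentMap I I' (f z)) := by
  rw [ckTopology, continuous_induced_rng]
  rfl

/-- Composition is continuous for the `C^k` compact-open topology. The tangent functor preserves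
composition, so this reduces to the compact-open topology, where it holds because the middle space
is locally compact. -/
theorem continuous_ckTopology_comp (k : ℕ) : ∀ {Z : Type*} [TopologicalSpace Z]
    {E : Type} [NormedAddCommGroup E] [NormedSpace ℝ E] {H : Type} [TopologicalSpace H]
    {I : ModelWithCorners ℝ E H} {E' : Type} [NormedAddCommGroup E'] [NormedSpace ℝ E']
    [FiniteDimensional ℝ E']
    {H' : Type} [TopologicalSpace H'] {I' : ModelWithCorners ℝ E' H'}
    {E'' : Type} [NormedAddCommGroup E''] [NormedSpace ℝ E'']
    {H'' : Type} [TopologicalSpace H''] {I'' : ModelWithCorners ℝ E'' H''}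
    {N : Type*} [TopologicalSpace N] [ChartedSpace H N] [IsManifold I ∞ N]
    {N' : Type*} [TopologicalSpace N'] [ChartedSpace H' N'] [IsManifold I' ∞ N']
    {N'' : Type*} [TopologicalSpace N''] [ChartedSpace H'' N''] [IsManifold I'' ∞ N'']
    {g : Z → N' → N''} {f : Z → N → N'},
    (∀ z, ContMDiff I' I'' ∞ (g z)) → (∀ z, ContMDiff I I' ∞ (f z)) →
    Continuous[_, ckTopology k I' I'' N' N''] g → Continuous[_, ckTopology k I I' N N'] f →
    Continuous[_, ckTopology k I I'' N N''] (fun z => g z ∘ f z) := by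
  induction k with
  | zero =>
    intro Z _ E _ _ H _ I E' _ _ _ H' _ I' E'' _ _ H'' _ I'' N _ _ _ N' _ _ _ N'' _ _ _ g f
      hg hf cg cf
    have := Manifold.locallyCompact_of_finiteDimensional (M := N') I'
    let g' : Z → C(N', N'') := fun z => ⟨g z, (hg z).continuous⟩
    let f' : Z → C(N, N') := fun z => ⟨f z, (hf z).continuous⟩
    have cg' : Continuous g' := (continuous_ckTopology_zero_iff I' I'' g').1 cg
    have cf' : Continuous f' := (continuous_ckTopology_zero_iff I I' f').1 cf
    exact (continuous_ckTopology_zero_iff I I'' (fun z => (g' z).comp (f' z))).2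
      (cg'.compCM cf')
  | succ k ih =>
    intro Z _ E _ _ H _ I E' _ _ _ H' _ I' E'' _ _ H'' _ I'' N _ _ _ N' _ _ _ N'' _ _ _ g f
      hg hf cg cf
    rw [continuous_ckTopology_succ_iff] at cg cf ⊢
    have e : (fun z => tangentMap I I'' (g z ∘ f z)) =
        fun z => tangentMap I' I'' (g z) ∘ tangentMap I I' (f z) := by
      funext z
      exact tangentMap_comp ((hg z).mdifferentiable (by simp)) ((hf z).mdifferentiable (by simp))
    rw [e]
    exact ih (fun z => (hg z).contMDiff_tangentMap le_rfl)
      (fun z => (hf z).contMDiff_tangentMap le_rfl) cg cf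

/-- Under `T(N' × N'') = TN' × TN''`, the tangent map of a pair is the pair of tangent maps. -/
theorem tangentMap_pair {E : Type} [NormedAddCommGroup E] [NormedSpace ℝ E] {H : Type}
    [TopologicalSpace H]
    {I : ModelWithCorners ℝ E H} {E' : Type} [NormedAddCommGroup E'] [NormedSpace ℝ E']
    {H' : Type} [TopologicalSpace H'] {I' : ModelWithCorners ℝ E' H'}
    {E'' : Type} [NormedAddCommGroup E''] [NormedSpace ℝ E'']
    {H'' : Type} [TopologicalSpace H''] {I'' : ModelWithCorners ℝ E'' H''}
    {N : Type*} [TopologicalSpace N] [ChartedSpace H N]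
    {N' : Type*} [TopologicalSpace N'] [ChartedSpace H' N'] [IsManifold I' 1 N']
    {N'' : Type*} [TopologicalSpace N''] [ChartedSpace H'' N''] [IsManifold I'' 1 N'']
    {f : N → N'} {g : N → N''} (hf : MDifferentiable I I' f) (hg : MDifferentiable I I'' g) :
    tangentMap I (I'.prod I'') (fun x => (f x, g x)) =
      (equivTangentBundleProd I' N' I'' N'').symm ∘
        fun p => (tangentMap I I' f p, tangentMap I I'' g p) := by
  funext p
  simp only [tangentMap, Function.comp]
  rw [mfderiv_prodMk (hf p.1) (hg p.1)]
  rfl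

theorem continuous_ckTopology_prodMk (k : ℕ) : ∀ {Z : Type*} [TopologicalSpace Z]
    {E : Type} [NormedAddCommGroup E] [NormedSpace ℝ E] [FiniteDimensional ℝ E] {H : Type}
    [TopologicalSpace H] {I : ModelWithCorners ℝ E H} {E' : Type} [NormedAddCommGroup E']
    [NormedSpace ℝ E']
    [FiniteDimensional ℝ E']
    {H' : Type} [TopologicalSpace H'] {I' : ModelWithCorners ℝ E' H'}
    {E'' : Type} [NormedAddCommGroup E''] [NormedSpace ℝ E''] [FiniteDimensional ℝ E'']
    {H'' : Type} [TopologicalSpace H''] {I'' : ModelWithCorners ℝ E'' H''}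
    {N : Type*} [TopologicalSpace N] [ChartedSpace H N] [IsManifold I ∞ N]
    {N' : Type*} [TopologicalSpace N'] [ChartedSpace H' N'] [IsManifold I' ∞ N']
    {N'' : Type*} [TopologicalSpace N''] [ChartedSpace H'' N''] [IsManifold I'' ∞ N'']
    {f : Z → N → N'} {g : Z → N → N''},
    (∀ z, ContMDiff I I' ∞ (f z)) → (∀ z, ContMDiff I I'' ∞ (g z)) →
    Continuous[_, ckTopology k I I' N N'] f → Continuous[_, ckTopology k I I'' N N''] g →
    Continuous[_, ckTopology k I (I'.prod I'') N (N' × N'')] (fun z x => (f z x, g z x)) := by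
  induction k with
  | zero =>
    intro Z _ E _ _ _ H _ I E' _ _ _ H' _ I' E'' _ _ _ H'' _ I'' N _ _ _ N' _ _ _ N'' _ _ _ f g
      hf hg cf cg
    let f' : Z → C(N, N') := fun z => ⟨f z, (hf z).continuous⟩
    let g' : Z → C(N, N'') := fun z => ⟨g z, (hg z).continuous⟩
    have cf' : Continuous f' := (continuous_ckTopology_zero_iff I I' f').1 cf
    have cg' : Continuous g' := (continuous_ckTopology_zero_iff I I'' g').1 cg
    have := Manifold.locallyCompact_of_finiteDimensional (M := N) I
    refine (continuous_ckTopology_zero_iff I (I'.prod I'') (fun z => (f' z).prodMk (g' z))).2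
      (ContinuousMap.continuous_of_continuous_uncurry _ ?_)
    exact (continuous_eval.comp (cf'.prodMap continuous_id)).prodMk
      (continuous_eval.comp (cg'.prodMap continuous_id))
  | succ k ih =>
    intro Z _ E _ _ _ H _ I E' _ _ _ H' _ I' E'' _ _ _ H'' _ I'' N _ _ _ N' _ _ _ N'' _ _ _ f g
      hf hg cf cg
    rw [continuous_ckTopology_succ_iff] at cf cg ⊢
    have e : (fun z => tangentMap I (I'.prod I'') (fun x => (f z x, g z x))) =
        fun z => (equivTangentBundleProd I' N' I'' N'').symm ∘
          (fun p => (tangentMap I I' (f z) p, tangentMap I I'' (g z) p)) := by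
      funext z
      exact tangentMap_pair ((hf z).mdifferentiable (by simp))
        ((hg z).mdifferentiable (by simp))
    rw [e]
    have h1 := fun z => (hf z).contMDiff_tangentMap (m := ∞) le_rfl
    have h2 := fun z => (hg z).contMDiff_tangentMap (m := ∞) le_rfl
    exact continuous_ckTopology_comp k (fun _ => contMDiff_equivTangentBundleProd_symm)
      (fun z => (h1 z).prodMk (h2 z)) (@continuous_const _ _ _ (_) _) (ih h1 h2 cf cg)

end CkFamilies

section SmoothFamilies

/-- A family `f z : N → N'` of smooth maps depending on a parameter `z`, continuously for the
`C^∞` compact-open topology. -/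
structure IsSmoothFamily {Z : Type*} [TopologicalSpace Z]
    {E : Type} [NormedAddCommGroup E] [NormedSpace ℝ E] {H : Type} [TopologicalSpace H]
    (I : ModelWithCorners ℝ E H) {E' : Type} [NormedAddCommGroup E'] [NormedSpace ℝ E']
    {H' : Type} [TopologicalSpace H'] (I' : ModelWithCorners ℝ E' H')
    {N : Type*} [TopologicalSpace N] [ChartedSpace H N] [IsManifold I ∞ N]
    {N' : Type*} [TopologicalSpace N'] [ChartedSpace H' N'] [IsManifold I' ∞ N']
    (f : Z → N → N') : Prop where
  smooth : ∀ z, ContMDiff I I' ∞ (f z)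
  continuous : Continuous[_, smoothTopology I I' N N'] f

variable {Z : Type*} [TopologicalSpace Z]
  {E : Type} [NormedAddCommGroup E] [NormedSpace ℝ E] [FiniteDimensional ℝ E]
  {H : Type} [TopologicalSpace H] {I : ModelWithCorners ℝ E H}
  {E' : Type} [NormedAddCommGroup E'] [NormedSpace ℝ E'] [FiniteDimensional ℝ E']
  {H' : Type} [TopologicalSpace H'] {I' : ModelWithCorners ℝ E' H'}
  {E'' : Type} [NormedAddCommGroup E''] [NormedSpace ℝ E''] [FiniteDimensional ℝ E'']
  {H'' : Type} [TopologicalSpace H''] {I'' : ModelWithCorners ℝ E'' H''}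
  {N : Type*} [TopologicalSpace N] [ChartedSpace H N] [IsManifold I ∞ N]
  {N' : Type*} [TopologicalSpace N'] [ChartedSpace H' N'] [IsManifold I' ∞ N']
  {N'' : Type*} [TopologicalSpace N''] [ChartedSpace H'' N''] [IsManifold I'' ∞ N'']

omit [FiniteDimensional ℝ E] [FiniteDimensional ℝ E'] in
theorem continuous_smoothTopology_iff {f : Z → N → N'} :
    Continuous[_, smoothTopology I I' N N'] f ↔
      ∀ k, Continuous[_, ckTopology k I I' N N'] f :=
  continuous_iInf_rng

namespace IsSmoothFamily

omit [FiniteDimensional ℝ E] [FiniteDimensional ℝ E'] in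
theorem const {f : N → N'} (hf : ContMDiff I I' ∞ f) :
    IsSmoothFamily I I' (fun _ : Z => f) :=
  ⟨fun _ => hf, @continuous_const _ _ _ (_) _⟩

omit [FiniteDimensional ℝ E] [FiniteDimensional ℝ E''] in
theorem comp {g : Z → N' → N''} {f : Z → N → N'} (hg : IsSmoothFamily I' I'' g)
    (hf : IsSmoothFamily I I' f) : IsSmoothFamily I I'' (fun z => g z ∘ f z) where
  smooth z := (hg.smooth z).comp (hf.smooth z)
  continuous := continuous_smoothTopology_iff.2 fun k =>
    continuous_ckTopology_comp k hg.smooth hf.smooth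
      (continuous_smoothTopology_iff.1 hg.continuous k)
      (continuous_smoothTopology_iff.1 hf.continuous k)

theorem prodMk {f : Z → N → N'} {g : Z → N → N''} (hf : IsSmoothFamily I I' f)
    (hg : IsSmoothFamily I I'' g) :
    IsSmoothFamily I (I'.prod I'') (fun z x => (f z x, g z x)) where
  smooth z := (hf.smooth z).prodMk (hg.smooth z)
  continuous := continuous_smoothTopology_iff.2 fun k =>
    continuous_ckTopology_prodMk k hf.smooth hg.smooth
      (continuous_smoothTopology_iff.1 hf.continuous k)
      (continuous_smoothTopology_iff.1 hg.continuous k)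

omit [FiniteDimensional ℝ E] [FiniteDimensional ℝ E'] in
theorem tangentMap {f : Z → N → N'} (hf : IsSmoothFamily I I' f) :
    IsSmoothFamily I.tangent I'.tangent (fun z => tangentMap I I' (f z)) where
  smooth z := (hf.smooth z).contMDiff_tangentMap le_rfl
  continuous := continuous_smoothTopology_iff.2 fun k =>
    (continuous_ckTopology_succ_iff I I' k f).1
      (continuous_smoothTopology_iff.1 hf.continuous (k + 1))

omit [FiniteDimensional ℝ E] [FiniteDimensional ℝ E'] in
theorem precomp {Z' : Type*} [TopologicalSpace Z'] {f : Z → N → N'}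
    (hf : IsSmoothFamily I I' f) {r : Z' → Z} (hr : Continuous r) :
    IsSmoothFamily I I' (fun z => f (r z)) where
  smooth z := hf.smooth (r z)
  continuous := @Continuous.comp _ _ _ _ _ (_) _ _ hf.continuous hr

end IsSmoothFamily

end SmoothFamilies

/-! ### Integrals depending smoothly on a parameter -/

section ParametricIntegral

universe u

variable {E : Type u} [NormedAddCommGroup E] [NormedSpace ℝ E] [FiniteDimensional ℝ E]

/-- Differentiation under the integral sign. -/
theorem hasFDerivAt_intervalIntegral_of_contDiffOn
    {F : Type*} [NormedAddCommGroup F] [NormedSpace ℝ F] [CompleteSpace F] {U : Set E}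
    (hU : IsOpen U) {c : ℝ × E → F} (hc : ContDiffOn ℝ 1 c (Set.univ ×ˢ U)) (a b : ℝ) {x : E}
    (hx : x ∈ U) :
    HasFDerivAt (fun y => ∫ t in a..b, c (t, y))
      (∫ t in a..b, (fderiv ℝ c (t, x)).comp (ContinuousLinearMap.inr ℝ ℝ E)) x := by
  have hopen : IsOpen ((Set.univ : Set ℝ) ×ˢ U) := isOpen_univ.prod hU
  have hcont : ContinuousOn c (Set.univ ×ˢ U) := hc.continuousOn
  have hderiv : ContinuousOn
      (fun p => (fderiv ℝ c p).comp (ContinuousLinearMap.inr ℝ ℝ E)) (Set.univ ×ˢ U) :=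
    (hc.continuousOn_fderiv_of_isOpen hopen le_rfl).clm_comp continuousOn_const
  have hslice : ∀ y ∈ U, Continuous fun t : ℝ => (t, y) := fun y _ => by fun_prop
  obtain ⟨ε, hε, hball⟩ := Metric.nhds_basis_closedBall.mem_iff.1 (hU.mem_nhds hx)
  have hK : IsCompact (Set.uIcc a b ×ˢ Metric.closedBall x ε) :=
    isCompact_uIcc.prod (isCompact_closedBall x ε)
  obtain ⟨C, hC⟩ := hK.exists_bound_of_continuousOn
    (hderiv.mono (Set.prod_mono (Set.subset_univ _) hball))
  have hs : ∀ y ∈ U, Continuous fun t => c (t, y) := fun y hy =>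
    hcont.comp_continuous (hslice y hy) fun t => ⟨trivial, hy⟩
  have hs' : Continuous fun t => (fderiv ℝ c (t, x)).comp (ContinuousLinearMap.inr ℝ ℝ E) :=
    hderiv.comp_continuous (hslice x hx) fun t => ⟨trivial, hx⟩
  refine intervalIntegral.hasFDerivAt_integral_of_dominated_of_fderiv_le
    (F' := fun y t => (fderiv ℝ c (t, y)).comp (ContinuousLinearMap.inr ℝ ℝ E))
    (bound := fun _ => C) (Metric.closedBall_mem_nhds x hε) ?_ ?_ ?_ ?_ ?_ ?_
  · filter_upwards [hU.mem_nhds hx] with y hy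
    exact (hs y hy).aestronglyMeasurable
  · exact (hs x hx).intervalIntegrable _ _
  · exact hs'.aestronglyMeasurable
  · exact Filter.Eventually.of_forall fun t ht y hy => hC (t, y) ⟨Set.uIoc_subset_uIcc ht, hy⟩
  · exact intervalIntegrable_const
  · refine Filter.Eventually.of_forall fun t _ y hy => ?_
    have h1 : HasFDerivAt c (fderiv ℝ c (t, y)) (t, y) :=
      ((hc.contDiffAt (hopen.mem_nhds ⟨trivial, hball hy⟩)).differentiableAt
        (by simp)).hasFDerivAt
    exact h1.comp y (hasFDerivAt_prodMk_right t y)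

/-- The induction quantifies over the target `F`, since the derivative takes values in
`E →L[ℝ] F`. -/
theorem contDiffOn_intervalIntegral_nat (n : ℕ) :
    ∀ {F : Type u} [NormedAddCommGroup F] [NormedSpace ℝ F] [CompleteSpace F] {U : Set E}
    (_ : IsOpen U) {c : ℝ × E → F} (_ : ContDiffOn ℝ ∞ c (Set.univ ×ˢ U)) (a b : ℝ),
    ContDiffOn ℝ n (fun y => ∫ t in a..b, c (t, y)) U := by
  induction n with
  | zero =>
    intro F _ _ _ U hU c hc a b
    refine contDiffOn_zero.2 fun x hx => ?_
    exact (hasFDerivAt_intervalIntegral_of_contDiffOn hU (hc.of_le (by simp)) a b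
      hx).continuousAt.continuousWithinAt
  | succ n ih =>
    intro F _ _ _ U hU c hc a b
    have hopen : IsOpen ((Set.univ : Set ℝ) ×ˢ U) := isOpen_univ.prod hU
    have hd : ∀ x ∈ U, HasFDerivAt (fun y => ∫ t in a..b, c (t, y))
        (∫ t in a..b, (fderiv ℝ c (t, x)).comp (ContinuousLinearMap.inr ℝ ℝ E)) x := fun x hx =>
      hasFDerivAt_intervalIntegral_of_contDiffOn hU (hc.of_le (by simp)) a b hx
    push_cast
    rw [contDiffOn_succ_iff_fderiv_of_isOpen hU]
    refine ⟨fun x hx => (hd x hx).differentiableAt.differentiableWithinAt, by simp, ?_⟩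
    have hc' : ContDiffOn ℝ ∞ (fun p => (fderiv ℝ c p).comp (ContinuousLinearMap.inr ℝ ℝ E))
        (Set.univ ×ˢ U) :=
      (hc.fderiv_of_isOpen hopen le_rfl).clm_comp contDiffOn_const
    exact (ih hU hc' a b).congr fun x hx => (hd x hx).fderiv

theorem contDiffOn_intervalIntegral
    {F : Type u} [NormedAddCommGroup F] [NormedSpace ℝ F] [CompleteSpace F] {U : Set E}
    (hU : IsOpen U) {c : ℝ × E → F} (hc : ContDiffOn ℝ ∞ c (Set.univ ×ˢ U)) (a b : ℝ) :
    ContDiffOn ℝ ∞ (fun y => ∫ t in a..b, c (t, y)) U :=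
  contDiffOn_infty.2 fun n => contDiffOn_intervalIntegral_nat n hU hc a b

section Manifold

variable {E : Type} [NormedAddCommGroup E] [NormedSpace ℝ E] [FiniteDimensional ℝ E]
  {H : Type} [TopologicalSpace H] {I : ModelWithCorners ℝ E H} [I.Boundaryless]
  {N : Type*} [TopologicalSpace N] [ChartedSpace H N] [IsManifold I ∞ N]

omit [FiniteDimensional ℝ E] [I.Boundaryless] in
/-- In the chart around `x`, a function on `ℝ × U` stays smooth. -/
theorem contDiffOn_extChartAt_symm_of_contMDiffOn {c : ℝ × N → ℝ} {U : Set N}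
    (hc : ContMDiffOn (𝓘(ℝ, ℝ).prod I) 𝓘(ℝ, ℝ) ∞ c (Set.univ ×ˢ U)) (x : N) :
    ContDiffOn ℝ ∞ (fun q : ℝ × E => c (q.1, (extChartAt I x).symm q.2))
      (Set.univ ×ˢ ((extChartAt I x).target ∩ (extChartAt I x).symm ⁻¹' U)) := by
  have h : ContMDiffOn 𝓘(ℝ, ℝ × E) (𝓘(ℝ, ℝ).prod I) ∞
      (fun q : ℝ × E => (q.1, (extChartAt I x).symm q.2))
      (Set.univ ×ˢ ((extChartAt I x).target ∩ (extChartAt I x).symm ⁻¹' U)) := by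
    refine ContMDiffOn.prodMk contDiff_fst.contMDiff.contMDiffOn ?_
    exact (contMDiffOn_extChartAt_symm x).comp contDiff_snd.contMDiff.contMDiffOn
      fun q hq => hq.2.1
  exact (hc.comp h fun q hq => ⟨trivial, hq.2.2⟩).contDiffOn

theorem contMDiffOn_intervalIntegral {c : ℝ × N → ℝ} {U : Set N} (hU : IsOpen U)
    (hc : ContMDiffOn (𝓘(ℝ, ℝ).prod I) 𝓘(ℝ, ℝ) ∞ c (Set.univ ×ˢ U)) (a b : ℝ) :
    ContMDiffOn I 𝓘(ℝ, ℝ) ∞ (fun x => ∫ t in a..b, c (t, x)) U := by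
  intro x hx
  refine ContMDiffAt.contMDiffWithinAt ?_
  have hV : IsOpen ((extChartAt I x).target ∩ (extChartAt I x).symm ⁻¹' U) :=
    (continuousOn_extChartAt_symm x).isOpen_inter_preimage (isOpen_extChartAt_target x) hU
  have hxV : extChartAt I x x ∈ (extChartAt I x).target ∩ (extChartAt I x).symm ⁻¹' U :=
    ⟨mem_extChartAt_target x, by simpa using hx⟩
  have h := contDiffOn_intervalIntegral hV (contDiffOn_extChartAt_symm_of_contMDiffOn hc x) a b
  have h2 := (h.contDiffAt (hV.mem_nhds hxV)).contMDiffAt.comp x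
    (contMDiffAt_extChartAt (I := I) (n := ∞))
  refine h2.congr_of_eventuallyEq ?_
  filter_upwards [extChartAt_source_mem_nhds (I := I) x] with y hy
  simp only [Function.comp, (extChartAt I x).left_inv hy]

/-- Differentiation under the integral sign on a manifold. -/
theorem mfderiv_intervalIntegral {c : ℝ × N → ℝ}
    (hc : ContMDiff (𝓘(ℝ, ℝ).prod I) 𝓘(ℝ, ℝ) ∞ c) (a b : ℝ) (x : N) (v : TangentSpace I x) :
    (mfderiv I 𝓘(ℝ, ℝ) (fun y => ∫ t in a..b, c (t, y)) x v : ℝ) =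
      ∫ t in a..b, (mfderiv I 𝓘(ℝ, ℝ) (fun y => c (t, y)) x v : ℝ) := by
  have hV : IsOpen (extChartAt I x).target := isOpen_extChartAt_target x
  have hxV := mem_extChartAt_target (I := I) x
  have hc' : ContDiffOn ℝ ∞ (fun q : ℝ × E => c (q.1, (extChartAt I x).symm q.2))
      (Set.univ ×ˢ (extChartAt I x).target) := by
    simpa using contDiffOn_extChartAt_symm_of_contMDiffOn (U := Set.univ)
      (by simpa using hc.contMDiffOn) x
  set c' : ℝ × E → ℝ := fun q : ℝ × E => c (q.1, (extChartAt I x).symm q.2) with hc'_def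
  have hopen : IsOpen ((Set.univ : Set ℝ) ×ˢ (extChartAt I x).target) := isOpen_univ.prod hV
  have hd := hasFDerivAt_intervalIntegral_of_contDiffOn hV (hc'.of_le (by simp)) a b hxV
  have hφ : HasMFDerivAt I 𝓘(ℝ, E) (extChartAt I x) x (mfderiv I 𝓘(ℝ, E) (extChartAt I x) x) :=
    (mdifferentiableAt_extChartAt (mem_chart_source H x)).hasMFDerivAt
  have hev : ∀ᶠ y in 𝓝 x, (extChartAt I x).symm (extChartAt I x y) = y := by
    filter_upwards [extChartAt_source_mem_nhds (I := I) x] with y hy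
    exact (extChartAt I x).left_inv hy
  have h1 : mfderiv I 𝓘(ℝ, ℝ) (fun y => ∫ t in a..b, c (t, y)) x =
      (∫ t in a..b, (fderiv ℝ c' (t, extChartAt I x x)).comp
        (ContinuousLinearMap.inr ℝ ℝ E)).comp (mfderiv I 𝓘(ℝ, E) (extChartAt I x) x) := by
    refine ((hd.hasMFDerivAt.comp x hφ).congr_of_eventuallyEq ?_).mfderiv
    filter_upwards [hev] with y hy
    simp only [Function.comp, hc'_def, hy]
  have h2 : ∀ t, mfderiv I 𝓘(ℝ, ℝ) (fun y => c (t, y)) x =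
      ((fderiv ℝ c' (t, extChartAt I x x)).comp
        (ContinuousLinearMap.inr ℝ ℝ E)).comp (mfderiv I 𝓘(ℝ, E) (extChartAt I x) x) := by
    intro t
    have h3 : HasFDerivAt (fun y => c' (t, y)) ((fderiv ℝ c' (t, extChartAt I x x)).comp
        (ContinuousLinearMap.inr ℝ ℝ E)) (extChartAt I x x) :=
      ((hc'.contDiffAt (hopen.mem_nhds ⟨trivial, hxV⟩)).differentiableAt
        (by simp)).hasFDerivAt.comp _ (hasFDerivAt_prodMk_right t _)
    refine ((h3.hasMFDerivAt.comp x hφ).congr_of_eventuallyEq ?_).mfderiv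
    filter_upwards [hev] with y hy
    simp only [Function.comp, hc'_def, hy]
  have hcont : Continuous fun t => (fderiv ℝ c' (t, extChartAt I x x)).comp
      (ContinuousLinearMap.inr ℝ ℝ E) :=
    ((hc'.continuousOn_fderiv_of_isOpen hopen (by simp)).clm_comp
      continuousOn_const).comp_continuous (by fun_prop) fun t => ⟨trivial, hxV⟩
  simp only [h1, h2]
  exact ContinuousLinearMap.intervalIntegral_apply (hcont.intervalIntegrable _ _) _

end Manifold

end ParametricIntegral

/-! ### Integrating a smooth family over time -/

section IntegralFamilies

/-- The identification `ℝ × ℝ = Tℝ` is smooth. -/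
theorem contMDiff_tangentBundle_real_mk :
    ContMDiff (𝓘(ℝ, ℝ).prod 𝓘(ℝ, ℝ)) 𝓘(ℝ, ℝ).tangent ∞
      (fun q : ℝ × ℝ => (⟨q.1, q.2⟩ : TangentBundle 𝓘(ℝ, ℝ) ℝ)) := by
  intro q
  refine Bundle.contMDiffAt_totalSpace.2 ⟨contMDiffAt_fst, ?_⟩
  convert (contMDiffAt_snd : ContMDiffAt (𝓘(ℝ, ℝ).prod 𝓘(ℝ, ℝ)) 𝓘(ℝ, ℝ) ∞ Prod.snd q) using 1
  funext y
  rw [trivializationAt_model_space_apply]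

variable {E : Type} [NormedAddCommGroup E] [NormedSpace ℝ E] {H : Type} [TopologicalSpace H]
  {I : ModelWithCorners ℝ E H} {N : Type*} [TopologicalSpace N] [ChartedSpace H N]
  [IsManifold I ∞ N]

variable (I N) in
/-- The map `ℝ × TN → T(ℝ × N)`, `(t, v) ↦ (0_t, v)`. -/
def zeroTimeLift (q : ℝ × TangentBundle I N) : TangentBundle (𝓘(ℝ, ℝ).prod I) (ℝ × N) :=
  ⟨(q.1, q.2.1), (0, q.2.2)⟩

theorem contMDiff_zeroTimeLift :
    ContMDiff (𝓘(ℝ, ℝ).prod I.tangent) (𝓘(ℝ, ℝ).prod I).tangent ∞ (zeroTimeLift I N) := by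
  have h1 : ContMDiff (𝓘(ℝ, ℝ).prod I.tangent) (𝓘(ℝ, ℝ).tangent.prod I.tangent) ∞
      (fun q : ℝ × TangentBundle I N => ((⟨q.1, (0 : ℝ)⟩ : TangentBundle 𝓘(ℝ, ℝ) ℝ), q.2)) :=
    (contMDiff_tangentBundle_real_mk.comp (contMDiff_fst.prodMk contMDiff_const)).prodMk
      contMDiff_snd
  exact contMDiff_equivTangentBundleProd_symm.comp h1

omit [IsManifold I ∞ N] in
/-- The differential at fixed time is the full differential along lifted vectors. -/
theorem mfderiv_slice_eq_tangentMap {E' : Type} [NormedAddCommGroup E'] [NormedSpace ℝ E']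
    {H' : Type} [TopologicalSpace H'] {I' : ModelWithCorners ℝ E' H'} {N' : Type*}
    [TopologicalSpace N'] [ChartedSpace H' N'] {F : ℝ × N → N'}
    (hF : MDifferentiable (𝓘(ℝ, ℝ).prod I) I' F) (t : ℝ) (p : TangentBundle I N) :
    tangentMap I I' (fun y => F (t, y)) p =
      tangentMap (𝓘(ℝ, ℝ).prod I) I' F (zeroTimeLift I N (t, p)) := by
  have h : tangentMap I I' (fun y => F (t, y)) p =
      tangentMap (𝓘(ℝ, ℝ).prod I) I' F (tangentMap I (𝓘(ℝ, ℝ).prod I) (fun y => (t, y)) p) :=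
    tangentMap_comp_at p (hF _) (mdifferentiableAt_const.prodMk mdifferentiableAt_id)
  rw [h]
  congr 1
  simp only [tangentMap, zeroTimeLift, mfderiv_prod_right]
  rfl

/-- The function `(t, v) ↦ d(F_t)(v)` on `ℝ × TN`, for a function `F` on `ℝ × N`. -/
noncomputable def sliceDifferential (F : ℝ × N → ℝ) (q : ℝ × TangentBundle I N) : ℝ :=
  (tangentMap (𝓘(ℝ, ℝ).prod I) 𝓘(ℝ, ℝ) F (zeroTimeLift I N q)).2

variable [FiniteDimensional ℝ E] [I.Boundaryless]

theorem contMDiff_intervalIntegral {c : ℝ × N → ℝ}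
    (hc : ContMDiff (𝓘(ℝ, ℝ).prod I) 𝓘(ℝ, ℝ) ∞ c) (a b : ℝ) :
    ContMDiff I 𝓘(ℝ, ℝ) ∞ (fun x => ∫ t in a..b, c (t, x)) := by
  rw [← contMDiffOn_univ]
  exact contMDiffOn_intervalIntegral isOpen_univ (by simpa using hc.contMDiffOn) a b

/-- The tangent map of a time integral is again given by time integrals of smooth families; this is
what makes the induction on the order of differentiability work. -/
theorem tangentMap_intervalIntegral {F : ℝ × N → ℝ}
    (hF : ContMDiff (𝓘(ℝ, ℝ).prod I) 𝓘(ℝ, ℝ) ∞ F) (a b : ℝ) :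
    tangentMap I 𝓘(ℝ, ℝ) (fun x => ∫ t in a..b, F (t, x)) =
      (fun q : ℝ × ℝ => (⟨q.1, q.2⟩ : TangentBundle 𝓘(ℝ, ℝ) ℝ)) ∘
        fun p => (∫ t in a..b, F (t, p.1), ∫ t in a..b, sliceDifferential F (t, p)) := by
  funext p
  have h1 : ∀ t, (mfderiv I 𝓘(ℝ, ℝ) (fun y => F (t, y)) p.1 p.2 : ℝ) =
      sliceDifferential F (t, p) := by
    intro t
    have h2 := mfderiv_slice_eq_tangentMap (hF.mdifferentiable (by simp)) t p
    exact congrArg (fun w : TangentBundle 𝓘(ℝ, ℝ) ℝ => (w.2 : ℝ)) h2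
  simp only [Function.comp, tangentMap]
  congr 1
  refine (mfderiv_intervalIntegral hF a b p.1 p.2).trans ?_
  simp only [h1]
  rfl

theorem continuous_ckTopology_intervalIntegral (k : ℕ) : ∀ {Z : Type*} [TopologicalSpace Z]
    {E : Type} [NormedAddCommGroup E] [NormedSpace ℝ E] [FiniteDimensional ℝ E]
    {H : Type} [TopologicalSpace H]
    {I : ModelWithCorners ℝ E H} [I.Boundaryless] {N : Type*} [TopologicalSpace N]
    [ChartedSpace H N] [IsManifold I ∞ N] {F : Z → ℝ × N → ℝ},
    (∀ z, ContMDiff (𝓘(ℝ, ℝ).prod I) 𝓘(ℝ, ℝ) ∞ (F z)) → ∀ a b : ℝ,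
    Continuous[_, ckTopology k (𝓘(ℝ, ℝ).prod I) 𝓘(ℝ, ℝ) (ℝ × N) ℝ] F →
    Continuous[_, ckTopology k I 𝓘(ℝ, ℝ) N ℝ] (fun z x => ∫ t in a..b, F z (t, x)) := by
  induction k with
  | zero =>
    intro Z _ E _ _ _ H _ I _ N _ _ _ F hF a b cF
    have := Manifold.locallyCompact_of_finiteDimensional (M := N) I
    let F' : Z → C(ℝ × N, ℝ) := fun z => ⟨F z, (hF z).continuous⟩
    have cF' : Continuous F' := (continuous_ckTopology_zero_iff _ _ F').1 cF
    have hjoint : Continuous fun q : Z × N => ∫ t in a..b, F q.1 (t, q.2) := by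
      refine intervalIntegral.continuous_parametric_intervalIntegral_of_continuous' ?_ a b
      have h : Continuous fun q : (Z × N) × ℝ => F' q.1.1 (q.2, q.1.2) :=
        continuous_eval.comp
          ((cF'.comp (continuous_fst.comp continuous_fst)).prodMk
            (continuous_snd.prodMk (continuous_snd.comp continuous_fst)))
      exact h
    refine (continuous_ckTopology_zero_iff I 𝓘(ℝ, ℝ) (fun z =>
      ⟨fun x => ∫ t in a..b, F z (t, x), hjoint.comp (continuous_const.prodMk continuous_id)⟩)).2 ?_
    exact ContinuousMap.continuous_of_continuous_uncurry _ hjoint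
  | succ k ih =>
    intro Z _ E _ _ _ H _ I _ N _ _ _ F hF a b cF
    rw [continuous_ckTopology_succ_iff] at cF ⊢
    have hT := fun z => (hF z).contMDiff_tangentMap (m := ∞) le_rfl
    have hproj : ContMDiff 𝓘(ℝ, ℝ).tangent 𝓘(ℝ, ℝ) ∞
        (fun p : TangentBundle 𝓘(ℝ, ℝ) ℝ => p.1) := contMDiff_proj _
    have hsnd := contMDiff_snd_tangentBundle_modelSpace (n := ∞) ℝ 𝓘(ℝ, ℝ)
    have hlift := contMDiff_zeroTimeLift (I := I) (N := N)
    -- both components of the tangent map of the integral are integrals of smooth families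
    have c0 : Continuous[_, ckTopology k (𝓘(ℝ, ℝ).prod I.tangent) 𝓘(ℝ, ℝ)
        (ℝ × TangentBundle I N) ℝ] (fun z (q : ℝ × TangentBundle I N) => F z (q.1, q.2.1)) :=
      continuous_ckTopology_comp k (g := fun _ (p : TangentBundle 𝓘(ℝ, ℝ) ℝ) => p.1)
        (f := fun z => tangentMap (𝓘(ℝ, ℝ).prod I) 𝓘(ℝ, ℝ) (F z) ∘ zeroTimeLift I N)
        (fun _ => hproj) (fun z => (hT z).comp hlift)
        (@continuous_const _ _ _ (_) _)
        (continuous_ckTopology_comp k hT (fun _ => hlift) cF (@continuous_const _ _ _ (_) _))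
    have c1 : Continuous[_, ckTopology k (𝓘(ℝ, ℝ).prod I.tangent) 𝓘(ℝ, ℝ)
        (ℝ × TangentBundle I N) ℝ] (fun z => sliceDifferential (F z)) :=
      continuous_ckTopology_comp k (g := fun _ (p : TangentBundle 𝓘(ℝ, ℝ) ℝ) => p.2)
        (f := fun z => tangentMap (𝓘(ℝ, ℝ).prod I) 𝓘(ℝ, ℝ) (F z) ∘ zeroTimeLift I N)
        (fun _ => hsnd) (fun z => (hT z).comp hlift)
        (@continuous_const _ _ _ (_) _)
        (continuous_ckTopology_comp k hT (fun _ => hlift) cF (@continuous_const _ _ _ (_) _))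
    have s0 : ∀ z, ContMDiff (𝓘(ℝ, ℝ).prod I.tangent) 𝓘(ℝ, ℝ) ∞
        (fun q : ℝ × TangentBundle I N => F z (q.1, q.2.1)) := fun z =>
      hproj.comp ((hT z).comp hlift)
    have s1 : ∀ z, ContMDiff (𝓘(ℝ, ℝ).prod I.tangent) 𝓘(ℝ, ℝ) ∞
        (sliceDifferential (I := I) (F z)) := fun z =>
      hsnd.comp ((hT z).comp hlift)
    have e : (fun z => tangentMap I 𝓘(ℝ, ℝ) (fun x => ∫ t in a..b, F z (t, x))) =
        fun z => (fun q : ℝ × ℝ => (⟨q.1, q.2⟩ : TangentBundle 𝓘(ℝ, ℝ) ℝ)) ∘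
          fun p => (∫ t in a..b, F z (t, p.1), ∫ t in a..b, sliceDifferential (F z) (t, p)) :=
      funext fun z => tangentMap_intervalIntegral (hF z) a b
    rw [e]
    have i0 := fun z => contMDiff_intervalIntegral (s0 z) a b
    have i1 := fun z => contMDiff_intervalIntegral (s1 z) a b
    exact continuous_ckTopology_comp k (fun _ => contMDiff_tangentBundle_real_mk)
      (fun z => (i0 z).prodMk (i1 z)) (@continuous_const _ _ _ (_) _)
      (continuous_ckTopology_prodMk k i0 i1 (ih s0 a b c0) (ih s1 a b c1))

/-- Integration over time is continuous for the `C^∞` topology. -/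
theorem IsSmoothFamily.intervalIntegral {Z : Type*} [TopologicalSpace Z] {F : Z → ℝ × N → ℝ}
    (hF : IsSmoothFamily (𝓘(ℝ, ℝ).prod I) 𝓘(ℝ, ℝ) F) (a b : ℝ) :
    IsSmoothFamily I 𝓘(ℝ, ℝ) (fun z x => ∫ t in a..b, F z (t, x)) where
  smooth z := contMDiff_intervalIntegral (hF.smooth z) a b
  continuous := continuous_smoothTopology_iff.2 fun k =>
    continuous_ckTopology_intervalIntegral k hF.smooth a b
      (continuous_smoothTopology_iff.1 hF.continuous k)

end IntegralFamilies

/-! ### Pullbacks along a flow in a vector space, and evaluation of forms on fields -/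

section FlowDerivative

variable {E : Type*} [NormedAddCommGroup E] [NormedSpace ℝ E]

/-- For a family `K (s, ·)` with `K (t, ·) = id`, generated at time `t` by `X`, the derivative of
`D K_s (y) u` at time `t` is `D X (y) u`. -/
theorem hasDerivAt_fderiv_flow {K : ℝ × E → E} {t : ℝ} {y : E} (hK : ContDiffAt ℝ 2 K (t, y))
    (u : E) :
    HasDerivAt (fun s => fderiv ℝ K (s, y) (0, u))
      (fderiv ℝ (fun z => fderiv ℝ K (t, z) (1, 0)) y u) t := by
  have hd : HasFDerivAt (fderiv ℝ K) (fderiv ℝ (fderiv ℝ K) (t, y)) (t, y) :=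
    ((hK.fderiv_right (m := 1) (by norm_num)).differentiableAt (by simp)).hasFDerivAt
  -- mixed time and space derivatives commute
  have hsymm : IsSymmSndFDerivAt ℝ K (t, y) := hK.isSymmSndFDerivAt (by simp)
  have h1 : HasDerivAt (fun s : ℝ => (s, y)) ((1 : ℝ), (0 : E)) t :=
    (hasDerivAt_id t).prodMk (hasDerivAt_const t y)
  have h2 : HasDerivAt (fun s => fderiv ℝ K (s, y)) (fderiv ℝ (fderiv ℝ K) (t, y) (1, 0)) t :=
    hd.comp_hasDerivAt t h1
  have h3 : HasFDerivAt (fun z => fderiv ℝ K (t, z) (1, 0))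
      (((fderiv ℝ (fderiv ℝ K) (t, y)).comp (ContinuousLinearMap.inr ℝ ℝ E)).flip (1, 0)) y := by
    have h4 : HasFDerivAt (fun z => fderiv ℝ K (t, z)) _ y :=
      hd.comp y (hasFDerivAt_prodMk_right t y)
    simpa using h4.clm_apply (hasFDerivAt_const ((1 : ℝ), (0 : E)) y)
  rw [h3.fderiv]
  have h5 := h2.clm_apply (hasDerivAt_const t ((0 : ℝ), u))
  convert h5 using 1
  simpa using hsymm (0, u) (1, 0)

variable {K : ℝ × E → E} {t : ℝ} {y : E}

theorem fderiv_flow_inr (hK : DifferentiableAt ℝ K (t, y)) (hid : ∀ᶠ z in 𝓝 y, K (t, z) = z)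
    (u : E) : fderiv ℝ K (t, y) (0, u) = u := by
  have h : HasFDerivAt (fun z => K (t, z)) _ y :=
    hK.hasFDerivAt.comp y (hasFDerivAt_prodMk_right t y)
  have h' : HasFDerivAt (fun z => K (t, z)) (ContinuousLinearMap.id ℝ E) y :=
    (hasFDerivAt_id y).congr_of_eventuallyEq hid
  simpa using congrArg (fun A : E →L[ℝ] E => A u) (h.unique h')

theorem hasDerivAt_flow (hK : DifferentiableAt ℝ K (t, y)) :
    HasDerivAt (fun s => K (s, y)) (fderiv ℝ K (t, y) (1, 0)) t := by
  have h1 : HasDerivAt (fun s : ℝ => (s, y)) ((1 : ℝ), (0 : E)) t :=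
    (hasDerivAt_id t).prodMk (hasDerivAt_const t y)
  exact hK.hasFDerivAt.comp_hasDerivAt t h1

/-- The Lie derivative of a (vector valued) covector field, as a derivative along the flow. -/
theorem hasDerivAt_pullback_one (hK : ContDiffAt ℝ 2 K (t, y)) (hid : ∀ᶠ z in 𝓝 y, K (t, z) = z)
    {F : Type*} [NormedAddCommGroup F] [NormedSpace ℝ F] {A : E → E →L[ℝ] F}
    (hA : DifferentiableAt ℝ A y) (u : E) :
    HasDerivAt (fun s => A (K (s, y)) (fderiv ℝ K (s, y) (0, u)))
      (fderiv ℝ A y (fderiv ℝ K (t, y) (1, 0)) u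
        + A y (fderiv ℝ (fun z => fderiv ℝ K (t, z) (1, 0)) y u)) t := by
  have hKd := hK.differentiableAt (by simp)
  have hy : K (t, y) = y := hid.self_of_nhds
  have hA' : HasFDerivAt A (fderiv ℝ A y) (K (t, y)) := hy.symm ▸ hA.hasFDerivAt
  have h1 : HasDerivAt (fun s => A (K (s, y))) (fderiv ℝ A y (fderiv ℝ K (t, y) (1, 0))) t :=
    hA'.comp_hasDerivAt t (hasDerivAt_flow hKd)
  have h := h1.clm_apply (hasDerivAt_fderiv_flow hK u)
  rwa [fderiv_flow_inr hKd hid, hy] at h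

/-- The Lie derivative of a covariant 2-tensor field, as a derivative along the flow. -/
theorem hasDerivAt_pullback_two (hK : ContDiffAt ℝ 2 K (t, y)) (hid : ∀ᶠ z in 𝓝 y, K (t, z) = z)
    {B : E → E →L[ℝ] E →L[ℝ] ℝ} (hB : DifferentiableAt ℝ B y) (u v : E) :
    HasDerivAt (fun s => B (K (s, y)) (fderiv ℝ K (s, y) (0, u)) (fderiv ℝ K (s, y) (0, v)))
      (fderiv ℝ B y (fderiv ℝ K (t, y) (1, 0)) u v
        + B y (fderiv ℝ (fun z => fderiv ℝ K (t, z) (1, 0)) y u) v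
        + B y u (fderiv ℝ (fun z => fderiv ℝ K (t, z) (1, 0)) y v)) t := by
  have hKd := hK.differentiableAt (by simp)
  have h := (hasDerivAt_pullback_one hK hid hB u).clm_apply (hasDerivAt_fderiv_flow hK v)
  rwa [fderiv_flow_inr hKd hid, fderiv_flow_inr hKd hid, hid.self_of_nhds,
    add_apply] at h

end FlowDerivative

section Pairings

variable {m : ℕ} {M : Type*} [TopologicalSpace M] [ChartedSpace (EuclideanSpace ℝ (Fin m)) M]
  [IsManifold (𝓡 m) ∞ M]
  {E' : Type*} [NormedAddCommGroup E'] [NormedSpace ℝ E'] {H' : Type*} [TopologicalSpace H']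
  {I' : ModelWithCorners ℝ E' H'} {N : Type*} [TopologicalSpace N] [ChartedSpace H' N]

theorem OneForm.contMDiffOn_apply (α : OneForm m M) {b : N → M} {v : ∀ n, TangentSpace (𝓡 m) (b n)}
    {s : Set N}
    (hv : ContMDiffOn I' (𝓡 m).tangent ∞ (fun n => (⟨b n, v n⟩ : TangentBundle (𝓡 m) M)) s) :
    ContMDiffOn I' 𝓘(ℝ, ℝ) ∞ (fun n => α (b n) (v n)) s := by
  have hb : ContMDiffOn I' (𝓡 m) ∞ b s :=
    (contMDiff_proj (TangentSpace (𝓡 m) : M → Type _)).comp_contMDiffOn hv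
  intro x hx
  have h := ((α.contMDiff (b x)).comp_contMDiffWithinAt x (hb x hx)).clm_bundle_apply
    (E₁ := (TangentSpace (𝓡 m) : M → Type _)) (E₂ := Bundle.Trivial M ℝ) (hv x hx)
  exact (contMDiffWithinAt_totalSpace.1 h).2

theorem TwoTensor.contMDiffOn_apply (Ω : TwoTensor m M) {b : N → M}
    {v w : ∀ n, TangentSpace (𝓡 m) (b n)} {s : Set N}
    (hv : ContMDiffOn I' (𝓡 m).tangent ∞ (fun n => (⟨b n, v n⟩ : TangentBundle (𝓡 m) M)) s)
    (hw : ContMDiffOn I' (𝓡 m).tangent ∞ (fun n => (⟨b n, w n⟩ : TangentBundle (𝓡 m) M)) s) :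
    ContMDiffOn I' 𝓘(ℝ, ℝ) ∞ (fun n => Ω (b n) (v n) (w n)) s := by
  have hb : ContMDiffOn I' (𝓡 m) ∞ b s :=
    (contMDiff_proj (TangentSpace (𝓡 m) : M → Type _)).comp_contMDiffOn hv
  intro x hx
  have h := ((Ω.contMDiff (b x)).comp_contMDiffWithinAt x (hb x hx)).clm_bundle_apply₂
    (E₁ := (TangentSpace (𝓡 m) : M → Type _)) (E₂ := (TangentSpace (𝓡 m) : M → Type _))
    (E₃ := Bundle.Trivial M ℝ) (hv x hx) (hw x hx)
  exact (contMDiffWithinAt_totalSpace.1 h).2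

theorem OneForm.contMDiff_apply (α : OneForm m M) {b : N → M} {v : ∀ n, TangentSpace (𝓡 m) (b n)}
    (hv : ContMDiff I' (𝓡 m).tangent ∞ (fun n => (⟨b n, v n⟩ : TangentBundle (𝓡 m) M))) :
    ContMDiff I' 𝓘(ℝ, ℝ) ∞ (fun n => α (b n) (v n)) :=
  contMDiffOn_univ.1 (α.contMDiffOn_apply hv.contMDiffOn)

theorem TwoTensor.contMDiff_apply (Ω : TwoTensor m M) {b : N → M}
    {v w : ∀ n, TangentSpace (𝓡 m) (b n)}
    (hv : ContMDiff I' (𝓡 m).tangent ∞ (fun n => (⟨b n, v n⟩ : TangentBundle (𝓡 m) M)))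
    (hw : ContMDiff I' (𝓡 m).tangent ∞ (fun n => (⟨b n, w n⟩ : TangentBundle (𝓡 m) M))) :
    ContMDiff I' 𝓘(ℝ, ℝ) ∞ (fun n => Ω (b n) (v n) (w n)) :=
  contMDiffOn_univ.1 (Ω.contMDiffOn_apply hv.contMDiffOn hw.contMDiffOn)

end Pairings

/-! ### Coefficients of forms in a chart -/

section Coefficients

variable {m : ℕ} {M : Type*} [TopologicalSpace M] [ChartedSpace (EuclideanSpace ℝ (Fin m)) M]

/-- The derivative at `y` of the inverse of the chart around `x`. -/
noncomputable def chartFrame (x : M) (y : EuclideanSpace ℝ (Fin m)) :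
    EuclideanSpace ℝ (Fin m) →L[ℝ] TangentSpace (𝓡 m) ((extChartAt (𝓡 m) x).symm y) :=
  mfderivWithin 𝓘(ℝ, EuclideanSpace ℝ (Fin m)) (𝓡 m) (extChartAt (𝓡 m) x).symm
    (Set.range (𝓡 m)) y

/-- The coefficients of a 1-form in the chart around `x`. -/
noncomputable def coeffOne (α : ∀ x : M, TangentSpace (𝓡 m) x →L[ℝ] ℝ) (x : M)
    (y : EuclideanSpace ℝ (Fin m)) : EuclideanSpace ℝ (Fin m) →L[ℝ] ℝ :=
  (α ((extChartAt (𝓡 m) x).symm y)).comp (chartFrame x y)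

/-- The coefficients of a covariant 2-tensor in the chart around `x`. -/
noncomputable def coeffTwo
    (Ω : ∀ x : M, TangentSpace (𝓡 m) x →L[ℝ] TangentSpace (𝓡 m) x →L[ℝ] ℝ) (x : M)
    (y : EuclideanSpace ℝ (Fin m)) :
    EuclideanSpace ℝ (Fin m) →L[ℝ] EuclideanSpace ℝ (Fin m) →L[ℝ] ℝ :=
  ContinuousLinearMap.bilinearComp
    (show EuclideanSpace ℝ (Fin m) →L[ℝ] EuclideanSpace ℝ (Fin m) →L[ℝ] ℝ from
      Ω ((extChartAt (𝓡 m) x).symm y))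
    (show EuclideanSpace ℝ (Fin m) →L[ℝ] EuclideanSpace ℝ (Fin m) from chartFrame x y)
    (show EuclideanSpace ℝ (Fin m) →L[ℝ] EuclideanSpace ℝ (Fin m) from chartFrame x y)

variable [IsManifold (𝓡 m) ∞ M]

theorem coordField_eq (x : M) (v : TangentSpace (𝓡 m) x) (y : EuclideanSpace ℝ (Fin m)) :
    coordField x v y = chartFrame x y v := by
  unfold coordField chartFrame
  rw [mfderiv_extChartAt_self]
  rfl

theorem chartDeriv_eq (x : M) (u : TangentSpace (𝓡 m) x) (F : EuclideanSpace ℝ (Fin m) → ℝ) :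
    chartDeriv x u F = fderiv ℝ F (extChartAt (𝓡 m) x x) u := by
  unfold chartDeriv
  rw [mfderiv_extChartAt_self]
  rfl

/-- The coordinate frame is smooth. -/
theorem contMDiffOn_chartFrame (x : M) (w : EuclideanSpace ℝ (Fin m)) :
    ContMDiffOn 𝓘(ℝ, EuclideanSpace ℝ (Fin m)) (𝓡 m).tangent ∞
      (fun y => (⟨(extChartAt (𝓡 m) x).symm y, chartFrame x y w⟩ : TangentBundle (𝓡 m) M))
      (extChartAt (𝓡 m) x).target := by
  have h1 : ContMDiffOn (𝓡 m) (𝓡 m).tangent ∞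
      (fun p : M => TotalSpace.mk' (EuclideanSpace ℝ (Fin m))
        (E := (TangentSpace (𝓡 m) : M → Type _)) p
        ((trivializationAt (EuclideanSpace ℝ (Fin m)) (TangentSpace (𝓡 m)) x).symmL ℝ p w))
      (chartAt (EuclideanSpace ℝ (Fin m)) x).source := by
    intro p hp
    have h := (trivializationAt (EuclideanSpace ℝ (Fin m)) (TangentSpace (𝓡 m) : M → Type _)
      x).contMDiffAt_symmL (IB := 𝓡 m) (n := ∞) (x := p) (by simpa using hp)
    exact (h.clm_bundle_apply (E₁ := Bundle.Trivial M (EuclideanSpace ℝ (Fin m)))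
      (E₂ := (TangentSpace (𝓡 m) : M → Type _)) (v := fun _ => w)
      (contMDiffAt_totalSpace.2 ⟨contMDiffAt_id, contMDiffAt_const⟩)).contMDiffWithinAt
  have hmem : ∀ y ∈ (extChartAt (𝓡 m) x).target,
      (extChartAt (𝓡 m) x).symm y ∈ (chartAt (EuclideanSpace ℝ (Fin m)) x).source := by
    intro y hy
    simpa using (extChartAt (𝓡 m) x).map_target hy
  refine (h1.comp (contMDiffOn_extChartAt_symm x) hmem).congr fun y hy => ?_
  have h2 := TangentBundle.symmL_trivializationAt (𝕜 := ℝ) (I := 𝓡 m) (hmem y hy)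
  rw [(extChartAt (𝓡 m) x).right_inv hy] at h2
  simp only [Function.comp, h2]
  rfl

/-- Read in the chart around `x`, a 1-form takes its original values. -/
theorem coeffOne_apply_mfderiv (α : ∀ x : M, TangentSpace (𝓡 m) x →L[ℝ] ℝ) {x p : M}
    (hp : p ∈ (extChartAt (𝓡 m) x).source) (a : TangentSpace (𝓡 m) p) :
    coeffOne α x (extChartAt (𝓡 m) x p)
      (mfderiv (𝓡 m) 𝓘(ℝ, EuclideanSpace ℝ (Fin m)) (extChartAt (𝓡 m) x) p a) = α p a := by
  have h := mfderivWithin_extChartAt_symm_comp_mfderiv_extChartAt' (I := 𝓡 m) hp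
  have h1 : chartFrame x (extChartAt (𝓡 m) x p)
      (mfderiv (𝓡 m) 𝓘(ℝ, EuclideanSpace ℝ (Fin m)) (extChartAt (𝓡 m) x) p a) = a :=
    congrArg (fun A : EuclideanSpace ℝ (Fin m) →L[ℝ] EuclideanSpace ℝ (Fin m) => A a) h
  have h2 : ∀ q, q = p → ∀ b : EuclideanSpace ℝ (Fin m), α q b = α p b := by
    rintro _ rfl b; rfl
  refine Eq.trans ?_ (h2 _ ((extChartAt (𝓡 m) x).left_inv hp) a)
  exact congrArg (α ((extChartAt (𝓡 m) x).symm (extChartAt (𝓡 m) x p))) h1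

theorem coeffTwo_apply_mfderiv
    (Ω : ∀ x : M, TangentSpace (𝓡 m) x →L[ℝ] TangentSpace (𝓡 m) x →L[ℝ] ℝ) {x p : M}
    (hp : p ∈ (extChartAt (𝓡 m) x).source) (a b : TangentSpace (𝓡 m) p) :
    coeffTwo Ω x (extChartAt (𝓡 m) x p)
      (mfderiv (𝓡 m) 𝓘(ℝ, EuclideanSpace ℝ (Fin m)) (extChartAt (𝓡 m) x) p a)
      (mfderiv (𝓡 m) 𝓘(ℝ, EuclideanSpace ℝ (Fin m)) (extChartAt (𝓡 m) x) p b) = Ω p a b := by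
  have h := mfderivWithin_extChartAt_symm_comp_mfderiv_extChartAt' (I := 𝓡 m) hp
  have h1 : ∀ a, chartFrame x (extChartAt (𝓡 m) x p)
      (mfderiv (𝓡 m) 𝓘(ℝ, EuclideanSpace ℝ (Fin m)) (extChartAt (𝓡 m) x) p a) = a := fun a =>
    congrArg (fun A : EuclideanSpace ℝ (Fin m) →L[ℝ] EuclideanSpace ℝ (Fin m) => A a) h
  have h2 : ∀ q, q = p → ∀ b c : EuclideanSpace ℝ (Fin m), Ω q b c = Ω p b c := by
    rintro _ rfl b c; rfl
  refine Eq.trans ?_ (h2 _ ((extChartAt (𝓡 m) x).left_inv hp) a b)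
  exact congrArg₂ (fun a b => Ω ((extChartAt (𝓡 m) x).symm (extChartAt (𝓡 m) x p)) a b)
    (h1 a) (h1 b)

theorem chartFrame_self (x : M) (u : EuclideanSpace ℝ (Fin m)) :
    chartFrame x (extChartAt (𝓡 m) x x) u = u := by
  unfold chartFrame
  rw [mfderivWithin_range_extChartAt_symm]
  rfl

theorem dOne_eq_of_differentiableAt (α : ∀ x : M, TangentSpace (𝓡 m) x →L[ℝ] ℝ) (x : M)
    (hα : DifferentiableAt ℝ (coeffOne α x) (extChartAt (𝓡 m) x x)) (u v : TangentSpace (𝓡 m) x) :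
    dOne α x u v = fderiv ℝ (coeffOne α x) (extChartAt (𝓡 m) x x) u v
      - fderiv ℝ (coeffOne α x) (extChartAt (𝓡 m) x x) v u := by
  have h : ∀ w : EuclideanSpace ℝ (Fin m), fderiv ℝ (fun y => coeffOne α x y w)
      (extChartAt (𝓡 m) x x) = (fderiv ℝ (coeffOne α x) (extChartAt (𝓡 m) x x)).flip w := by
    intro w
    have h1 := hα.hasFDerivAt.clm_apply (hasFDerivAt_const w (extChartAt (𝓡 m) x x))
    rw [h1.fderiv]
    simp
  simp only [dOne, chartDeriv_eq, coordField_eq]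
  exact congrArg₂ (fun a b : ℝ => a - b)
    (congrArg (fun A : EuclideanSpace ℝ (Fin m) →L[ℝ] ℝ => A u) (h v))
    (congrArg (fun A : EuclideanSpace ℝ (Fin m) →L[ℝ] ℝ => A v) (h u))

theorem dTwo_eq_of_differentiableAt
    (Ω : ∀ x : M, TangentSpace (𝓡 m) x →L[ℝ] TangentSpace (𝓡 m) x →L[ℝ] ℝ) (x : M)
    (hΩ : DifferentiableAt ℝ (coeffTwo Ω x) (extChartAt (𝓡 m) x x))
    (u v w : TangentSpace (𝓡 m) x) :
    dTwo Ω x u v w = fderiv ℝ (coeffTwo Ω x) (extChartAt (𝓡 m) x x) u v w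
      - fderiv ℝ (coeffTwo Ω x) (extChartAt (𝓡 m) x x) v u w
      + fderiv ℝ (coeffTwo Ω x) (extChartAt (𝓡 m) x x) w u v := by
  have h : ∀ a b c : EuclideanSpace ℝ (Fin m), fderiv ℝ (fun y => coeffTwo Ω x y b c)
      (extChartAt (𝓡 m) x x) a = fderiv ℝ (coeffTwo Ω x) (extChartAt (𝓡 m) x x) a b c := by
    intro a b c
    have h1 := (hΩ.hasFDerivAt.clm_apply (hasFDerivAt_const b (extChartAt (𝓡 m) x x))).clm_apply
      (hasFDerivAt_const c (extChartAt (𝓡 m) x x))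
    rw [h1.fderiv]
    simp
  simp only [dTwo, chartDeriv_eq, coordField_eq]
  rw [← h u v w, ← h v u w, ← h w u v]
  rfl

theorem OneForm.contDiffOn_coeffOne (α : OneForm m M) (x : M) :
    ContDiffOn ℝ ∞ (coeffOne α x) (extChartAt (𝓡 m) x).target :=
  contDiffOn_clm_apply.2 fun w =>
    (α.contMDiffOn_apply (contMDiffOn_chartFrame x w)).contDiffOn

theorem TwoTensor.contDiffOn_coeffTwo (Ω : TwoTensor m M) (x : M) :
    ContDiffOn ℝ ∞ (coeffTwo Ω x) (extChartAt (𝓡 m) x).target :=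
  contDiffOn_clm_apply.2 fun w => contDiffOn_clm_apply.2 fun w' =>
    (Ω.contMDiffOn_apply (contMDiffOn_chartFrame x w) (contMDiffOn_chartFrame x w')).contDiffOn

omit [IsManifold (𝓡 m) ∞ M] in
theorem dFun_eq_of_contMDiff {f : M → ℝ} (hf : ContMDiff (𝓡 m) 𝓘(ℝ, ℝ) ∞ f) (x : M)
    (u : TangentSpace (𝓡 m) x) :
    dFun f x u = fderiv ℝ (fun y => f ((extChartAt (𝓡 m) x).symm y)) (extChartAt (𝓡 m) x x) u := by
  unfold dFun
  rw [(hf.mdifferentiableAt (by simp)).mfderiv]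
  simp only [ModelWithCorners.range_eq_univ, fderivWithin_univ]
  rfl

end Coefficients

/-! ### Cartan's formulas -/

section Cartan

variable {m : ℕ} {M : Type*} [TopologicalSpace M] [ChartedSpace (EuclideanSpace ℝ (Fin m)) M]

/-- The vector field generating the family `K (s, ·)` at a time `t` with `K (t, ·) = id`. -/
noncomputable def generator (K : ℝ × M → M) (t : ℝ) (x : M) : TangentSpace (𝓡 m) x :=
  mfderiv 𝓘(ℝ, ℝ) (𝓡 m) (fun s => K (s, x)) t (1 : ℝ)

/-- The family `K (s, ·)` in the chart around `z`. -/
noncomputable def chartFlow (K : ℝ × M → M) (z : M) (q : ℝ × EuclideanSpace ℝ (Fin m)) :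
    EuclideanSpace ℝ (Fin m) :=
  extChartAt (𝓡 m) z (K (q.1, (extChartAt (𝓡 m) z).symm q.2))

variable [IsManifold (𝓡 m) ∞ M] {K : ℝ × M → M} {t : ℝ}

theorem contDiffAt_chartFlow (hK : ContMDiff (𝓘(ℝ, ℝ).prod (𝓡 m)) (𝓡 m) ∞ K) {z : M} {s : ℝ}
    {y : EuclideanSpace ℝ (Fin m)} (hy : y ∈ (extChartAt (𝓡 m) z).target)
    (hs : K (s, (extChartAt (𝓡 m) z).symm y) ∈ (extChartAt (𝓡 m) z).source) :
    ContDiffAt ℝ ∞ (chartFlow K z) (s, y) := by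
  have h1 : ContMDiffAt 𝓘(ℝ, EuclideanSpace ℝ (Fin m)) (𝓡 m) ∞ (extChartAt (𝓡 m) z).symm y :=
    (contMDiffOn_extChartAt_symm z).contMDiffAt ((isOpen_extChartAt_target z).mem_nhds hy)
  have h2 : ContMDiffAt 𝓘(ℝ, ℝ × EuclideanSpace ℝ (Fin m)) (𝓘(ℝ, ℝ).prod (𝓡 m)) ∞
      (fun q : ℝ × EuclideanSpace ℝ (Fin m) => (q.1, (extChartAt (𝓡 m) z).symm q.2)) (s, y) :=
    ContMDiffAt.prodMk contDiff_fst.contMDiff.contMDiffAt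
      (ContMDiffAt.comp (s, y) h1 contDiff_snd.contMDiff.contMDiffAt)
  have h3 : ContMDiffAt (𝓡 m) 𝓘(ℝ, EuclideanSpace ℝ (Fin m)) ∞ (extChartAt (𝓡 m) z)
      (K (s, (extChartAt (𝓡 m) z).symm y)) :=
    contMDiffAt_extChartAt' (by simpa using hs)
  exact (h3.comp (s, y) (hK.contMDiffAt.comp (s, y) h2)).contDiffAt

/-- The space derivative of the flow in the chart is the coordinate expression of the differential
of `K (s, ·)`. -/
theorem fderiv_chartFlow_inr (hK : ContMDiff (𝓘(ℝ, ℝ).prod (𝓡 m)) (𝓡 m) ∞ K) {z : M} {s : ℝ}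
    (hs : K (s, z) ∈ (extChartAt (𝓡 m) z).source) (u : TangentSpace (𝓡 m) z) :
    fderiv ℝ (chartFlow K z) (s, extChartAt (𝓡 m) z z) (0, u) =
      mfderiv (𝓡 m) 𝓘(ℝ, EuclideanSpace ℝ (Fin m)) (extChartAt (𝓡 m) z) (K (s, z))
        (mfderiv (𝓡 m) (𝓡 m) (fun p => K (s, p)) z u) := by
  have hd : DifferentiableAt ℝ (chartFlow K z) (s, extChartAt (𝓡 m) z z) :=
    (contDiffAt_chartFlow hK (mem_extChartAt_target z)
      (by rwa [extChartAt_to_inv])).differentiableAt (by simp)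
  have h1 : HasFDerivAt (fun y => chartFlow K z (s, y)) _ (extChartAt (𝓡 m) z z) :=
    hd.hasFDerivAt.comp _ (hasFDerivAt_prodMk_right s _)
  have hφ : HasMFDerivAt (𝓡 m) 𝓘(ℝ, EuclideanSpace ℝ (Fin m)) (extChartAt (𝓡 m) z) z
      (ContinuousLinearMap.id ℝ _) := by
    have := (mdifferentiableAt_extChartAt (I := 𝓡 m) (mem_chart_source _ z)).hasMFDerivAt
    rwa [mfderiv_extChartAt_self] at this
  have h2 := h1.hasMFDerivAt.comp z hφ
  have h3 : HasMFDerivAt (𝓡 m) (𝓡 m) (fun p => K (s, p)) z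
      (mfderiv (𝓡 m) (𝓡 m) (fun p => K (s, p)) z) :=
    ((hK.comp (contMDiff_const.prodMk contMDiff_id)).mdifferentiableAt (by simp)).hasMFDerivAt
  have h4 := (mdifferentiableAt_extChartAt (I := 𝓡 m)
    (by simpa using hs)).hasMFDerivAt.comp z h3
  have h5 := h2.congr_of_eventuallyEq (f₁ := extChartAt (𝓡 m) z ∘ fun p => K (s, p)) (by
    filter_upwards [extChartAt_source_mem_nhds (I := 𝓡 m) z] with p hp
    simp only [Function.comp, chartFlow, (extChartAt (𝓡 m) z).left_inv hp])
  exact congrArg (fun A : EuclideanSpace ℝ (Fin m) →L[ℝ] EuclideanSpace ℝ (Fin m) => A u)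
    (hasMFDerivAt_unique h5 h4)

/-- The time derivative of the flow in the chart is the coordinate expression of the generator. -/
theorem fderiv_chartFlow_inl (hK : ContMDiff (𝓘(ℝ, ℝ).prod (𝓡 m)) (𝓡 m) ∞ K)
    (hid : ∀ x, K (t, x) = x) {z : M} {y : EuclideanSpace ℝ (Fin m)}
    (hy : y ∈ (extChartAt (𝓡 m) z).target) :
    fderiv ℝ (chartFlow K z) (t, y) (1, 0) =
      mfderiv (𝓡 m) 𝓘(ℝ, EuclideanSpace ℝ (Fin m)) (extChartAt (𝓡 m) z)
        ((extChartAt (𝓡 m) z).symm y) (generator K t ((extChartAt (𝓡 m) z).symm y)) := by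
  set p := (extChartAt (𝓡 m) z).symm y with hp
  have hps : p ∈ (extChartAt (𝓡 m) z).source := (extChartAt (𝓡 m) z).map_target hy
  have hps' : K (t, p) ∈ (extChartAt (𝓡 m) z).source := by rwa [hid]
  have hd : DifferentiableAt ℝ (chartFlow K z) (t, y) :=
    (contDiffAt_chartFlow hK hy (by rwa [hid])).differentiableAt (by simp)
  have h1 : HasDerivAt (fun s => chartFlow K z (s, y)) _ t := hasDerivAt_flow hd
  have h3 : HasMFDerivAt 𝓘(ℝ, ℝ) (𝓡 m) (fun s => K (s, p)) t
      (mfderiv 𝓘(ℝ, ℝ) (𝓡 m) (fun s => K (s, p)) t) :=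
    ((hK.comp (contMDiff_id.prodMk contMDiff_const)).mdifferentiableAt (by simp)).hasMFDerivAt
  have h4 := (mdifferentiableAt_extChartAt (I := 𝓡 m)
    (by simpa using hps')).hasMFDerivAt.comp t h3
  have h5 := hasMFDerivAt_unique h1.hasFDerivAt.hasMFDerivAt h4
  have h6 := congrArg (fun A : ℝ →L[ℝ] EuclideanSpace ℝ (Fin m) => A 1) h5
  have h7 : ∀ q, q = p → ∀ w : EuclideanSpace ℝ (Fin m),
      (mfderiv (𝓡 m) 𝓘(ℝ, EuclideanSpace ℝ (Fin m)) (extChartAt (𝓡 m) z) q w :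
        EuclideanSpace ℝ (Fin m)) =
      mfderiv (𝓡 m) 𝓘(ℝ, EuclideanSpace ℝ (Fin m)) (extChartAt (𝓡 m) z) p w := by
    rintro _ rfl w; rfl
  have h8 : fderiv ℝ (chartFlow K z) (t, y) (1, 0) =
      mfderiv (𝓡 m) 𝓘(ℝ, EuclideanSpace ℝ (Fin m)) (extChartAt (𝓡 m) z) (K (t, p))
        (mfderiv 𝓘(ℝ, ℝ) (𝓡 m) (fun s => K (s, p)) t (1 : ℝ)) := by
    refine Eq.trans ?_ h6
    simp
  exact h8.trans (h7 _ (hid p) _)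

theorem chartFrame_fderiv_chartFlow (hK : ContMDiff (𝓘(ℝ, ℝ).prod (𝓡 m)) (𝓡 m) ∞ K)
    (hid : ∀ x, K (t, x) = x) {z : M} {y : EuclideanSpace ℝ (Fin m)}
    (hy : y ∈ (extChartAt (𝓡 m) z).target) :
    chartFrame z y (fderiv ℝ (chartFlow K z) (t, y) (1, 0)) =
      generator K t ((extChartAt (𝓡 m) z).symm y) := by
  rw [fderiv_chartFlow_inl hK hid hy]
  exact congrArg (fun A : EuclideanSpace ℝ (Fin m) →L[ℝ] EuclideanSpace ℝ (Fin m) =>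
    A (generator K t ((extChartAt (𝓡 m) z).symm y)))
    (mfderivWithin_extChartAt_symm_comp_mfderiv_extChartAt (I := 𝓡 m) hy)

omit [IsManifold (𝓡 m) ∞ M] in
theorem eventually_chartFlow_eq (hid : ∀ x, K (t, x) = x) (z : M) :
    ∀ᶠ y in 𝓝 (extChartAt (𝓡 m) z z), chartFlow K z (t, y) = y := by
  filter_upwards [extChartAt_target_mem_nhds (I := 𝓡 m) z] with y hy
  simp only [chartFlow, hid, (extChartAt (𝓡 m) z).right_inv hy]

omit [IsManifold (𝓡 m) ∞ M] in
theorem eventually_flow_mem_source (hK : ContMDiff (𝓘(ℝ, ℝ).prod (𝓡 m)) (𝓡 m) ∞ K)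
    (hid : ∀ x, K (t, x) = x) (z : M) :
    ∀ᶠ s in 𝓝 t, K (s, z) ∈ (extChartAt (𝓡 m) z).source := by
  have hc : Continuous fun s => K (s, z) := hK.continuous.comp (by fun_prop)
  have h := hc.continuousAt (x := t)
  refine h ?_
  change _ ∈ 𝓝 (K (t, z))
  rw [hid]
  exact extChartAt_source_mem_nhds z

theorem generator_eq_fderiv_chartFlow (hK : ContMDiff (𝓘(ℝ, ℝ).prod (𝓡 m)) (𝓡 m) ∞ K)
    (hid : ∀ x, K (t, x) = x) (z : M) :
    fderiv ℝ (chartFlow K z) (t, extChartAt (𝓡 m) z z) (1, 0) = generator K t z := by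
  have h := chartFrame_fderiv_chartFlow hK hid (mem_extChartAt_target (I := 𝓡 m) z)
  rw [chartFrame_self, extChartAt_to_inv] at h
  exact h

theorem contDiffAt_chartFlow_base (hK : ContMDiff (𝓘(ℝ, ℝ).prod (𝓡 m)) (𝓡 m) ∞ K)
    (hid : ∀ x, K (t, x) = x) (z : M) :
    ContDiffAt ℝ ∞ (chartFlow K z) (t, extChartAt (𝓡 m) z z) := by
  refine contDiffAt_chartFlow hK (mem_extChartAt_target z) ?_
  rw [hid, extChartAt_to_inv]
  exact mem_extChartAt_source z

/-- The coordinates of the generator are differentiable. -/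
theorem differentiableAt_fderiv_chartFlow (hK : ContMDiff (𝓘(ℝ, ℝ).prod (𝓡 m)) (𝓡 m) ∞ K)
    (hid : ∀ x, K (t, x) = x) (z : M) :
    DifferentiableAt ℝ (fun y => fderiv ℝ (chartFlow K z) (t, y) (1, 0))
      (extChartAt (𝓡 m) z z) := by
  have h1 : DifferentiableAt ℝ (fderiv ℝ (chartFlow K z)) (t, extChartAt (𝓡 m) z z) :=
    ((contDiffAt_chartFlow_base hK hid z).fderiv_right (m := 1) (by norm_cast)).differentiableAt
      (by simp)
  have h2 : DifferentiableAt ℝ (fun y => fderiv ℝ (chartFlow K z) (t, y))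
      (extChartAt (𝓡 m) z z) :=
    (h1.hasFDerivAt.comp _ (hasFDerivAt_prodMk_right t _)).differentiableAt
  exact h2.clm_apply (differentiableAt_const _)

theorem TwoTensor.pullback_eq_coeffTwo (Ω : TwoTensor m M)
    (hK : ContMDiff (𝓘(ℝ, ℝ).prod (𝓡 m)) (𝓡 m) ∞ K) {s : ℝ} {z : M}
    (hs : K (s, z) ∈ (extChartAt (𝓡 m) z).source) (u v : TangentSpace (𝓡 m) z) :
    Ω (K (s, z)) (mfderiv (𝓡 m) (𝓡 m) (fun p => K (s, p)) z u)
        (mfderiv (𝓡 m) (𝓡 m) (fun p => K (s, p)) z v) =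
      coeffTwo Ω z (chartFlow K z (s, extChartAt (𝓡 m) z z))
        (fderiv ℝ (chartFlow K z) (s, extChartAt (𝓡 m) z z) (0, u))
        (fderiv ℝ (chartFlow K z) (s, extChartAt (𝓡 m) z z) (0, v)) := by
  rw [fderiv_chartFlow_inr hK hs, fderiv_chartFlow_inr hK hs]
  have e : chartFlow K z (s, extChartAt (𝓡 m) z z) = extChartAt (𝓡 m) z (K (s, z)) := by
    simp only [chartFlow, extChartAt_to_inv]
  rw [e, coeffTwo_apply_mfderiv Ω hs]

/-- The coefficients of `i_X Ω` near the centre of a chart. -/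
theorem TwoTensor.hasFDerivAt_coeffOne_contraction (Ω : TwoTensor m M)
    (hK : ContMDiff (𝓘(ℝ, ℝ).prod (𝓡 m)) (𝓡 m) ∞ K) (hid : ∀ x, K (t, x) = x) (z : M) :
    HasFDerivAt (coeffOne (fun y => Ω y (generator K t y)) z)
      ((coeffTwo Ω z (extChartAt (𝓡 m) z z)).comp
        (fderiv ℝ (fun y => fderiv ℝ (chartFlow K z) (t, y) (1, 0)) (extChartAt (𝓡 m) z z)) +
        (fderiv ℝ (coeffTwo Ω z) (extChartAt (𝓡 m) z z)).flip
          (fderiv ℝ (chartFlow K z) (t, extChartAt (𝓡 m) z z) (1, 0)))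
      (extChartAt (𝓡 m) z z) := by
  have hnhds := extChartAt_target_mem_nhds (I := 𝓡 m) z
  have hΩ : DifferentiableAt ℝ (coeffTwo Ω z) (extChartAt (𝓡 m) z z) :=
    ((Ω.contDiffOn_coeffTwo z).contDiffAt hnhds).differentiableAt (by simp)
  refine (hΩ.hasFDerivAt.clm_apply
    (differentiableAt_fderiv_chartFlow hK hid z).hasFDerivAt).congr_of_eventuallyEq ?_
  filter_upwards [hnhds] with y hy
  ext w
  exact congrArg (fun a => Ω ((extChartAt (𝓡 m) z).symm y) a (chartFrame z y w))
    (chartFrame_fderiv_chartFlow hK hid hy).symm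

theorem TwoTensor.dOne_contraction (Ω : TwoTensor m M)
    (hK : ContMDiff (𝓘(ℝ, ℝ).prod (𝓡 m)) (𝓡 m) ∞ K) (hid : ∀ x, K (t, x) = x) (z : M)
    (u v : EuclideanSpace ℝ (Fin m)) :
    dOne (fun y => Ω y (generator K t y)) z u v =
      (coeffTwo Ω z (extChartAt (𝓡 m) z z)
        (fderiv ℝ (fun y => fderiv ℝ (chartFlow K z) (t, y) (1, 0)) (extChartAt (𝓡 m) z z) u) v
      + fderiv ℝ (coeffTwo Ω z) (extChartAt (𝓡 m) z z) u
        (fderiv ℝ (chartFlow K z) (t, extChartAt (𝓡 m) z z) (1, 0)) v)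
      - (coeffTwo Ω z (extChartAt (𝓡 m) z z)
        (fderiv ℝ (fun y => fderiv ℝ (chartFlow K z) (t, y) (1, 0)) (extChartAt (𝓡 m) z z) v) u
      + fderiv ℝ (coeffTwo Ω z) (extChartAt (𝓡 m) z z) v
        (fderiv ℝ (chartFlow K z) (t, extChartAt (𝓡 m) z z) (1, 0)) u) := by
  have hα := Ω.hasFDerivAt_coeffOne_contraction hK hid z
  have hα' : ∀ a b : EuclideanSpace ℝ (Fin m),
      fderiv ℝ (coeffOne (fun y => Ω y (generator K t y)) z) (extChartAt (𝓡 m) z z) a b =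
      coeffTwo Ω z (extChartAt (𝓡 m) z z)
        (fderiv ℝ (fun y => fderiv ℝ (chartFlow K z) (t, y) (1, 0)) (extChartAt (𝓡 m) z z) a) b
      + fderiv ℝ (coeffTwo Ω z) (extChartAt (𝓡 m) z z) a
        (fderiv ℝ (chartFlow K z) (t, extChartAt (𝓡 m) z z) (1, 0)) b := by
    intro a b
    rw [hα.fderiv]
    rfl
  exact (dOne_eq_of_differentiableAt _ z hα.differentiableAt u v).trans
    (congrArg₂ (fun a b : ℝ => a - b) (hα' u v) (hα' v u))

/-- Cartan's formula for 2-forms: the derivative of `K_s^* Ω` at a time with `K_s = id` is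
`L_X Ω = d (i_X Ω) + i_X dΩ`. -/
theorem TwoTensor.hasDerivAt_pullback (Ω : TwoTensor m M)
    (halt : ∀ (x : M) (v : TangentSpace (𝓡 m) x), Ω x v v = 0)
    (hK : ContMDiff (𝓘(ℝ, ℝ).prod (𝓡 m)) (𝓡 m) ∞ K) (hid : ∀ x, K (t, x) = x) (z : M)
    (u v : TangentSpace (𝓡 m) z) :
    HasDerivAt (fun s => Ω (K (s, z)) (mfderiv (𝓡 m) (𝓡 m) (fun p => K (s, p)) z u)
        (mfderiv (𝓡 m) (𝓡 m) (fun p => K (s, p)) z v))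
      (dOne (fun y => Ω y (generator K t y)) z u v + dTwo Ω z (generator K t z) u v) t := by
  have hΩ : DifferentiableAt ℝ (coeffTwo Ω z) (extChartAt (𝓡 m) z z) :=
    ((Ω.contDiffOn_coeffTwo z).contDiffAt
      (extChartAt_target_mem_nhds (I := 𝓡 m) z)).differentiableAt (by simp)
  have h := hasDerivAt_pullback_two
    ((contDiffAt_chartFlow_base hK hid z).of_le (by norm_cast))
    (eventually_chartFlow_eq hid z) hΩ u v
  have hswap : ∀ a b : EuclideanSpace ℝ (Fin m),
      coeffTwo Ω z (extChartAt (𝓡 m) z z) a b = -coeffTwo Ω z (extChartAt (𝓡 m) z z) b a := by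
    have h0 : ∀ a, coeffTwo Ω z (extChartAt (𝓡 m) z z) a a = 0 := fun a => halt _ _
    intro a b
    have h1 := h0 (a + b)
    rw [map_add, map_add, add_apply, add_apply, h0, h0] at h1
    linarith
  refine (h.congr_of_eventuallyEq ((eventually_flow_mem_source hK hid z).mono fun s hs =>
    Ω.pullback_eq_coeffTwo hK hs u v)).congr_deriv ?_
  rw [Ω.dOne_contraction hK hid z u v, dTwo_eq_of_differentiableAt _ z hΩ,
    generator_eq_fderiv_chartFlow hK hid z, hswap u]
  ring

/-- Cartan's formula for 1-forms. -/
theorem OneForm.hasDerivAt_pullback (α : OneForm m M)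
    (hK : ContMDiff (𝓘(ℝ, ℝ).prod (𝓡 m)) (𝓡 m) ∞ K) (hid : ∀ x, K (t, x) = x) (z : M)
    (hf : ContMDiff (𝓡 m) 𝓘(ℝ, ℝ) ∞ (fun y => α y (generator K t y)))
    (u : TangentSpace (𝓡 m) z) :
    HasDerivAt (fun s => α (K (s, z)) (mfderiv (𝓡 m) (𝓡 m) (fun p => K (s, p)) z u))
      (dFun (fun y => α y (generator K t y)) z u + dOne α z (generator K t z) u) t := by
  have hnhds := extChartAt_target_mem_nhds (I := 𝓡 m) z
  have hα : DifferentiableAt ℝ (coeffOne α z) (extChartAt (𝓡 m) z z) :=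
    ((α.contDiffOn_coeffOne z).contDiffAt hnhds).differentiableAt (by simp)
  have hX := differentiableAt_fderiv_chartFlow hK hid z
  have hdiff := contDiffAt_chartFlow_base hK hid z
  have h := hasDerivAt_pullback_one (hdiff.of_le (by norm_cast))
    (eventually_chartFlow_eq hid z) hα u
  have hev : ∀ᶠ s in 𝓝 t,
      α (K (s, z)) (mfderiv (𝓡 m) (𝓡 m) (fun p => K (s, p)) z u) =
      coeffOne α z (chartFlow K z (s, extChartAt (𝓡 m) z z))
        (fderiv ℝ (chartFlow K z) (s, extChartAt (𝓡 m) z z) (0, u)) := by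
    filter_upwards [eventually_flow_mem_source hK hid z] with s hs
    rw [fderiv_chartFlow_inr hK hs]
    have e : chartFlow K z (s, extChartAt (𝓡 m) z z) = extChartAt (𝓡 m) z (K (s, z)) := by
      simp only [chartFlow, extChartAt_to_inv]
    rw [e, coeffOne_apply_mfderiv α hs]
  have hcoeff : (fun y => α ((extChartAt (𝓡 m) z).symm y)
      (generator K t ((extChartAt (𝓡 m) z).symm y))) =ᶠ[𝓝 (extChartAt (𝓡 m) z z)]
      fun y => coeffOne α z y (fderiv ℝ (chartFlow K z) (t, y) (1, 0)) := by
    filter_upwards [hnhds] with y hy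
    exact congrArg (fun a => α ((extChartAt (𝓡 m) z).symm y) a)
      (chartFrame_fderiv_chartFlow hK hid hy).symm
  have hf' : dFun (fun y => α y (generator K t y)) z u =
      coeffOne α z (extChartAt (𝓡 m) z z)
        (fderiv ℝ (fun y => fderiv ℝ (chartFlow K z) (t, y) (1, 0)) (extChartAt (𝓡 m) z z) u)
      + fderiv ℝ (coeffOne α z) (extChartAt (𝓡 m) z z) u (generator K t z) := by
    rw [dFun_eq_of_contMDiff hf,
      ((hα.hasFDerivAt.clm_apply hX.hasFDerivAt).congr_of_eventuallyEq hcoeff).fderiv,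
      ← generator_eq_fderiv_chartFlow hK hid z]
    rfl
  have h1 := dOne_eq_of_differentiableAt _ z hα (generator K t z) u
  rw [generator_eq_fderiv_chartFlow hK hid z] at h
  refine (h.congr_of_eventuallyEq hev).congr_deriv ?_
  linear_combination -h1 - hf'

end Cartan

/-! ### Smooth paths of diffeomorphisms and their velocity -/

section Paths

variable {m : ℕ} {M : Type*} [TopologicalSpace M] [ChartedSpace (EuclideanSpace ℝ (Fin m)) M]
  [IsManifold (𝓡 m) ∞ M]

theorem OneForm.congr_point (α : OneForm m M) {p q : M} (h : p = q)
    (a : EuclideanSpace ℝ (Fin m)) : α p a = α q a := by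
  subst h; rfl

theorem TwoTensor.congr_point (Ω : TwoTensor m M) {p q : M} (h : p = q)
    (a b : EuclideanSpace ℝ (Fin m)) : Ω p a b = Ω q a b := by
  subst h; rfl

/-- The vector `∂/∂t` of `ℝ × M` at a given point. -/
def timeLift (m : ℕ) {M : Type*} [TopologicalSpace M] [ChartedSpace (EuclideanSpace ℝ (Fin m)) M]
    (q : ℝ × M) : TangentBundle (𝓘(ℝ, ℝ).prod (𝓡 m)) (ℝ × M) :=
  ⟨q, (1, 0)⟩

theorem contMDiff_timeLift : ContMDiff (𝓘(ℝ, ℝ).prod (𝓡 m)) (𝓘(ℝ, ℝ).prod (𝓡 m)).tangent ∞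
    (timeLift m (M := M)) := by
  have h1 : ContMDiff (𝓘(ℝ, ℝ).prod (𝓡 m)) (𝓘(ℝ, ℝ).tangent.prod (𝓡 m).tangent) ∞
      (fun q : ℝ × M => ((⟨q.1, (1 : ℝ)⟩ : TangentBundle 𝓘(ℝ, ℝ) ℝ),
        zeroSection (EuclideanSpace ℝ (Fin m)) (TangentSpace (𝓡 m) : M → Type _) q.2)) :=
    (contMDiff_tangentBundle_real_mk.comp (contMDiff_fst.prodMk contMDiff_const)).prodMk
      ((contMDiff_zeroSection ℝ (TangentSpace (𝓡 m) : M → Type _)).comp contMDiff_snd)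
  exact contMDiff_equivTangentBundleProd_symm.comp h1

omit [IsManifold (𝓡 m) ∞ M] in
/-- The time derivative of a map on `ℝ × M` is its differential along `∂/∂t`. -/
theorem mfderiv_time_eq {G : ℝ × M → M} (hG : MDifferentiable (𝓘(ℝ, ℝ).prod (𝓡 m)) (𝓡 m) G)
    (t : ℝ) (x : M) :
    (mfderiv 𝓘(ℝ, ℝ) (𝓡 m) (fun s => G (s, x)) t (1 : ℝ) : EuclideanSpace ℝ (Fin m)) =
      mfderiv (𝓘(ℝ, ℝ).prod (𝓡 m)) (𝓡 m) G (t, x) ((1 : ℝ), (0 : EuclideanSpace ℝ (Fin m))) := by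
  have h := mfderiv_comp (I := 𝓘(ℝ, ℝ)) t (hG (t, x))
    (mdifferentiableAt_id.prodMk (mdifferentiableAt_const (c := x)))
  have h' : mfderiv 𝓘(ℝ, ℝ) (𝓡 m) (fun s => G (s, x)) t =
    (mfderiv (𝓘(ℝ, ℝ).prod (𝓡 m)) (𝓡 m) G (t, x)).comp
      (mfderiv 𝓘(ℝ, ℝ) (𝓘(ℝ, ℝ).prod (𝓡 m)) (fun s => (s, x)) t) := h
  rw [h', mfderiv_prod_left]
  rfl

/-- A smooth path of diffeomorphisms with smooth inverses. -/
structure IsSmoothPath (g : ℝ → (M ≃ₘ⟮𝓡 m, 𝓡 m⟯ M)) : Prop where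
  smooth : ContMDiff (𝓘(ℝ, ℝ).prod (𝓡 m)) (𝓡 m) ∞ (fun p : ℝ × M => g p.1 p.2)
  smooth_symm : ContMDiff (𝓘(ℝ, ℝ).prod (𝓡 m)) (𝓡 m) ∞ (fun p : ℝ × M => (g p.1).symm p.2)

variable {g : ℝ → (M ≃ₘ⟮𝓡 m, 𝓡 m⟯ M)}

namespace IsSmoothPath

omit [IsManifold (𝓡 m) ∞ M] in
theorem contMDiff_translate (hg : IsSmoothPath g) (t : ℝ) :
    ContMDiff (𝓘(ℝ, ℝ).prod (𝓡 m)) (𝓡 m) ∞ (fun p : ℝ × M => g p.1 ((g t).symm p.2)) :=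
  hg.smooth.comp (contMDiff_fst.prodMk ((g t).symm.contMDiff.comp contMDiff_snd))

omit [IsManifold (𝓡 m) ∞ M] in
/-- The velocity in terms of tangent maps: `X_t(x) = TG(∂/∂t)` at the point `(t, g_t⁻¹ x)`, where
`G(t, x) = g_t x`. -/
theorem velocity_eq_tangentMap (hg : IsSmoothPath g) (t : ℝ) (x : M) :
    (⟨x, LCSStructure.velocity g t x⟩ : TangentBundle (𝓡 m) M) =
      tangentMap (𝓘(ℝ, ℝ).prod (𝓡 m)) (𝓡 m) (fun p : ℝ × M => g p.1 p.2)
        (timeLift m (t, (g t).symm x)) := by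
  have h := mfderiv_time_eq (hg.smooth.mdifferentiable (by simp)) t ((g t).symm x)
  have h2 : ∀ p q : M, p = q → ∀ a b : EuclideanSpace ℝ (Fin m), a = b →
      (⟨p, a⟩ : TangentBundle (𝓡 m) M) = ⟨q, b⟩ := by
    rintro _ _ rfl _ _ rfl; rfl
  exact h2 x (g t ((g t).symm x)) ((g t).apply_symm_apply x).symm _ _ h

/-- The velocity of a smooth path depends smoothly on time and space. -/
theorem contMDiff_velocity (hg : IsSmoothPath g) :
    ContMDiff (𝓘(ℝ, ℝ).prod (𝓡 m)) (𝓡 m).tangent ∞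
      (fun q : ℝ × M => (⟨q.2, LCSStructure.velocity g q.1 q.2⟩ : TangentBundle (𝓡 m) M)) := by
  have h := (hg.smooth.contMDiff_tangentMap (m := ∞) le_rfl).comp
    (contMDiff_timeLift.comp (contMDiff_fst.prodMk hg.smooth_symm))
  refine h.congr fun q => hg.velocity_eq_tangentMap q.1 q.2

theorem contMDiff_velocity_slice (hg : IsSmoothPath g) (t : ℝ) :
    ContMDiff (𝓡 m) (𝓡 m).tangent ∞
      (fun x : M => (⟨x, LCSStructure.velocity g t x⟩ : TangentBundle (𝓡 m) M)) :=
  hg.contMDiff_velocity.comp (contMDiff_const.prodMk contMDiff_id)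

omit [IsManifold (𝓡 m) ∞ M] in
/-- Along the trajectories, the velocity is the time derivative. -/
theorem velocity_apply (hg : IsSmoothPath g) (t : ℝ) (x : M) :
    (LCSStructure.velocity g t (g t x) : EuclideanSpace ℝ (Fin m)) =
      mfderiv (𝓘(ℝ, ℝ).prod (𝓡 m)) (𝓡 m) (fun p : ℝ × M => g p.1 p.2) (t, x)
        ((1 : ℝ), (0 : EuclideanSpace ℝ (Fin m))) := by
  have h := mfderiv_time_eq (hg.smooth.mdifferentiable (by simp)) t x
  have h2 : ∀ y, y = x → (mfderiv 𝓘(ℝ, ℝ) (𝓡 m) (fun s => g s y) t (1 : ℝ) :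
      EuclideanSpace ℝ (Fin m)) = mfderiv 𝓘(ℝ, ℝ) (𝓡 m) (fun s => g s x) t (1 : ℝ) := by
    rintro _ rfl; rfl
  exact (h2 _ ((g t).symm_apply_apply x)).trans h

omit [IsManifold (𝓡 m) ∞ M] in
/-- The chain rule for `g_s = (g_s g_t⁻¹) g_t`. -/
theorem mfderiv_translate (hg : IsSmoothPath g) (s t : ℝ) (x : M) (u : TangentSpace (𝓡 m) x) :
    (mfderiv (𝓡 m) (𝓡 m) (fun p => g s ((g t).symm p)) (g t x)
      (mfderiv (𝓡 m) (𝓡 m) (g t) x u) : EuclideanSpace ℝ (Fin m)) =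
      mfderiv (𝓡 m) (𝓡 m) (g s) x u := by
  have h := mfderiv_comp (I := 𝓡 m) (I' := 𝓡 m) (I'' := 𝓡 m) x
    (((hg.contMDiff_translate t).comp
      (contMDiff_const (c := s) |>.prodMk contMDiff_id)).mdifferentiableAt (x := g t x) (by simp))
    ((g t).contMDiff.mdifferentiableAt (by simp))
  have e : ((fun p : ℝ × M => g p.1 ((g t).symm p.2)) ∘ fun x => (s, id x)) ∘ g t = g s := by
    funext p
    simp
  have h' := congrArg (fun A : EuclideanSpace ℝ (Fin m) →L[ℝ] EuclideanSpace ℝ (Fin m) => A u) h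
  have h2 : ∀ f : M → M, f = g s → ((mfderiv (𝓡 m) (𝓡 m) f x :
      EuclideanSpace ℝ (Fin m) →L[ℝ] EuclideanSpace ℝ (Fin m)) u) =
      mfderiv (𝓡 m) (𝓡 m) (g s) x u := by
    rintro _ rfl; rfl
  exact h'.symm.trans (h2 _ e)

/-- `d/dt (g_t^* Ω) = g_t^* (L_{X_t} Ω)`. -/
theorem hasDerivAt_pullback_two (hg : IsSmoothPath g) (Ω : TwoTensor m M)
    (halt : ∀ (x : M) (v : TangentSpace (𝓡 m) x), Ω x v v = 0) (t : ℝ) (x : M)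
    (u v : TangentSpace (𝓡 m) x) :
    HasDerivAt (fun s => Ω (g s x) (mfderiv (𝓡 m) (𝓡 m) (g s) x u)
        (mfderiv (𝓡 m) (𝓡 m) (g s) x v))
      (dOne (fun y => Ω y (LCSStructure.velocity g t y)) (g t x)
          (mfderiv (𝓡 m) (𝓡 m) (g t) x u) (mfderiv (𝓡 m) (𝓡 m) (g t) x v)
        + dTwo Ω (g t x) (LCSStructure.velocity g t (g t x))
          (mfderiv (𝓡 m) (𝓡 m) (g t) x u) (mfderiv (𝓡 m) (𝓡 m) (g t) x v)) t := by
  have h := Ω.hasDerivAt_pullback halt (hg.contMDiff_translate t)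
    (fun y => (g t).apply_symm_apply y) (g t x)
    (mfderiv (𝓡 m) (𝓡 m) (g t) x u) (mfderiv (𝓡 m) (𝓡 m) (g t) x v)
  refine h.congr_of_eventuallyEq (Filter.Eventually.of_forall fun s => ?_)
  have e := Ω.congr_point (congrArg (g s) ((g t).symm_apply_apply x))
    (mfderiv (𝓡 m) (𝓡 m) (g s) x u) (mfderiv (𝓡 m) (𝓡 m) (g s) x v)
  refine e.symm.trans ?_
  exact congrArg₂ (fun a b => Ω (g s ((g t).symm (g t x))) a b)
    (hg.mfderiv_translate s t x u).symm (hg.mfderiv_translate s t x v).symm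

/-- `d/dt (g_t^* α) = g_t^* (L_{X_t} α)`. -/
theorem hasDerivAt_pullback_one (hg : IsSmoothPath g) (α : OneForm m M) (t : ℝ) (x : M)
    (u : TangentSpace (𝓡 m) x) :
    HasDerivAt (fun s => α (g s x) (mfderiv (𝓡 m) (𝓡 m) (g s) x u))
      (dFun (fun y => α y (LCSStructure.velocity g t y)) (g t x) (mfderiv (𝓡 m) (𝓡 m) (g t) x u)
        + dOne α (g t x) (LCSStructure.velocity g t (g t x))
          (mfderiv (𝓡 m) (𝓡 m) (g t) x u)) t := by
  have h := α.hasDerivAt_pullback (hg.contMDiff_translate t)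
    (fun y => (g t).apply_symm_apply y) (g t x)
    (α.contMDiff_apply (hg.contMDiff_velocity_slice t)) (mfderiv (𝓡 m) (𝓡 m) (g t) x u)
  refine h.congr_of_eventuallyEq (Filter.Eventually.of_forall fun s => ?_)
  have e := α.congr_point (congrArg (g s) ((g t).symm_apply_apply x))
    (mfderiv (𝓡 m) (𝓡 m) (g s) x u)
  refine e.symm.trans ?_
  exact congrArg (fun a => α (g s ((g t).symm (g t x))) a) (hg.mfderiv_translate s t x u).symm

end IsSmoothPath

end Paths

/-! ### Fields in `ker Φ` and conformal paths -/

namespace LCSStructure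

variable {m : ℕ} {M : Type*} [TopologicalSpace M] [ChartedSpace (EuclideanSpace ℝ (Fin m)) M]
  [IsManifold (𝓡 m) ∞ M] (L : LCSStructure m M)

/-- A field lies in `ker Φ` when it is smooth and `L_X Ω = -ω(X) Ω`; the condition on `L_X ω` is
then automatic because `ω` is closed. -/
theorem mem_kerPhi_iff {X : ∀ x : M, TangentSpace (𝓡 m) x} :
    X ∈ L.kerPhi ↔
      ContMDiff (𝓡 m) (𝓡 m).tangent ∞ (fun x => (⟨x, X x⟩ : TangentBundle (𝓡 m) M)) ∧
      ∀ (x : M) (u v : TangentSpace (𝓡 m) x),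
        dOne (fun y => L.form y (X y)) x u v + dTwo L.form x (X x) u v
          = -(L.lee x (X x) * L.form x u v) := by
  constructor
  · rintro ⟨f, hf, h⟩
    refine ⟨hf.smooth_field, fun x u v => ?_⟩
    rw [hf.lie_form, sub_eq_zero.1 (h x)]
  · rintro ⟨h1, h2⟩
    refine ⟨fun x => L.lee x (X x), ⟨h1, L.lee.contMDiff_apply h1, h2, fun x v => ?_⟩,
      fun x => sub_self _⟩
    rw [L.closed, add_zero]

/-- For fields in `ker Φ`, the contraction `i_X Ω` is `d^ω`-closed. -/
theorem dTwistOne_contraction {X : ∀ x : M, TangentSpace (𝓡 m) x} (hX : X ∈ L.kerPhi) (x : M)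
    (u v : TangentSpace (𝓡 m) x) : L.dTwistOne (fun y => L.form y (X y)) x u v = 0 := by
  have h := (L.mem_kerPhi_iff.1 hX).2 x u v
  rw [L.structure_eq] at h
  unfold dTwistOne
  linear_combination h

/-- A path `g_t` of diffeomorphisms is conformal with potential `φ` when `g_t^* Ω = e^{φ_t} Ω` and
`dφ = ω - G^* ω` on `ℝ × M`, where `G (t, x) = g_t x` and `ω` is pulled back from `M`. -/
structure IsConformalPath (g : ℝ → (M ≃ₘ⟮𝓡 m, 𝓡 m⟯ M)) (φ : ℝ × M → ℝ) : Prop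
    extends IsSmoothPath g where
  smooth_potential : ContMDiff (𝓘(ℝ, ℝ).prod (𝓡 m)) 𝓘(ℝ, ℝ) ∞ φ
  mfderiv_potential : ∀ (q : ℝ × M) (w : TangentSpace (𝓘(ℝ, ℝ).prod (𝓡 m)) q),
    (mfderiv (𝓘(ℝ, ℝ).prod (𝓡 m)) 𝓘(ℝ, ℝ) φ q w : ℝ) = L.lee q.2 w.2 -
      L.lee (g q.1 q.2)
        (mfderiv (𝓘(ℝ, ℝ).prod (𝓡 m)) (𝓡 m) (fun p : ℝ × M => g p.1 p.2) q w)
  pullback_form : ∀ (t : ℝ) (x : M) (u v : TangentSpace (𝓡 m) x),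
    L.form (g t x) (mfderiv (𝓡 m) (𝓡 m) (g t) x u) (mfderiv (𝓡 m) (𝓡 m) (g t) x v) =
      Real.exp (φ (t, x)) * L.form x u v

variable {L} {g : ℝ → (M ≃ₘ⟮𝓡 m, 𝓡 m⟯ M)} {φ : ℝ × M → ℝ}

omit [IsManifold (𝓡 m) ∞ M] in
theorem _root_.Diffeomorph.exists_mfderiv_apply_eq (g : M ≃ₘ⟮𝓡 m, 𝓡 m⟯ M) (z : M)
    (u : EuclideanSpace ℝ (Fin m)) :
    ∃ u' : EuclideanSpace ℝ (Fin m), mfderiv (𝓡 m) (𝓡 m) g (g.symm z) u' = u := by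
  have h := mfderiv_comp (I := 𝓡 m) (I' := 𝓡 m) (I'' := 𝓡 m) z
    (g.contMDiff.mdifferentiableAt (x := g.symm z) (by simp))
    (g.symm.contMDiff.mdifferentiableAt (by simp))
  have e : (g ∘ g.symm : M → M) = id := funext fun p => g.apply_symm_apply p
  rw [e, mfderiv_id] at h
  exact ⟨mfderiv (𝓡 m) (𝓡 m) g.symm z u,
    (congrArg (fun A : EuclideanSpace ℝ (Fin m) →L[ℝ] EuclideanSpace ℝ (Fin m) => A u) h).symm⟩

/-- The time component of `dφ = ω - G^* ω`. -/
theorem IsConformalPath.hasDerivAt_potential (h : L.IsConformalPath g φ) (t : ℝ) (x : M) :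
    HasDerivAt (fun s => φ (s, x)) (-L.lee (g t x) (velocity g t (g t x))) t := by
  let A : ℝ × EuclideanSpace ℝ (Fin m) →L[ℝ] ℝ :=
    mfderiv (𝓘(ℝ, ℝ).prod (𝓡 m)) 𝓘(ℝ, ℝ) φ (t, x)
  have h1 : HasMFDerivAt 𝓘(ℝ, ℝ) 𝓘(ℝ, ℝ) (fun s => φ (s, x)) t
      (A.comp ((ContinuousLinearMap.id ℝ ℝ).prod 0)) :=
    ((h.smooth_potential.mdifferentiableAt (x := (t, x)) (by simp)).hasMFDerivAt).comp t
      ((hasMFDerivAt_id t).prodMk (hasMFDerivAt_const x t))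
  have h2 : HasFDerivAt (fun s => φ (s, x)) (A.comp ((ContinuousLinearMap.id ℝ ℝ).prod 0)) t :=
    h1.hasFDerivAt
  refine h2.hasDerivAt.congr_deriv ?_
  have h3 := h.mfderiv_potential (t, x) ((1 : ℝ), (0 : EuclideanSpace ℝ (Fin m)))
  have h4 : L.lee x (0 : EuclideanSpace ℝ (Fin m)) = 0 := map_zero (L.lee x)
  have h5 := congrArg (fun a => L.lee (g t x) a) (h.toIsSmoothPath.velocity_apply t x)
  refine Eq.trans h3 ?_
  refine Eq.trans (congrArg₂ (fun a b : ℝ => a - b) h4 h5.symm) (zero_sub _)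

/-- A conformal path is generated by fields in `ker Φ`. -/
theorem IsConformalPath.velocity_mem (h : L.IsConformalPath g φ) (t : ℝ) :
    velocity g t ∈ L.kerPhi := by
  refine L.mem_kerPhi_iff.2 ⟨h.toIsSmoothPath.contMDiff_velocity_slice t, fun z u v => ?_⟩
  obtain ⟨x, rfl⟩ : ∃ x, g t x = z := ⟨_, (g t).apply_symm_apply z⟩
  have hs : ∀ u : TangentSpace (𝓡 m) (g t x),
      ∃ u' : TangentSpace (𝓡 m) x, mfderiv (𝓡 m) (𝓡 m) (g t) x u' = u := by
    intro u
    have := Diffeomorph.exists_mfderiv_apply_eq (g t) (g t x) u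
    rwa [(g t).symm_apply_apply x] at this
  obtain ⟨u', rfl⟩ := hs u
  obtain ⟨v', rfl⟩ := hs v
  have h1 := h.toIsSmoothPath.hasDerivAt_pullback_two L.form L.alternating t x u' v'
  have h2 := ((h.hasDerivAt_potential t x).exp).mul_const (L.form x u' v')
  have h3 := h1.unique (h2.congr_of_eventuallyEq
    (Filter.Eventually.of_forall fun s => h.pullback_form s x u' v'))
  rw [h3, h.pullback_form]
  ring

end LCSStructure

/-! ### The potential of an isotopy generated by `ker Φ` -/

namespace LCSStructure

variable {m : ℕ} {M : Type*} [TopologicalSpace M] [ChartedSpace (EuclideanSpace ℝ (Fin m)) M]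
  [IsManifold (𝓡 m) ∞ M] (L : LCSStructure m M) {g : ℝ → (M ≃ₘ⟮𝓡 m, 𝓡 m⟯ M)}

/-- The value of the Lee form on the velocity, `(t, x) ↦ ω(X_t)(g_t x)`. -/
noncomputable def leeSpeed (g : ℝ → (M ≃ₘ⟮𝓡 m, 𝓡 m⟯ M)) (q : ℝ × M) : ℝ :=
  L.lee (g q.1 q.2) (velocity g q.1 (g q.1 q.2))

/-- The potential `(t, x) ↦ -∫₀ᵗ ω(X_s)(g_s x) ds` of a path. -/
noncomputable def potential (g : ℝ → (M ≃ₘ⟮𝓡 m, 𝓡 m⟯ M)) (q : ℝ × M) : ℝ :=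
  -∫ s in (0 : ℝ)..q.1, L.leeSpeed g (s, q.2)

theorem contMDiff_leeSpeed (hg : IsSmoothPath g) :
    ContMDiff (𝓘(ℝ, ℝ).prod (𝓡 m)) 𝓘(ℝ, ℝ) ∞ (L.leeSpeed g) :=
  L.lee.contMDiff_apply (hg.contMDiff_velocity.comp (contMDiff_fst.prodMk hg.smooth))

/-- Smoothness in the upper limit of integration follows from the substitution `s = tσ`, which makes
the limits constant. -/
theorem contMDiff_potential (hg : IsSmoothPath g) :
    ContMDiff (𝓘(ℝ, ℝ).prod (𝓡 m)) 𝓘(ℝ, ℝ) ∞ (L.potential g) := by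
  have hmul : ContMDiff (𝓘(ℝ, ℝ).prod (𝓘(ℝ, ℝ).prod (𝓡 m))) 𝓘(ℝ, ℝ) ∞
      (fun p : ℝ × (ℝ × M) => p.2.1 * p.1) :=
    ContMDiff.mul (contMDiff_fst.comp contMDiff_snd) contMDiff_fst
  have h1 : ContMDiff (𝓘(ℝ, ℝ).prod (𝓘(ℝ, ℝ).prod (𝓡 m))) 𝓘(ℝ, ℝ) ∞
      (fun p : ℝ × (ℝ × M) => L.leeSpeed g (p.2.1 * p.1, p.2.2)) :=
    (L.contMDiff_leeSpeed hg).comp (hmul.prodMk (contMDiff_snd.comp contMDiff_snd))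
  have h2 := contMDiff_intervalIntegral h1 0 1
  have h3 : ContMDiff (𝓘(ℝ, ℝ).prod (𝓡 m)) 𝓘(ℝ, ℝ) ∞
      (fun q : ℝ × M => -(q.1 * ∫ σ in (0 : ℝ)..1, L.leeSpeed g (q.1 * σ, q.2))) :=
    (contDiff_neg (𝕜 := ℝ) (F := ℝ)).contMDiff.comp (ContMDiff.mul contMDiff_fst h2)
  refine h3.congr fun q => ?_
  have h4 := intervalIntegral.smul_integral_comp_mul_left (a := 0) (b := 1)
    (fun s => L.leeSpeed g (s, q.2)) q.1
  rw [mul_zero, mul_one] at h4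
  rw [potential, ← h4, smul_eq_mul]

theorem potential_zero (g : ℝ → (M ≃ₘ⟮𝓡 m, 𝓡 m⟯ M)) (x : M) : L.potential g (0, x) = 0 := by
  simp [potential]

theorem hasDerivAt_potential (hg : IsSmoothPath g) (t : ℝ) (x : M) :
    HasDerivAt (fun s => L.potential g (s, x)) (-L.leeSpeed g (t, x)) t := by
  have hc : Continuous fun s => L.leeSpeed g (s, x) :=
    (L.contMDiff_leeSpeed hg).continuous.comp (by fun_prop)
  exact (intervalIntegral.integral_hasDerivAt_right (hc.intervalIntegrable _ _)
    (hc.stronglyMeasurableAtFilter _ _) hc.continuousAt).neg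

/-- The derivative of `g_s^* ω` in time is `d (ω(X_s) ∘ g_s)`, because `ω` is closed. -/
theorem hasDerivAt_pullback_lee (hg : IsSmoothPath g) (t : ℝ) (x : M)
    (u : TangentSpace (𝓡 m) x) :
    HasDerivAt (fun s => L.lee (g s x) (mfderiv (𝓡 m) (𝓡 m) (g s) x u))
      (sliceDifferential (I := 𝓡 m) (L.leeSpeed g) (t, ⟨x, u⟩)) t := by
  refine (hg.hasDerivAt_pullback_one L.lee t x u).congr_deriv ?_
  rw [L.closed, add_zero]
  have h1 : ContMDiff (𝓡 m) 𝓘(ℝ, ℝ) ∞ (fun y => L.lee y (velocity g t y)) :=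
    L.lee.contMDiff_apply (hg.contMDiff_velocity_slice t)
  have h2 := mfderiv_comp (I := 𝓡 m) (I' := 𝓡 m) (I'' := 𝓘(ℝ, ℝ)) x
    (h1.mdifferentiableAt (x := g t x) (by simp))
    ((g t).contMDiff.mdifferentiableAt (by simp))
  have h3 := mfderiv_slice_eq_tangentMap
    ((L.contMDiff_leeSpeed hg).mdifferentiable (by simp)) t (⟨x, u⟩ : TangentBundle (𝓡 m) M)
  have h4 := congrArg (fun w : TangentBundle 𝓘(ℝ, ℝ) ℝ => (w.2 : ℝ)) h3
  exact (congrArg (fun A : EuclideanSpace ℝ (Fin m) →L[ℝ] ℝ => A u) h2).symm.trans h4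

theorem continuous_sliceDifferential_leeSpeed (hg : IsSmoothPath g)
    (p : TangentBundle (𝓡 m) M) :
    Continuous fun s => sliceDifferential (I := 𝓡 m) (L.leeSpeed g) (s, p) := by
  have h := (contMDiff_snd_tangentBundle_modelSpace (n := ∞) ℝ 𝓘(ℝ, ℝ)).comp
    (((L.contMDiff_leeSpeed hg).contMDiff_tangentMap (m := ∞) le_rfl).comp
      (contMDiff_zeroTimeLift (I := 𝓡 m) (N := M)))
  exact h.continuous.comp (by fun_prop : Continuous fun s : ℝ => (s, p))

/-- The space component of `dφ = ω - G^* ω`, obtained by integrating the derivative of `g_s^* ω`. -/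
theorem mfderiv_potential_space (hg : IsSmoothPath g) (h0 : g 0 = 1) (t : ℝ) (x : M)
    (u : TangentSpace (𝓡 m) x) :
    (mfderiv (𝓡 m) 𝓘(ℝ, ℝ) (fun y => L.potential g (t, y)) x u : ℝ) =
      L.lee x u - L.lee (g t x) (mfderiv (𝓡 m) (𝓡 m) (g t) x u) := by
  have h1 := mfderiv_intervalIntegral (L.contMDiff_leeSpeed hg) 0 t x u
  have h2 : ∀ s, (mfderiv (𝓡 m) 𝓘(ℝ, ℝ) (fun y => L.leeSpeed g (s, y)) x u : ℝ) =
      sliceDifferential (I := 𝓡 m) (L.leeSpeed g) (s, ⟨x, u⟩) := by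
    intro s
    have h3 := mfderiv_slice_eq_tangentMap
      ((L.contMDiff_leeSpeed hg).mdifferentiable (by simp)) s (⟨x, u⟩ : TangentBundle (𝓡 m) M)
    exact congrArg (fun w : TangentBundle 𝓘(ℝ, ℝ) ℝ => (w.2 : ℝ)) h3
  simp only [h2] at h1
  have h4 := intervalIntegral.integral_eq_sub_of_hasDerivAt
    (fun s _ => L.hasDerivAt_pullback_lee hg s x u)
    ((L.continuous_sliceDifferential_leeSpeed hg ⟨x, u⟩).intervalIntegrable 0 t)
  have h5 : ∀ f : M ≃ₘ⟮𝓡 m, 𝓡 m⟯ M, f = 1 →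
      L.lee (f x) (mfderiv (𝓡 m) (𝓡 m) f x u) = L.lee x u := by
    rintro _ rfl
    have : (((1 : M ≃ₘ⟮𝓡 m, 𝓡 m⟯ M) : M → M)) = id := rfl
    rw [this, mfderiv_id]
    rfl
  rw [h5 (g 0) h0] at h4
  have h6 : MDifferentiableAt (𝓡 m) 𝓘(ℝ, ℝ)
      (fun y => ∫ s in (0 : ℝ)..t, L.leeSpeed g (s, y)) x :=
    (contMDiff_intervalIntegral (L.contMDiff_leeSpeed hg) 0 t).mdifferentiableAt (by simp)
  have h7 : mfderiv (𝓡 m) 𝓘(ℝ, ℝ) (fun y => L.potential g (t, y)) x =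
      -mfderiv (𝓡 m) 𝓘(ℝ, ℝ) (fun y => ∫ s in (0 : ℝ)..t, L.leeSpeed g (s, y)) x :=
    h6.hasMFDerivAt.neg.mfderiv
  have h8 := congrArg (fun A : EuclideanSpace ℝ (Fin m) →L[ℝ] ℝ => A u) h7
  refine h8.trans ?_
  have h9 := h1.trans h4
  refine Eq.trans (congrArg (fun a : ℝ => -a) h9) ?_
  ring

/-- A smooth path starting at the identity and generated by `ker Φ` is conformal. -/
theorem isConformalPath_potential (hg : IsSmoothPath g) (h0 : g 0 = 1)
    (hv : ∀ t, velocity g t ∈ L.kerPhi) : L.IsConformalPath g (L.potential g) where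
  toIsSmoothPath := hg
  smooth_potential := L.contMDiff_potential hg
  mfderiv_potential := by
    rintro ⟨t, x⟩ w
    have h1 := mfderiv_prod_eq_add_apply (v := w)
      ((L.contMDiff_potential hg).mdifferentiableAt (x := (t, x)) (by simp))
    have h2 := mfderiv_prod_eq_add_apply (v := w)
      (hg.smooth.mdifferentiableAt (x := (t, x)) (by simp))
    have h3 : (mfderiv 𝓘(ℝ, ℝ) 𝓘(ℝ, ℝ) (fun s => L.potential g (s, x)) t w.1 : ℝ) =
        w.1 * -L.leeSpeed g (t, x) := by
      rw [(L.hasDerivAt_potential hg t x).hasFDerivAt.hasMFDerivAt.mfderiv]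
      rfl
    have h4 := L.mfderiv_potential_space hg h0 t x w.2
    have h5 := mfderiv_time_eq (hg.smooth.mdifferentiable (by simp)) t x
    have h6 := hg.velocity_apply t x
    have h7 : (mfderiv 𝓘(ℝ, ℝ) (𝓡 m) (fun s => g s x) t w.1 : EuclideanSpace ℝ (Fin m)) =
        (w.1 : ℝ) • (velocity g t (g t x) : EuclideanSpace ℝ (Fin m)) := by
      rw [h6, ← h5]
      have := map_smul (mfderiv 𝓘(ℝ, ℝ) (𝓡 m) (fun s => g s x) t :
        ℝ →L[ℝ] EuclideanSpace ℝ (Fin m)) w.1 (1 : ℝ)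
      rwa [smul_eq_mul, mul_one] at this
    have h8 : L.lee (g t x) (mfderiv (𝓘(ℝ, ℝ).prod (𝓡 m)) (𝓡 m)
        (fun p : ℝ × M => g p.1 p.2) (t, x) w) = w.1 * L.leeSpeed g (t, x) +
          L.lee (g t x) (mfderiv (𝓡 m) (𝓡 m) (g t) x w.2) := by
      refine (congrArg (L.lee (g t x)) h2).trans ?_
      refine (map_add (L.lee (g t x)) _ _).trans ?_
      refine congrArg₂ (fun a b : ℝ => a + b) ?_ rfl
      exact (congrArg (L.lee (g t x)) h7).trans (map_smul (L.lee (g t x)) _ _)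
    refine h1.trans ((congrArg₂ (fun a b : ℝ => a + b) h3 h4).trans ?_)
    change _ = L.lee x w.2 - L.lee (g t x) _
    rw [h8]
    ring
  pullback_form := by
    intro t x u v
    -- `e^{-φ_s} g_s^* Ω` is constant in `s`, by Cartan's formula and `L_{X_s} Ω = -ω(X_s) Ω`
    have h1 : ∀ s, HasDerivAt (fun s => L.form (g s x) (mfderiv (𝓡 m) (𝓡 m) (g s) x u)
        (mfderiv (𝓡 m) (𝓡 m) (g s) x v) * Real.exp (-L.potential g (s, x))) 0 s := by
      intro s
      have h2 := hg.hasDerivAt_pullback_two L.form L.alternating s x u v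
      rw [(L.mem_kerPhi_iff.1 (hv s)).2] at h2
      refine (h2.mul (L.hasDerivAt_potential hg s x).neg.exp).congr_deriv ?_
      simp only [leeSpeed]
      ring
    have h3 := is_const_of_deriv_eq_zero (fun s => (h1 s).differentiableAt)
      (fun s => (h1 s).deriv) t 0
    have h5 : ∀ f : M ≃ₘ⟮𝓡 m, 𝓡 m⟯ M, f = 1 →
        L.form (f x) (mfderiv (𝓡 m) (𝓡 m) f x u) (mfderiv (𝓡 m) (𝓡 m) f x v) =
          L.form x u v := by
      rintro _ rfl
      have : (((1 : M ≃ₘ⟮𝓡 m, 𝓡 m⟯ M) : M → M)) = id := rfl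
      rw [this, mfderiv_id]
      rfl
    rw [h5 (g 0) h0, L.potential_zero, neg_zero, Real.exp_zero, mul_one] at h3
    rw [← h3, mul_comm, mul_assoc, ← Real.exp_add]
    simp

end LCSStructure

/-! ### The group of isotopies -/

section PathOperations

variable {m : ℕ} {M : Type*} [TopologicalSpace M] [ChartedSpace (EuclideanSpace ℝ (Fin m)) M]
  {g h : ℝ → (M ≃ₘ⟮𝓡 m, 𝓡 m⟯ M)}

namespace IsSmoothPath

theorem mul (hg : IsSmoothPath g) (hh : IsSmoothPath h) : IsSmoothPath (fun t => g t * h t) where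
  smooth := hg.smooth.comp (contMDiff_fst.prodMk hh.smooth)
  smooth_symm := hh.smooth_symm.comp (contMDiff_fst.prodMk hg.smooth_symm)

theorem inv (hg : IsSmoothPath g) : IsSmoothPath (fun t => (g t)⁻¹) where
  smooth := hg.smooth_symm
  smooth_symm := hg.smooth

theorem reparam (hg : IsSmoothPath g) {ρ : ℝ → ℝ} (hρ : ContDiff ℝ ∞ ρ) :
    IsSmoothPath (fun t => g (ρ t)) where
  smooth := hg.smooth.comp ((hρ.contMDiff.comp contMDiff_fst).prodMk contMDiff_snd)
  smooth_symm := hg.smooth_symm.comp ((hρ.contMDiff.comp contMDiff_fst).prodMk contMDiff_snd)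

end IsSmoothPath

end PathOperations

namespace LCSStructure

variable {m : ℕ} {M : Type*} [TopologicalSpace M] [ChartedSpace (EuclideanSpace ℝ (Fin m)) M]
  [IsManifold (𝓡 m) ∞ M] {L : LCSStructure m M} {g h : ℝ → (M ≃ₘ⟮𝓡 m, 𝓡 m⟯ M)}
  {φ ψ : ℝ × M → ℝ}

/-- Potentials multiply by the cocycle rule `φ_{gh} = φ_g ∘ h + φ_h`. -/
theorem IsConformalPath.mul (hg : L.IsConformalPath g φ) (hh : L.IsConformalPath h ψ) :
    L.IsConformalPath (fun t => g t * h t) (fun q => φ (q.1, h q.1 q.2) + ψ q) where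
  toIsSmoothPath := hg.toIsSmoothPath.mul hh.toIsSmoothPath
  smooth_potential :=
    (hg.smooth_potential.comp (contMDiff_fst.prodMk hh.smooth)).add hh.smooth_potential
  mfderiv_potential := by
    intro q w
    have hHd := hh.smooth.mdifferentiableAt (x := q) (by simp)
    have hJ : HasMFDerivAt (𝓘(ℝ, ℝ).prod (𝓡 m)) (𝓘(ℝ, ℝ).prod (𝓡 m))
        (fun p : ℝ × M => (p.1, h p.1 p.2)) q _ := (hasMFDerivAt_fst q).prodMk hHd.hasMFDerivAt
    have h1 := ((hg.smooth_potential.mdifferentiableAt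
      (x := (q.1, h q.1 q.2)) (by simp)).hasMFDerivAt.comp q hJ).add
      (hh.smooth_potential.mdifferentiableAt (x := q) (by simp)).hasMFDerivAt
    have h2 := (hg.smooth.mdifferentiableAt
      (x := (q.1, h q.1 q.2)) (by simp)).hasMFDerivAt.comp q hJ
    have e1 := congrArg (fun A : ℝ × EuclideanSpace ℝ (Fin m) →L[ℝ] ℝ => A w) h1.mfderiv
    have e2 := congrArg (fun A : ℝ × EuclideanSpace ℝ (Fin m) →L[ℝ] EuclideanSpace ℝ (Fin m) =>
      A w) h2.mfderiv
    have e3 := hg.mfderiv_potential (q.1, h q.1 q.2)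
      ((w.1 : ℝ), mfderiv (𝓘(ℝ, ℝ).prod (𝓡 m)) (𝓡 m) (fun p : ℝ × M => h p.1 p.2) q w)
    have e4 := hh.mfderiv_potential q w
    refine e1.trans ((congrArg₂ (fun a b : ℝ => a + b) e3 e4).trans ?_)
    have e5 := congrArg (L.lee (g q.1 (h q.1 q.2))) e2
    refine Eq.trans ?_ (congrArg (fun a : ℝ => L.lee q.2 w.2 - a) e5.symm)
    exact sub_add_sub_cancel' _ _ _
  pullback_form := by
    intro t x u v
    have h1 := mfderiv_comp (I := 𝓡 m) (I' := 𝓡 m) (I'' := 𝓡 m) x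
      ((g t).contMDiff.mdifferentiableAt (x := h t x) (by simp))
      ((h t).contMDiff.mdifferentiableAt (by simp))
    have h2 : ∀ u, (mfderiv (𝓡 m) (𝓡 m) (⇑(g t * h t)) x u : EuclideanSpace ℝ (Fin m)) =
        mfderiv (𝓡 m) (𝓡 m) (g t) (h t x) (mfderiv (𝓡 m) (𝓡 m) (h t) x u) := fun u =>
      congrArg (fun A : EuclideanSpace ℝ (Fin m) →L[ℝ] EuclideanSpace ℝ (Fin m) => A u) h1
    refine (congrArg₂ (fun a b => L.form (g t (h t x)) a b) (h2 u) (h2 v)).trans ?_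
    refine (hg.pullback_form t (h t x) _ _).trans ?_
    rw [hh.pullback_form, Real.exp_add, mul_assoc]

/-- The potential of the inverse path is `-φ ∘ g⁻¹`. -/
theorem IsConformalPath.inv (hg : L.IsConformalPath g φ) :
    L.IsConformalPath (fun t => (g t)⁻¹) (fun q => -φ (q.1, (g q.1).symm q.2)) where
  toIsSmoothPath := hg.toIsSmoothPath.inv
  smooth_potential := (contDiff_neg (𝕜 := ℝ) (F := ℝ)).contMDiff.comp
    (hg.smooth_potential.comp (contMDiff_fst.prodMk hg.smooth_symm))
  mfderiv_potential := by
    intro q w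
    have hHd := hg.smooth_symm.mdifferentiableAt (x := q) (by simp)
    have hJ : HasMFDerivAt (𝓘(ℝ, ℝ).prod (𝓡 m)) (𝓘(ℝ, ℝ).prod (𝓡 m))
        (fun p : ℝ × M => (p.1, (g p.1).symm p.2)) q _ :=
      (hasMFDerivAt_fst q).prodMk hHd.hasMFDerivAt
    have h1 := ((hg.smooth_potential.mdifferentiableAt
      (x := (q.1, (g q.1).symm q.2)) (by simp)).hasMFDerivAt.comp q hJ).neg
    have h2 := (hg.smooth.mdifferentiableAt
      (x := (q.1, (g q.1).symm q.2)) (by simp)).hasMFDerivAt.comp q hJ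
    have h3 : ((fun p : ℝ × M => g p.1 p.2) ∘ fun p : ℝ × M => (p.1, (g p.1).symm p.2)) =
        Prod.snd := funext fun p => (g p.1).apply_symm_apply p.2
    rw [h3] at h2
    have e1 := congrArg (fun A : ℝ × EuclideanSpace ℝ (Fin m) →L[ℝ] ℝ => A w) h1.mfderiv
    have e2 := congrArg (fun A : ℝ × EuclideanSpace ℝ (Fin m) →L[ℝ] EuclideanSpace ℝ (Fin m) =>
      A w) (hasMFDerivAt_unique h2 (hasMFDerivAt_snd q))
    have e3 := hg.mfderiv_potential (q.1, (g q.1).symm q.2)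
      ((w.1 : ℝ), mfderiv (𝓘(ℝ, ℝ).prod (𝓡 m)) (𝓡 m) (fun p : ℝ × M => (g p.1).symm p.2) q w)
    refine e1.trans ((congrArg (fun a : ℝ => -a) e3).trans ?_)
    have e5 := (L.lee.congr_point ((g q.1).apply_symm_apply q.2) _).trans
      (congrArg (L.lee q.2) e2)
    refine (neg_sub _ _).trans ?_
    exact congrArg₂ (fun a b : ℝ => a - b) e5 rfl
  pullback_form := by
    intro t x u v
    have h1 := mfderiv_comp (I := 𝓡 m) (I' := 𝓡 m) (I'' := 𝓡 m) x
      ((g t).contMDiff.mdifferentiableAt (x := (g t).symm x) (by simp))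
      ((g t).symm.contMDiff.mdifferentiableAt (by simp))
    have e : (g t ∘ (g t).symm : M → M) = id := funext fun p => (g t).apply_symm_apply p
    rw [e, mfderiv_id] at h1
    have h2 : ∀ u : EuclideanSpace ℝ (Fin m), mfderiv (𝓡 m) (𝓡 m) (g t) ((g t).symm x)
        (mfderiv (𝓡 m) (𝓡 m) (g t).symm x u) = u := fun u =>
      (congrArg (fun A : EuclideanSpace ℝ (Fin m) →L[ℝ] EuclideanSpace ℝ (Fin m) => A u) h1).symm
    have h3 := hg.pullback_form t ((g t).symm x) (mfderiv (𝓡 m) (𝓡 m) (g t).symm x u)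
      (mfderiv (𝓡 m) (𝓡 m) (g t).symm x v)
    have h4 : L.form (g t ((g t).symm x))
        (mfderiv (𝓡 m) (𝓡 m) (g t) ((g t).symm x) (mfderiv (𝓡 m) (𝓡 m) (g t).symm x u))
        (mfderiv (𝓡 m) (𝓡 m) (g t) ((g t).symm x) (mfderiv (𝓡 m) (𝓡 m) (g t).symm x v)) =
        L.form x u v :=
      (congrArg₂ (fun a b => L.form (g t ((g t).symm x)) a b) (h2 u) (h2 v)).trans
        (L.form.congr_point ((g t).apply_symm_apply x) u v)
    rw [h4] at h3
    change L.form ((g t).symm x) (mfderiv (𝓡 m) (𝓡 m) (g t).symm x u)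
      (mfderiv (𝓡 m) (𝓡 m) (g t).symm x v) = _
    rw [h3, ← mul_assoc, ← Real.exp_add, neg_add_cancel, Real.exp_zero, one_mul]

theorem IsConformalPath.reparam (hg : L.IsConformalPath g φ) {ρ : ℝ → ℝ}
    (hρ : ContDiff ℝ ∞ ρ) :
    L.IsConformalPath (fun t => g (ρ t)) (fun q => φ (ρ q.1, q.2)) where
  toIsSmoothPath := hg.toIsSmoothPath.reparam hρ
  smooth_potential := hg.smooth_potential.comp
    ((hρ.contMDiff.comp contMDiff_fst).prodMk contMDiff_snd)
  mfderiv_potential := by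
    intro q w
    have hρq : HasMFDerivAt 𝓘(ℝ, ℝ) 𝓘(ℝ, ℝ) ρ q.1 (mfderiv 𝓘(ℝ, ℝ) 𝓘(ℝ, ℝ) ρ q.1) :=
      (hρ.contMDiff.mdifferentiableAt (by simp)).hasMFDerivAt
    have hJ : HasMFDerivAt (𝓘(ℝ, ℝ).prod (𝓡 m)) (𝓘(ℝ, ℝ).prod (𝓡 m))
        (fun p : ℝ × M => (ρ p.1, p.2)) q _ :=
      (hρq.comp q (hasMFDerivAt_fst q)).prodMk (hasMFDerivAt_snd q)
    have h1 := (hg.smooth_potential.mdifferentiableAt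
      (x := (ρ q.1, q.2)) (by simp)).hasMFDerivAt.comp q hJ
    have h2 := (hg.smooth.mdifferentiableAt
      (x := (ρ q.1, q.2)) (by simp)).hasMFDerivAt.comp q hJ
    have e1 := congrArg (fun A : ℝ × EuclideanSpace ℝ (Fin m) →L[ℝ] ℝ => A w) h1.mfderiv
    have e2 := congrArg (fun A : ℝ × EuclideanSpace ℝ (Fin m) →L[ℝ] EuclideanSpace ℝ (Fin m) =>
      A w) h2.mfderiv
    have e3 := hg.mfderiv_potential (ρ q.1, q.2)
      ((mfderiv 𝓘(ℝ, ℝ) 𝓘(ℝ, ℝ) ρ q.1 w.1 : ℝ), w.2)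
    refine e1.trans (e3.trans ?_)
    exact congrArg (fun a : ℝ => L.lee q.2 w.2 - a)
      (congrArg (L.lee (g (ρ q.1) q.2)) e2).symm
  pullback_form := fun t x u v => hg.pullback_form (ρ t) x u v

theorem isConformalPath_one : L.IsConformalPath (fun _ => 1) (fun _ => 0) where
  smooth := contMDiff_snd
  smooth_symm := contMDiff_snd
  smooth_potential := contMDiff_const
  mfderiv_potential := by
    intro q w
    have h1 : mfderiv (𝓘(ℝ, ℝ).prod (𝓡 m)) 𝓘(ℝ, ℝ) (fun _ : ℝ × M => (0 : ℝ)) q = 0 :=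
      mfderiv_const
    have h2 : mfderiv (𝓘(ℝ, ℝ).prod (𝓡 m)) (𝓡 m)
        (fun p : ℝ × M => (1 : M ≃ₘ⟮𝓡 m, 𝓡 m⟯ M) p.2) q = _ := mfderiv_snd
    rw [h1, h2]
    exact (sub_self (L.lee q.2 w.2)).symm
  pullback_form := by
    intro t x u v
    have h1 : mfderiv (𝓡 m) (𝓡 m) (1 : M ≃ₘ⟮𝓡 m, 𝓡 m⟯ M) x = _ := mfderiv_id
    rw [h1, Real.exp_zero, one_mul]
    rfl

namespace KerPhiIsotopy

variable (γ δ : L.KerPhiIsotopy)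

@[ext]
theorem ext {γ δ : L.KerPhiIsotopy} (h : ∀ t, γ.toFun t = δ.toFun t) : γ = δ := by
  obtain ⟨a, _, _, _, _⟩ := γ
  obtain ⟨b, _, _, _, _⟩ := δ
  obtain rfl : a = b := funext h
  rfl

theorem isSmoothPath : IsSmoothPath γ.toFun := ⟨γ.smooth, γ.smooth_symm⟩

theorem isConformalPath : L.IsConformalPath γ.toFun (L.potential γ.toFun) :=
  L.isConformalPath_potential γ.isSmoothPath γ.start γ.velocity_mem

/-- A conformal path starting at the identity, as an isotopy generated by `ker Φ`. -/
def ofConformal (hg : L.IsConformalPath g φ) (h0 : g 0 = 1) : L.KerPhiIsotopy :=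
  ⟨g, hg.smooth, hg.smooth_symm, h0, hg.velocity_mem⟩

/-- Isotopies form a group under pointwise composition. -/
noncomputable instance : Group L.KerPhiIsotopy where
  mul γ δ := ofConformal (γ.isConformalPath.mul δ.isConformalPath)
    (by rw [γ.start, δ.start, one_mul])
  one := ofConformal (φ := fun _ => 0) (g := fun _ => 1) isConformalPath_one rfl
  inv γ := ofConformal γ.isConformalPath.inv (by rw [γ.start, inv_one])
  mul_assoc _ _ _ := ext fun _ => mul_assoc _ _ _
  one_mul _ := ext fun _ => one_mul _
  mul_one _ := ext fun _ => mul_one _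
  inv_mul_cancel _ := ext fun _ => inv_mul_cancel _

theorem mul_toFun (t : ℝ) : (γ * δ).toFun t = γ.toFun t * δ.toFun t := rfl

/-- The isotopy `t ↦ g_{ρ(t)} g_{ρ(0)}⁻¹`. -/
noncomputable def reparam {ρ : ℝ → ℝ} (hρ : ContDiff ℝ ∞ ρ) : L.KerPhiIsotopy :=
  ofConformal (g := fun t => γ.toFun (ρ t) * (γ.toFun (ρ 0))⁻¹)
    ((γ.isConformalPath.reparam hρ).mul
      (γ.isConformalPath.reparam (ρ := fun _ => ρ 0) contDiff_const).inv)
    (mul_inv_cancel _)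

theorem isSmoothFamily_apply :
    IsSmoothFamily (𝓘(ℝ, ℝ).prod (𝓡 m)) (𝓡 m)
      (fun (γ : L.KerPhiIsotopy) (p : ℝ × M) => γ.toFun p.1 p.2) :=
  ⟨fun γ => γ.smooth, continuous_le_dom inf_le_left continuous_induced_dom⟩

theorem isSmoothFamily_symm_apply :
    IsSmoothFamily (𝓘(ℝ, ℝ).prod (𝓡 m)) (𝓡 m)
      (fun (γ : L.KerPhiIsotopy) (p : ℝ × M) => (γ.toFun p.1).symm p.2) :=
  ⟨fun γ => γ.smooth_symm, continuous_le_dom inf_le_right continuous_induced_dom⟩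

theorem continuous_of_isSmoothFamily {Z : Type*} [TopologicalSpace Z] {f : Z → L.KerPhiIsotopy}
    (h1 : IsSmoothFamily (𝓘(ℝ, ℝ).prod (𝓡 m)) (𝓡 m)
      (fun z (p : ℝ × M) => (f z).toFun p.1 p.2))
    (h2 : IsSmoothFamily (𝓘(ℝ, ℝ).prod (𝓡 m)) (𝓡 m)
      (fun z (p : ℝ × M) => ((f z).toFun p.1).symm p.2)) : Continuous f :=
  continuous_inf_rng.2 ⟨continuous_induced_rng.2 h1.continuous,
    continuous_induced_rng.2 h2.continuous⟩

instance : IsTopologicalGroup L.KerPhiIsotopy where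
  continuous_mul := by
    have hfst : IsSmoothFamily (𝓘(ℝ, ℝ).prod (𝓡 m)) 𝓘(ℝ, ℝ)
        (fun (_ : L.KerPhiIsotopy × L.KerPhiIsotopy) (p : ℝ × M) => p.1) :=
      IsSmoothFamily.const contMDiff_fst
    refine continuous_of_isSmoothFamily ?_ ?_
    · exact (isSmoothFamily_apply.precomp continuous_fst).comp
        (hfst.prodMk (isSmoothFamily_apply.precomp continuous_snd))
    · exact (isSmoothFamily_symm_apply.precomp continuous_snd).comp
        (hfst.prodMk (isSmoothFamily_symm_apply.precomp continuous_fst))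
  continuous_inv :=
    continuous_of_isSmoothFamily isSmoothFamily_symm_apply isSmoothFamily_apply

end KerPhiIsotopy

end LCSStructure

/-! ### The integrated contraction is a closed 1-form -/

section BilinearIntegral

variable {V W G : Type*} [NormedAddCommGroup V] [NormedSpace ℝ V] [NormedAddCommGroup W]
  [NormedSpace ℝ W] [NormedAddCommGroup G] [NormedSpace ℝ G]
  {φ : ℝ → V →L[ℝ] W →L[ℝ] G}

theorem continuous_clm_apply_apply (hφ : Continuous φ) (u : V) (v : W) :
    Continuous fun t => φ t u v :=
  (hφ.clm_apply continuous_const).clm_apply continuous_const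

set_option synthInstance.maxHeartbeats 100000 in
theorem intervalIntegral_clm_apply_apply (hφ : Continuous φ) (a b : ℝ) (u : V) (v : W) :
    (∫ t in a..b, φ t) u v = ∫ t in a..b, φ t u v := by
  rw [ContinuousLinearMap.intervalIntegral_apply (hφ.intervalIntegrable a b),
    ContinuousLinearMap.intervalIntegral_apply
      ((hφ.clm_apply continuous_const).intervalIntegrable a b)]

end BilinearIntegral

section IntegratedForms

variable {m : ℕ} {M : Type*} [TopologicalSpace M] [ChartedSpace (EuclideanSpace ℝ (Fin m)) M]
  [IsManifold (𝓡 m) ∞ M]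

/-- A field of covectors with smooth coefficients in all charts is a smooth 1-form. -/
theorem contMDiff_oneForm_of_contDiffOn_coeffOne
    {α : ∀ x : M, TangentSpace (𝓡 m) x →L[ℝ] ℝ}
    (hα : ∀ x, ContDiffOn ℝ ∞ (coeffOne α x) (extChartAt (𝓡 m) x).target) :
    ContMDiff (𝓡 m) ((𝓡 m).prod 𝓘(ℝ, EuclideanSpace ℝ (Fin m) →L[ℝ] ℝ)) ∞
      (fun x => TotalSpace.mk' (EuclideanSpace ℝ (Fin m) →L[ℝ] ℝ)
        (E := fun x : M => TangentSpace (𝓡 m) x →L[ℝ] ℝ) x (α x)) := by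
  intro x
  refine (contMDiffAt_hom_bundle (E₁ := (TangentSpace (𝓡 m) : M → Type _))
    (E₂ := Bundle.Trivial M ℝ) _).2 ⟨contMDiffAt_id, ?_⟩
  have h1 : ContMDiffAt (𝓡 m) 𝓘(ℝ, EuclideanSpace ℝ (Fin m) →L[ℝ] ℝ) ∞
      (fun p => coeffOne α x (extChartAt (𝓡 m) x p)) x :=
    (((hα x).contDiffAt (extChartAt_target_mem_nhds x)).contMDiffAt).comp x
      contMDiffAt_extChartAt
  refine h1.congr_of_eventuallyEq ?_
  filter_upwards [extChartAt_source_mem_nhds (I := 𝓡 m) x] with p hp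
  ext w
  have h2 := TangentBundle.symmL_trivializationAt (𝕜 := ℝ) (I := 𝓡 m) (x₀ := x) (x := p)
    (by simpa using hp)
  have h3 : ∀ q, q = p → ∀ b : EuclideanSpace ℝ (Fin m), α p b = α q b := by
    rintro _ rfl b; rfl
  refine Eq.trans ?_ (h3 _ ((extChartAt (𝓡 m) x).left_inv hp)
    (chartFrame x (extChartAt (𝓡 m) x p) w))
  rw [ContinuousLinearMap.inCoordinates_eq (by simpa using hp) (by simp)]
  have h4 := congrArg (fun A : EuclideanSpace ℝ (Fin m) →L[ℝ] EuclideanSpace ℝ (Fin m) =>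
    α p (A w)) h2
  refine Eq.trans ?_ h4
  simp
  exact congrArg (α p) (Trivialization.symmL_apply (R := ℝ)
    (trivializationAt (EuclideanSpace ℝ (Fin m)) (TangentSpace (𝓡 m) : M → Type _) x)
    (by simpa using hp) w).symm

/-- The coefficients of a family of covector fields depend smoothly on time and space. -/
def IsSmoothCovectorPath (β : ℝ → ∀ x : M, TangentSpace (𝓡 m) x →L[ℝ] ℝ) : Prop :=
  ∀ x : M, ContDiffOn ℝ ∞ (fun q : ℝ × EuclideanSpace ℝ (Fin m) => coeffOne (β q.1) x q.2)
    (Set.univ ×ˢ (extChartAt (𝓡 m) x).target)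

/-- The time integral of a family of covector fields, taken at each point in the space of covectors
of the model space, with which the cotangent space is identified. -/
noncomputable def integralCovector (β : ℝ → ∀ x : M, TangentSpace (𝓡 m) x →L[ℝ] ℝ)
    (a b : ℝ) (x : M) : TangentSpace (𝓡 m) x →L[ℝ] ℝ :=
  (∫ t in a..b, (β t x : EuclideanSpace ℝ (Fin m) →L[ℝ] ℝ) :
    EuclideanSpace ℝ (Fin m) →L[ℝ] ℝ)

namespace IsSmoothCovectorPath

variable {β : ℝ → ∀ x : M, TangentSpace (𝓡 m) x →L[ℝ] ℝ}

theorem continuous_apply (hβ : IsSmoothCovectorPath β) (x : M) :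
    Continuous fun t => (β t x : EuclideanSpace ℝ (Fin m) →L[ℝ] ℝ) := by
  have h : ∀ t, (β t x : EuclideanSpace ℝ (Fin m) →L[ℝ] ℝ) =
      coeffOne (β t) x (extChartAt (𝓡 m) x x) := by
    intro t
    ext w
    have h := coeffOne_apply_mfderiv (β t) (mem_extChartAt_source (I := 𝓡 m) x) w
    rw [mfderiv_extChartAt_self] at h
    exact h.symm
  simp only [h]
  exact (hβ x).continuousOn.comp_continuous (f := fun t => (t, extChartAt (𝓡 m) x x))
    (by fun_prop) fun t => ⟨trivial, mem_extChartAt_target x⟩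

theorem continuous_apply_apply (hβ : IsSmoothCovectorPath β) (x : M)
    (v : EuclideanSpace ℝ (Fin m)) : Continuous fun t => β t x v :=
  let A : ℝ → EuclideanSpace ℝ (Fin m) →L[ℝ] ℝ := fun t => β t x
  have hA : Continuous A := hβ.continuous_apply x
  hA.clm_apply continuous_const

theorem integralCovector_apply (hβ : IsSmoothCovectorPath β) (a b : ℝ) (x : M)
    (v : TangentSpace (𝓡 m) x) : integralCovector β a b x v = ∫ t in a..b, β t x v :=
  let A : ℝ → EuclideanSpace ℝ (Fin m) →L[ℝ] ℝ := fun t => β t x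
  have hA : Continuous A := hβ.continuous_apply x
  ContinuousLinearMap.intervalIntegral_apply (hA.intervalIntegrable a b)
    (v : EuclideanSpace ℝ (Fin m))

theorem coeffOne_integralCovector (hβ : IsSmoothCovectorPath β) (a b : ℝ) (x : M)
    {y : EuclideanSpace ℝ (Fin m)} (hy : y ∈ (extChartAt (𝓡 m) x).target) :
    coeffOne (integralCovector β a b) x y = ∫ t in a..b, coeffOne (β t) x y := by
  ext w
  have hc : Continuous fun t => coeffOne (β t) x y :=
    (hβ x).continuousOn.comp_continuous (f := fun t => (t, y)) (by fun_prop)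
      fun t => ⟨trivial, hy⟩
  refine (hβ.integralCovector_apply a b _ (chartFrame x y w)).trans ?_
  exact (ContinuousLinearMap.intervalIntegral_apply (hc.intervalIntegrable a b) w).symm

theorem contDiffOn_coeffOne_integralCovector (hβ : IsSmoothCovectorPath β) (a b : ℝ) (x : M) :
    ContDiffOn ℝ ∞ (coeffOne (integralCovector β a b) x) (extChartAt (𝓡 m) x).target :=
  (contDiffOn_intervalIntegral (isOpen_extChartAt_target x) (hβ x) a b).congr
    fun _ hy => hβ.coeffOne_integralCovector a b x hy

/-- Exterior differentiation commutes with integration over time. -/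
theorem dOne_integralCovector (hβ : IsSmoothCovectorPath β) (a b : ℝ) (x : M)
    (u v : TangentSpace (𝓡 m) x) :
    Continuous (fun t => dOne (β t) x u v) ∧
    dOne (integralCovector β a b) x u v = ∫ t in a..b, dOne (β t) x u v := by
  have hV := isOpen_extChartAt_target (I := 𝓡 m) x
  have hxV := mem_extChartAt_target (I := 𝓡 m) x
  have hopen : IsOpen ((Set.univ : Set ℝ) ×ˢ (extChartAt (𝓡 m) x).target) := isOpen_univ.prod hV
  set C := fun q : ℝ × EuclideanSpace ℝ (Fin m) => coeffOne (β q.1) x q.2 with hC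
  have hd := hasFDerivAt_intervalIntegral_of_contDiffOn hV ((hβ x).of_le (by simp)) a b hxV
  have hslice : ∀ t, HasFDerivAt (coeffOne (β t) x)
      ((fderiv ℝ C (t, extChartAt (𝓡 m) x x)).comp (ContinuousLinearMap.inr ℝ ℝ _))
      (extChartAt (𝓡 m) x x) := fun t =>
    (((hβ x).contDiffAt (hopen.mem_nhds ⟨trivial, hxV⟩)).differentiableAt
      (by simp)).hasFDerivAt.comp _ (hasFDerivAt_prodMk_right t _)
  have hcont : Continuous fun t => (fderiv ℝ C (t, extChartAt (𝓡 m) x x)).comp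
      (ContinuousLinearMap.inr ℝ ℝ _) :=
    (((hβ x).continuousOn_fderiv_of_isOpen hopen (by simp)).clm_comp
      continuousOn_const).comp_continuous (by fun_prop) fun t => ⟨trivial, hxV⟩
  have hd' : HasFDerivAt (coeffOne (integralCovector β a b) x) _ (extChartAt (𝓡 m) x x) :=
    hd.congr_of_eventuallyEq (by
      filter_upwards [hV.mem_nhds hxV] with y hy
      exact hβ.coeffOne_integralCovector a b x hy)
  have happ := fun p q => intervalIntegral_clm_apply_apply hcont a b p q
  have hcont' := fun p q => continuous_clm_apply_apply hcont p q
  have ht : ∀ t, dOne (β t) x u v =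
      (fderiv ℝ C (t, extChartAt (𝓡 m) x x)).comp
        (ContinuousLinearMap.inr ℝ ℝ (EuclideanSpace ℝ (Fin m))) u v -
      (fderiv ℝ C (t, extChartAt (𝓡 m) x x)).comp
        (ContinuousLinearMap.inr ℝ ℝ (EuclideanSpace ℝ (Fin m))) v u := by
    intro t
    rw [dOne_eq_of_differentiableAt _ _ (hslice t).differentiableAt, (hslice t).fderiv]
  simp only [ht]
  refine ⟨(hcont' u v).sub (hcont' v u), ?_⟩
  rw [dOne_eq_of_differentiableAt _ _ hd'.differentiableAt, hd'.fderiv,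
    intervalIntegral.integral_sub ((hcont' u v).intervalIntegrable a b)
      ((hcont' v u).intervalIntegrable a b)]
  exact congrArg₂ (fun a b : ℝ => a - b) (happ u v) (happ v u)

end IsSmoothCovectorPath

end IntegratedForms

namespace LCSStructure

variable {m : ℕ} {M : Type*} [TopologicalSpace M] [ChartedSpace (EuclideanSpace ℝ (Fin m)) M]
  [IsManifold (𝓡 m) ∞ M] {L : LCSStructure m M}

variable (L) in
/-- The contraction `i_{X_t} Ω` along a smooth path is smooth in time and space. -/
theorem isSmoothCovectorPath_contraction {g : ℝ → (M ≃ₘ⟮𝓡 m, 𝓡 m⟯ M)} (hg : IsSmoothPath g) :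
    IsSmoothCovectorPath fun t x => L.form x (velocity g t x) := by
  intro x
  refine contDiffOn_clm_apply.2 fun w => ContMDiffOn.contDiffOn ?_
  have hsymm : ContMDiffOn 𝓘(ℝ, ℝ × EuclideanSpace ℝ (Fin m)) (𝓘(ℝ, ℝ).prod (𝓡 m)) ∞
      (fun q : ℝ × EuclideanSpace ℝ (Fin m) => (q.1, (extChartAt (𝓡 m) x).symm q.2))
      (Set.univ ×ˢ (extChartAt (𝓡 m) x).target) :=
    ContMDiffOn.prodMk contDiff_fst.contMDiff.contMDiffOn
      ((contMDiffOn_extChartAt_symm x).comp contDiff_snd.contMDiff.contMDiffOn fun q hq => hq.2)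
  exact L.form.contMDiffOn_apply (hg.contMDiff_velocity.comp_contMDiffOn hsymm)
    ((contMDiffOn_chartFrame x w).comp contDiff_snd.contMDiff.contMDiffOn fun q hq => hq.2)

namespace KerPhiIsotopy

variable (γ : L.KerPhiIsotopy)

/-- The closed form `∫₀¹ i_{X_t} Ω dt` whose class is the flux. -/
noncomputable def fluxForm : L.cocycles :=
  ⟨⟨integralCovector (fun t x => L.form x (velocity γ.toFun t x)) 0 1,
      contMDiff_oneForm_of_contDiffOn_coeffOne fun x =>
        (L.isSmoothCovectorPath_contraction
          γ.isSmoothPath).contDiffOn_coeffOne_integralCovector 0 1 x⟩, by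
    intro x u v
    have hβ := L.isSmoothCovectorPath_contraction γ.isSmoothPath
    obtain ⟨hc, hd⟩ := hβ.dOne_integralCovector 0 1 x u v
    have happ := hβ.integralCovector_apply 0 1 x
    have hcw : ∀ w : EuclideanSpace ℝ (Fin m),
        Continuous fun t => L.form x (velocity γ.toFun t x) w := hβ.continuous_apply_apply x
    have h0 : ∀ t, dOne (fun x => L.form x (velocity γ.toFun t x)) x u v +
        (L.lee x u * L.form x (velocity γ.toFun t x) v -
          L.lee x v * L.form x (velocity γ.toFun t x) u) = 0 := fun t =>
      L.dTwistOne_contraction (γ.velocity_mem t) x u v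
    change dOne (integralCovector (fun t x => L.form x (velocity γ.toFun t x)) 0 1) x u v +
      (L.lee x u * integralCovector (fun t x => L.form x (velocity γ.toFun t x)) 0 1 x v -
        L.lee x v * integralCovector (fun t x => L.form x (velocity γ.toFun t x)) 0 1 x u) = 0
    rw [hd, happ, happ, ← intervalIntegral.integral_const_mul,
      ← intervalIntegral.integral_const_mul, ← intervalIntegral.integral_sub,
      ← intervalIntegral.integral_add]
    · simp only [h0, intervalIntegral.integral_zero]
    · exact hc.intervalIntegrable 0 1
    · exact (((hcw v).const_mul _).sub ((hcw u).const_mul _)).intervalIntegrable 0 1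
    · exact ((hcw v).const_mul _).intervalIntegrable 0 1
    · exact ((hcw u).const_mul _).intervalIntegrable 0 1⟩

theorem fluxForm_apply (x : M) (v : TangentSpace (𝓡 m) x) :
    γ.fluxForm.1 x v = ∫ t in (0 : ℝ)..1, L.form x (velocity γ.toFun t x) v :=
  (L.isSmoothCovectorPath_contraction γ.isSmoothPath).integralCovector_apply 0 1 x v

/-- A form is determined by its values, so any closed form with the values of the integrated
contraction represents the flux. -/
theorem pathFlux_eq_mkQ {α : L.cocycles} (h : ∀ (x : M) (v : TangentSpace (𝓡 m) x),
    α.1 x v = ∫ t in (0 : ℝ)..1, L.form x (velocity γ.toFun t x) v) :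
    L.pathFlux γ = L.coboundaries.mkQ α := by
  have hex : ∃ α : L.cocycles, ∀ (x : M) (v : TangentSpace (𝓡 m) x),
      α.1 x v = ∫ t in (0 : ℝ)..1, L.form x (velocity γ.toFun t x) v := ⟨α, h⟩
  rw [pathFlux, dif_pos hex]
  congr 1
  refine Subtype.ext (ContMDiffSection.ext fun x => ContinuousLinearMap.ext fun v => ?_)
  exact (hex.choose_spec x v).trans (h x v).symm

theorem pathFlux_eq : L.pathFlux γ = L.coboundaries.mkQ γ.fluxForm :=
  γ.pathFlux_eq_mkQ γ.fluxForm_apply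

end KerPhiIsotopy

end LCSStructure

/-! ### Continuity of the flux -/

section VerticalPairing

variable {m : ℕ} {M : Type*} [TopologicalSpace M] [ChartedSpace (EuclideanSpace ℝ (Fin m)) M]
  [IsManifold (𝓡 m) ∞ M]

/-- The function `w ↦ Ω(τ(w), Tπ(w))` on `T(TM)`, where `τ : T(TM) → TM` and `π : TM → M` are the
bundle projections. It pairs a vector field with the directions in which it is differentiated. -/
noncomputable def TwoTensor.doubleTangentPairing (Ω : TwoTensor m M)
    (w : TangentBundle (𝓡 m).tangent (TangentBundle (𝓡 m) M)) : ℝ :=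
  Ω w.1.1 w.1.2 (tangentMap (𝓡 m).tangent (𝓡 m) (fun p : TangentBundle (𝓡 m) M => p.1) w).2

theorem TwoTensor.contMDiff_doubleTangentPairing (Ω : TwoTensor m M) :
    ContMDiff (𝓡 m).tangent.tangent 𝓘(ℝ, ℝ) ∞ Ω.doubleTangentPairing := by
  have hπ : ContMDiff (𝓡 m).tangent (𝓡 m) ∞ (fun p : TangentBundle (𝓡 m) M => p.1) :=
    contMDiff_proj _
  have hτ : ContMDiff (𝓡 m).tangent.tangent (𝓡 m).tangent ∞
      (fun w : TangentBundle (𝓡 m).tangent (TangentBundle (𝓡 m) M) => w.1) :=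
    contMDiff_proj _
  exact Ω.contMDiff_apply hτ (hπ.contMDiff_tangentMap (m := ∞) le_rfl)

/-- Evaluating the pairing on the tangent map of a time-dependent vector field. -/
theorem TwoTensor.doubleTangentPairing_tangentMap (Ω : TwoTensor m M)
    {X : ℝ × M → TangentBundle (𝓡 m) M} (hX : ContMDiff (𝓘(ℝ, ℝ).prod (𝓡 m)) (𝓡 m).tangent ∞ X)
    (hproj : ∀ q, (X q).1 = q.2) (t : ℝ) (p : TangentBundle (𝓡 m) M) :
    Ω.doubleTangentPairing (tangentMap (𝓘(ℝ, ℝ).prod (𝓡 m)) (𝓡 m).tangent X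
      (zeroTimeLift (𝓡 m) M (t, p))) = Ω p.1 (X (t, p.1)).2 p.2 := by
  have hπ : ContMDiff (𝓡 m).tangent (𝓡 m) ∞ (fun p : TangentBundle (𝓡 m) M => p.1) :=
    contMDiff_proj _
  have h1 := tangentMap_comp_at (I := 𝓘(ℝ, ℝ).prod (𝓡 m)) (I' := (𝓡 m).tangent) (I'' := 𝓡 m)
    (g := fun p : TangentBundle (𝓡 m) M => p.1) (f := X) (zeroTimeLift (𝓡 m) M (t, p))
    (hπ.mdifferentiableAt (by simp)) (hX.mdifferentiableAt (by simp))
  -- `π ∘ X` is the projection to `M`, whose tangent map takes the lifted vector back to `p`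
  have h2 : (fun p : TangentBundle (𝓡 m) M => p.1) ∘ X = Prod.snd := funext hproj
  rw [h2] at h1
  have h3 : tangentMap (𝓘(ℝ, ℝ).prod (𝓡 m)) (𝓡 m) Prod.snd (zeroTimeLift (𝓡 m) M (t, p)) = p := by
    rw [tangentMap_prodSnd]
    rfl
  rw [h3] at h1
  have h4 : ((tangentMap (𝓡 m).tangent (𝓡 m) (fun p : TangentBundle (𝓡 m) M => p.1)
      (tangentMap (𝓘(ℝ, ℝ).prod (𝓡 m)) (𝓡 m).tangent X (zeroTimeLift (𝓡 m) M (t, p)))).2 :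
      EuclideanSpace ℝ (Fin m)) = p.2 :=
    congrArg (fun w : TangentBundle (𝓡 m) M => (w.2 : EuclideanSpace ℝ (Fin m))) h1.symm
  refine (congrArg (fun b => Ω (X (t, p.1)).1 (X (t, p.1)).2 b) h4).trans ?_
  exact Ω.congr_point (hproj (t, p.1)) _ _

end VerticalPairing

namespace LCSStructure

variable {m : ℕ} {M : Type*} [TopologicalSpace M] [ChartedSpace (EuclideanSpace ℝ (Fin m)) M]
  [IsManifold (𝓡 m) ∞ M] {L : LCSStructure m M}

namespace KerPhiIsotopy

/-- The velocity field depends continuously on the isotopy in the `C^∞` topology. -/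
theorem isSmoothFamily_velocity :
    IsSmoothFamily (𝓘(ℝ, ℝ).prod (𝓡 m)) (𝓡 m).tangent
      (fun (γ : L.KerPhiIsotopy) (q : ℝ × M) =>
        (⟨q.2, velocity γ.toFun q.1 q.2⟩ : TangentBundle (𝓡 m) M)) := by
  have hfst : IsSmoothFamily (𝓘(ℝ, ℝ).prod (𝓡 m)) 𝓘(ℝ, ℝ)
      (fun (_ : L.KerPhiIsotopy) (p : ℝ × M) => p.1) :=
    IsSmoothFamily.const contMDiff_fst
  have h := (isSmoothFamily_apply (L := L)).tangentMap.comp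
    ((IsSmoothFamily.const contMDiff_timeLift).comp (hfst.prodMk isSmoothFamily_symm_apply))
  convert h using 1
  funext γ q
  exact γ.isSmoothPath.velocity_eq_tangentMap q.1 q.2

/-- As a function on `TM`, the flux form is the time integral of the smooth family
`(t, v) ↦ Ω(X_t, v)`, which is expressed through tangent maps of the velocity by the pairing on
`T(TM)`. -/
theorem continuous_fluxForm : Continuous (fluxForm (L := L)) := by
  refine continuous_induced_rng.2 (continuous_induced_rng.2 ?_)
  have h1 := (IsSmoothFamily.const L.form.contMDiff_doubleTangentPairing).comp
    (isSmoothFamily_velocity (L := L).tangentMap.comp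
      (IsSmoothFamily.const (contMDiff_zeroTimeLift (I := 𝓡 m) (N := M))))
  have h2 := (h1.intervalIntegral 0 1).continuous
  convert h2 using 1
  funext γ p
  refine (γ.fluxForm_apply p.1 p.2).trans ?_
  refine intervalIntegral.integral_congr fun t _ => ?_
  exact (L.form.doubleTangentPairing_tangentMap (isSmoothFamily_velocity.smooth γ)
    (fun _ => rfl) t p).symm

theorem continuous_pathFlux : Continuous L.pathFlux := by
  have h : L.pathFlux = L.coboundaries.mkQ ∘ fluxForm := funext fun γ => γ.pathFlux_eq
  rw [h]
  exact continuous_quot_mk.comp continuous_fluxForm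

end KerPhiIsotopy

end LCSStructure

/-! ### Flux of reparametrized and concatenated isotopies -/

namespace LCSStructure

section Velocity

variable {m : ℕ} {M : Type*} [TopologicalSpace M] [ChartedSpace (EuclideanSpace ℝ (Fin m)) M]
  {g h : ℝ → (M ≃ₘ⟮𝓡 m, 𝓡 m⟯ M)} {t : ℝ}

theorem velocity_congr (e : ∀ᶠ s in 𝓝 t, g s = h s) (x : M) : velocity g t x = velocity h t x := by
  have e1 : (fun s => g s ((g t).symm x)) =ᶠ[𝓝 t] fun s => h s ((h t).symm x) := by
    filter_upwards [e] with s hs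
    rw [hs, e.self_of_nhds]
  have e2 := e1.mfderiv_eq (I := 𝓘(ℝ, ℝ)) (I' := 𝓡 m)
  exact congrArg (fun A : ℝ →L[ℝ] EuclideanSpace ℝ (Fin m) => A 1) e2

theorem velocity_of_eventually_const {c : M ≃ₘ⟮𝓡 m, 𝓡 m⟯ M} (e : ∀ᶠ s in 𝓝 t, g s = c) (x : M) :
    velocity g t x = 0 := by
  rw [velocity_congr e]
  have h : mfderiv 𝓘(ℝ, ℝ) (𝓡 m) (fun _ : ℝ => c (c.symm x)) t = 0 := mfderiv_const
  exact congrArg (fun A : ℝ →L[ℝ] EuclideanSpace ℝ (Fin m) => A 1) h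

theorem velocity_mul_const (c : M ≃ₘ⟮𝓡 m, 𝓡 m⟯ M) (x : M) :
    velocity (fun s => g s * c) t x = velocity g t x := by
  have e1 : (fun s => (g s * c) ((g t * c).symm x)) =ᶠ[𝓝 t] fun s => g s ((g t).symm x) :=
    Filter.Eventually.of_forall fun s => congrArg (g s) (c.apply_symm_apply _)
  have e2 := e1.mfderiv_eq (I := 𝓘(ℝ, ℝ)) (I' := 𝓡 m)
  exact congrArg (fun A : ℝ →L[ℝ] EuclideanSpace ℝ (Fin m) => A 1) e2

theorem velocity_reparam (hg : IsSmoothPath g) {ρ : ℝ → ℝ} (hρ : DifferentiableAt ℝ ρ t) (x : M) :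
    velocity (fun s => g (ρ s)) t x = deriv ρ t • velocity g (ρ t) x := by
  have h1 : MDifferentiableAt 𝓘(ℝ, ℝ) (𝓡 m) (fun s => g s ((g (ρ t)).symm x)) (ρ t) :=
    (hg.smooth.comp (contMDiff_id.prodMk contMDiff_const)).mdifferentiableAt (by simp)
  have h2 := (h1.hasMFDerivAt.comp t hρ.hasDerivAt.hasFDerivAt.hasMFDerivAt).mfderiv
  have h3 := congrArg (fun A : ℝ →L[ℝ] EuclideanSpace ℝ (Fin m) => A 1) h2
  refine h3.trans ?_
  let B : ℝ →L[ℝ] EuclideanSpace ℝ (Fin m) :=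
    mfderiv 𝓘(ℝ, ℝ) (𝓡 m) (fun s => g s ((g (ρ t)).symm x)) (ρ t)
  have h4 : B (1 * deriv ρ t) = deriv ρ t • B 1 := by
    rw [one_mul, ← map_smul, smul_eq_mul, mul_one]
  refine Eq.trans ?_ h4
  change B _ = B _
  congr 1

end Velocity

namespace KerPhiIsotopy

variable {m : ℕ} {M : Type*} [TopologicalSpace M] [ChartedSpace (EuclideanSpace ℝ (Fin m)) M]
  [IsManifold (𝓡 m) ∞ M] {L : LCSStructure m M} (γ δ : L.KerPhiIsotopy)

theorem velocity_reparam {ρ : ℝ → ℝ} (hρ : ContDiff ℝ ∞ ρ) (t : ℝ) (x : M) :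
    velocity (γ.reparam hρ).toFun t x = deriv ρ t • velocity γ.toFun (ρ t) x :=
  (velocity_mul_const _ x).trans
    (LCSStructure.velocity_reparam γ.isSmoothPath (hρ.differentiable (by simp) t) x)

theorem continuous_form_velocity (x : M) (v : TangentSpace (𝓡 m) x) :
    Continuous fun t => L.form x (velocity γ.toFun t x) v :=
  (L.isSmoothCovectorPath_contraction γ.isSmoothPath).continuous_apply_apply x v

/-- The velocity of `g_{ρ(t)}` is `ρ'(t) X_{ρ(t)}`, so this is the substitution rule. -/
theorem fluxForm_reparam_apply {ρ : ℝ → ℝ} (hρ : ContDiff ℝ ∞ ρ) (x : M)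
    (v : TangentSpace (𝓡 m) x) :
    (γ.reparam hρ).fluxForm.1 x v =
      ∫ t in ρ 0..ρ 1, L.form x (velocity γ.toFun t x) v := by
  rw [fluxForm_apply]
  have h := intervalIntegral.integral_comp_mul_deriv (a := 0) (b := 1)
    (g := fun t => L.form x (velocity γ.toFun t x) v)
    (fun t _ => (hρ.differentiable (by simp) t).hasDerivAt)
    (hρ.continuous_deriv (by simp)).continuousOn (γ.continuous_form_velocity x v)
  refine Eq.trans ?_ h
  refine intervalIntegral.integral_congr fun t _ => ?_
  have h1 : L.form x (velocity (γ.reparam hρ).toFun t x) v =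
      L.form x (deriv ρ t • velocity γ.toFun (ρ t) x) v :=
    congrArg (fun a => L.form x a v) (γ.velocity_reparam hρ t x)
  refine h1.trans ?_
  rw [map_smul]
  exact mul_comm _ _

/-- The flux is invariant under reparametrization. -/
theorem pathFlux_reparam {ρ : ℝ → ℝ} (hρ : ContDiff ℝ ∞ ρ) (h0 : ρ 0 = 0) (h1 : ρ 1 = 1) :
    L.pathFlux (γ.reparam hρ) = L.pathFlux γ := by
  rw [γ.pathFlux_eq]
  refine pathFlux_eq_mkQ _ fun x v => ?_
  rw [← fluxForm_apply (γ.reparam hρ), fluxForm_reparam_apply, h0, h1, fluxForm_apply]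

/-- The flux of the reversed isotopy. -/
theorem pathFlux_reverse {ρ : ℝ → ℝ} (hρ : ContDiff ℝ ∞ ρ) (h0 : ρ 0 = 1) (h1 : ρ 1 = 0) :
    L.pathFlux (γ.reparam hρ) = -L.pathFlux γ := by
  rw [γ.pathFlux_eq, ← map_neg]
  refine pathFlux_eq_mkQ _ fun x v => ?_
  rw [← fluxForm_apply (γ.reparam hρ), fluxForm_reparam_apply, h0, h1,
    intervalIntegral.integral_symm]
  exact congrArg (fun a : ℝ => -a) (γ.fluxForm_apply x v)

/-- If at almost every time one of two isotopies is locally constant, the outer one being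
moreover equal to the identity where it rests, then fluxes add up. -/
theorem pathFlux_mul_of_eventually_const (t₀ : ℝ)
    (h : ∀ t ≠ t₀, (∀ᶠ s in 𝓝 t, γ.toFun s = 1) ∨ ∀ᶠ s in 𝓝 t, δ.toFun s = δ.toFun t) :
    L.pathFlux (γ * δ) = L.pathFlux γ + L.pathFlux δ := by
  rw [γ.pathFlux_eq, δ.pathFlux_eq, ← map_add]
  refine pathFlux_eq_mkQ _ fun x v => ?_
  have hv : ∀ t ≠ t₀, L.form x (velocity (γ * δ).toFun t x) v =
      L.form x (velocity γ.toFun t x) v + L.form x (velocity δ.toFun t x) v := by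
    intro t ht
    have h0 : L.form x 0 v = 0 := by rw [map_zero]; rfl
    rcases h t ht with h | h
    · have e : ∀ᶠ s in 𝓝 t, (γ * δ).toFun s = δ.toFun s := by
        filter_upwards [h] with s hs
        rw [mul_toFun, hs, one_mul]
      rw [velocity_congr e, velocity_of_eventually_const h, h0, zero_add]
    · have e : ∀ᶠ s in 𝓝 t, (γ * δ).toFun s = γ.toFun s * δ.toFun t := by
        filter_upwards [h] with s hs
        rw [mul_toFun, hs]
      rw [velocity_congr e, velocity_mul_const, velocity_of_eventually_const h, h0, add_zero]
  have h1 : ∫ t in (0 : ℝ)..1, L.form x (velocity (γ * δ).toFun t x) v =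
      ∫ t in (0 : ℝ)..1, (L.form x (velocity γ.toFun t x) v +
        L.form x (velocity δ.toFun t x) v) := by
    refine intervalIntegral.integral_congr_ae ?_
    filter_upwards [MeasureTheory.Measure.ae_ne MeasureTheory.volume t₀] with t ht _ using hv t ht
  rw [h1, intervalIntegral.integral_add
    ((γ.continuous_form_velocity x v).intervalIntegrable _ _)
    ((δ.continuous_form_velocity x v).intervalIntegrable _ _)]
  exact congrArg₂ (fun a b : ℝ => a + b) (γ.fluxForm_apply x v) (δ.fluxForm_apply x v)

theorem exists_reverse :
    ∃ ε : L.KerPhiIsotopy, ε.toFun 1 = (γ.toFun 1)⁻¹ ∧ L.pathFlux ε = -L.pathFlux γ := by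
  have hρ : ContDiff ℝ ∞ (fun t : ℝ => 1 - t) := by fun_prop
  refine ⟨γ.reparam hρ, ?_, γ.pathFlux_reverse hρ (by norm_num) (by norm_num)⟩
  change γ.toFun (1 - 1) * (γ.toFun (1 - 0))⁻¹ = _
  rw [sub_self, sub_zero, γ.start, one_mul]

/-- The smooth concatenation of `δ` followed by `γ`. -/
theorem exists_concat :
    ∃ ε : L.KerPhiIsotopy, ε.toFun 1 = γ.toFun 1 * δ.toFun 1 ∧
      L.pathFlux ε = L.pathFlux γ + L.pathFlux δ := by
  -- `δ` runs during `[0, 1/2]` and rests afterwards; `γ` rests before and runs during `[1/2, 1]`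
  have hρ : ContDiff ℝ ∞ (fun t : ℝ => Real.smoothTransition (2 * t)) :=
    Real.smoothTransition.contDiff.comp (by fun_prop)
  have hσ : ContDiff ℝ ∞ (fun t : ℝ => Real.smoothTransition (2 * t - 1)) :=
    Real.smoothTransition.contDiff.comp (by fun_prop)
  have e0 : Real.smoothTransition 0 = 0 := Real.smoothTransition.zero
  have e1 : ∀ {t : ℝ}, 1 ≤ t → Real.smoothTransition t = 1 :=
    Real.smoothTransition.one_of_one_le
  have e2 : ∀ {t : ℝ}, t ≤ 0 → Real.smoothTransition t = 0 :=
    Real.smoothTransition.zero_of_nonpos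
  have fγ : ∀ t, (γ.reparam hσ).toFun t = γ.toFun (Real.smoothTransition (2 * t - 1)) := by
    intro t
    change _ * (γ.toFun (Real.smoothTransition (2 * 0 - 1)))⁻¹ = _
    rw [e2 (t := 2 * 0 - 1) (by norm_num), γ.start, inv_one, mul_one]
  have fδ : ∀ t, (δ.reparam hρ).toFun t = δ.toFun (Real.smoothTransition (2 * t)) := by
    intro t
    change _ * (δ.toFun (Real.smoothTransition (2 * 0)))⁻¹ = _
    rw [e2 (t := 2 * 0) (by norm_num), δ.start, inv_one, mul_one]
  refine ⟨γ.reparam hσ * δ.reparam hρ, ?_, ?_⟩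
  · rw [mul_toFun, fγ, fδ, e1 (t := 2 * 1 - 1) (by norm_num), e1 (t := 2 * 1) (by norm_num)]
  · rw [pathFlux_mul_of_eventually_const _ _ (1 / 2), pathFlux_reparam, pathFlux_reparam]
    · exact e2 (by norm_num)
    · exact e1 (by norm_num)
    · exact e2 (by norm_num)
    · exact e1 (by norm_num)
    · intro t ht
      rcases lt_or_gt_of_ne ht with ht | ht
      · left
        filter_upwards [Iio_mem_nhds ht] with s hs
        rw [fγ, e2 (by linarith [Set.mem_Iio.1 hs]), γ.start]
      · right
        filter_upwards [Ioi_mem_nhds ht] with s hs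
        rw [fδ, fδ, e1 (by linarith [Set.mem_Ioi.1 hs]), e1 (by linarith)]

end KerPhiIsotopy

end LCSStructure

/-! ### The flux homomorphism and the splitting -/

namespace LCSStructure

variable {m : ℕ} {M : Type*} [TopologicalSpace M] [ChartedSpace (EuclideanSpace ℝ (Fin m)) M]
  [IsManifold (𝓡 m) ∞ M] (L : LCSStructure m M)

/-- Evaluation at time one, as a homomorphism for the pointwise composition of isotopies. -/
noncomputable def evOneHom : L.KerPhiIsotopy →* L.kerPhiGroup where
  toFun := L.evOne
  map_one' := rfl
  map_mul' _ _ := rfl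

/-- Products and inverses of endpoints are endpoints of pointwise products and inverses, so the
group generated by endpoints consists of endpoints. -/
theorem evOne_surjective : Function.Surjective L.evOne := by
  have h : L.kerPhiGroup ≤ (L.kerPhiGroup.subtype.comp L.evOneHom).range :=
    (Subgroup.closure_le _).2 (by rintro _ ⟨γ, rfl⟩; exact ⟨γ, rfl⟩)
  rintro ⟨g, hg⟩
  obtain ⟨γ, hγ⟩ := h hg
  exact ⟨γ, Subtype.ext hγ⟩

theorem isQuotientMap_evOne : Topology.IsQuotientMap L.evOne := ⟨⟨rfl⟩, L.evOne_surjective⟩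

/-- A quotient homomorphism of groups is open, so the operations descend: products of open quotient
maps are quotient maps. -/
instance : IsTopologicalGroup L.kerPhiGroup := by
  have ho : IsOpenQuotientMap L.evOne :=
    MonoidHom.isOpenQuotientMap_of_isQuotientMap (φ := L.evOneHom) L.isQuotientMap_evOne
  refine { continuous_mul := ?_, continuous_inv := ?_ }
  · refine (ho.prodMap ho).isQuotientMap.continuous_iff.2 ?_
    exact L.isQuotientMap_evOne.continuous.comp (continuous_mul (M := L.KerPhiIsotopy))
  · refine L.isQuotientMap_evOne.continuous_iff.2 ?_
    exact L.isQuotientMap_evOne.continuous.comp (continuous_inv (G := L.KerPhiIsotopy))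

/-- Fluxes of isotopies with the same endpoint differ by a period. -/
theorem pathFlux_sub_mem_periodGroup {γ δ : L.KerPhiIsotopy} (h : L.evOne γ = L.evOne δ) :
    L.pathFlux γ - L.pathFlux δ ∈ L.periodGroup := by
  obtain ⟨δ', hδ', hf⟩ := δ.exists_reverse
  obtain ⟨ε, hε, hf'⟩ := γ.exists_concat δ'
  refine AddSubgroup.subset_closure ⟨ε, ?_, ?_⟩
  · have h' : γ.toFun 1 = δ.toFun 1 := congrArg Subtype.val h
    rw [hε, hδ', h', mul_inv_cancel]
  · rw [hf', hf, sub_eq_add_neg]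

theorem flux_evOne (γ : L.KerPhiIsotopy) :
    L.flux (L.evOne γ) = QuotientAddGroup.mk (L.pathFlux γ) := by
  have h : ∃ δ : L.KerPhiIsotopy, L.evOne δ = L.evOne γ := ⟨γ, rfl⟩
  rw [flux, dif_pos h, QuotientAddGroup.eq_iff_sub_mem]
  exact L.pathFlux_sub_mem_periodGroup h.choose_spec

/-- The periods are exactly the fluxes of loops. -/
theorem mem_periodGroup_iff {c : L.H1} :
    c ∈ L.periodGroup ↔ ∃ γ : L.KerPhiIsotopy, γ.toFun 1 = 1 ∧ L.pathFlux γ = c := by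
  refine ⟨fun h => ?_, fun h => AddSubgroup.subset_closure h⟩
  induction h using AddSubgroup.closure_induction with
  | mem c h => exact h
  | zero =>
    obtain ⟨δ, hδ, hf⟩ := (1 : L.KerPhiIsotopy).exists_reverse
    obtain ⟨ε, hε, hf'⟩ := (1 : L.KerPhiIsotopy).exists_concat δ
    exact ⟨ε, by rw [hε, hδ, mul_inv_cancel], by rw [hf', hf, add_neg_cancel]⟩
  | add a b _ _ ha hb =>
    obtain ⟨γ, hγ, rfl⟩ := ha
    obtain ⟨δ, hδ, rfl⟩ := hb
    obtain ⟨ε, hε, hf⟩ := γ.exists_concat δ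
    exact ⟨ε, by rw [hε, hγ, hδ, mul_one], hf⟩
  | neg a _ ha =>
    obtain ⟨γ, hγ, rfl⟩ := ha
    obtain ⟨ε, hε, hf⟩ := γ.exists_reverse
    exact ⟨ε, by rw [hε, hγ, inv_one], hf⟩

/-- Additivity holds for the smooth concatenation of isotopies, whose endpoint is the product. -/
theorem flux_mul (g h : L.kerPhiGroup) : L.flux (g * h) = L.flux g + L.flux h := by
  obtain ⟨γ, rfl⟩ := L.evOne_surjective g
  obtain ⟨δ, rfl⟩ := L.evOne_surjective h
  obtain ⟨ε, hε, hf⟩ := γ.exists_concat δ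
  have e : L.evOne γ * L.evOne δ = L.evOne ε := Subtype.ext hε.symm
  rw [e, flux_evOne, flux_evOne, flux_evOne, hf]
  rfl

/-- The flux as a homomorphism. -/
noncomputable def fluxHom : L.kerPhiGroup →* Multiplicative (L.H1 ⧸ L.periodGroup) :=
  MonoidHom.mk' (fun g => Multiplicative.ofAdd (L.flux g)) fun g h => congrArg _ (L.flux_mul g h)

theorem flux_inv (g : L.kerPhiGroup) : L.flux g⁻¹ = -L.flux g :=
  congrArg Multiplicative.toAdd (L.fluxHom.map_inv g)

theorem continuous_flux : Continuous L.flux := by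
  refine L.isQuotientMap_evOne.continuous_iff.2 ?_
  have h : L.flux ∘ L.evOne = QuotientAddGroup.mk ∘ L.pathFlux := funext L.flux_evOne
  rw [h]
  exact continuous_quot_mk.comp KerPhiIsotopy.continuous_pathFlux

/-- The Hamiltonian diffeomorphisms are the kernel of the flux: an isotopy whose flux is a period
can be corrected by a loop to one with zero flux. -/
theorem Ham_eq_ker : L.Ham = L.fluxHom.ker := by
  refine le_antisymm ((Subgroup.closure_le _).2 ?_) fun g hg => ?_
  · rintro _ ⟨γ, hγ, rfl⟩
    have h : L.flux (L.evOne γ) = 0 := by rw [flux_evOne, hγ]; rfl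
    exact congrArg Multiplicative.ofAdd h
  · have hg0 : L.flux g = 0 := congrArg Multiplicative.toAdd hg
    obtain ⟨γ, rfl⟩ := L.evOne_surjective g
    rw [flux_evOne, QuotientAddGroup.eq_zero_iff, mem_periodGroup_iff] at hg0
    -- the loop `δ` carries the whole flux of `γ`; running it backwards first cancels the flux
    obtain ⟨δ, hδ, hf⟩ := hg0
    obtain ⟨δ', hδ', hf'⟩ := δ.exists_reverse
    obtain ⟨ε, hε, hfε⟩ := γ.exists_concat δ'
    refine Subgroup.subset_closure ⟨ε, by rw [hfε, hf', hf, add_neg_cancel], Subtype.ext ?_⟩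
    change ε.toFun 1 = γ.toFun 1
    rw [hε, hδ', hδ, inv_one, mul_one]

theorem mem_Ham_iff {g : L.kerPhiGroup} : g ∈ L.Ham ↔ L.flux g = 0 := by
  rw [Ham_eq_ker]
  exact ⟨fun h => congrArg Multiplicative.toAdd h, fun h => congrArg Multiplicative.ofAdd h⟩

theorem Ham_normal : L.Ham.Normal := by
  rw [Ham_eq_ker]
  exact MonoidHom.normal_ker _

/-- A continuous section `s` of the flux splits `(ker Φ)_0` topologically: the inverse of
`(h, k) ↦ h k` is `g ↦ (g s(F g)⁻¹, s(F g))`. -/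
theorem isHomeomorph_mul_of_section {s : L.H1 ⧸ L.periodGroup → L.kerPhiGroup} (hs : Continuous s)
    (hsec : ∀ a, L.flux (s a) = a) {K : Set L.kerPhiGroup} (hK : K = Set.range s) :
    IsHomeomorph (fun p : L.Ham × K => (p.1 : L.kerPhiGroup) * (p.2 : L.kerPhiGroup)) := by
  subst hK
  have hflux : ∀ (h : L.Ham) (k : Set.range s),
      s (L.flux ((h : L.kerPhiGroup) * (k : L.kerPhiGroup))) = k := by
    rintro ⟨h, hh⟩ ⟨_, a, rfl⟩
    rw [flux_mul, L.mem_Ham_iff.1 hh, zero_add, hsec]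
  let e : L.Ham × Set.range s ≃ₜ L.kerPhiGroup :=
    { toFun := fun p => (p.1 : L.kerPhiGroup) * (p.2 : L.kerPhiGroup)
      invFun := fun g => (⟨g * (s (L.flux g))⁻¹, by
        rw [mem_Ham_iff, flux_mul, flux_inv, hsec, add_neg_cancel]⟩, ⟨s (L.flux g), _, rfl⟩)
      left_inv := fun p => by
        refine Prod.ext (Subtype.ext ?_) (Subtype.ext (hflux p.1 p.2))
        change (p.1 : L.kerPhiGroup) * (p.2 : L.kerPhiGroup) * (s (L.flux _))⁻¹ = p.1
        rw [hflux, mul_inv_cancel_right]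
      right_inv := fun g => inv_mul_cancel_right _ _
      continuous_toFun := by fun_prop
      continuous_invFun := by
        have h := hs.comp L.continuous_flux
        exact ((continuous_id.mul h.inv).subtype_mk _).prodMk (h.subtype_mk _) }
  exact e.isHomeomorph

/-- The image of a multiplicative section of the flux. -/
noncomputable def sectionRange {s : L.H1 ⧸ L.periodGroup → L.kerPhiGroup}
    (hmul : ∀ a b, s (a + b) = s a * s b) :
    Subgroup L.kerPhiGroup :=
  (MonoidHom.mk' (fun a : Multiplicative (L.H1 ⧸ L.periodGroup) => s a.toAdd)
    fun a b => hmul a.toAdd b.toAdd).range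

end LCSStructure

theorem theorem3p5 (n : ℕ) (M : Type*) [TopologicalSpace M] [T2Space M] [CompactSpace M]
    [ChartedSpace (EuclideanSpace ℝ (Fin (2 * n))) M] [IsManifold (𝓡 (2 * n)) ∞ M]
    (L : LCSStructure (2 * n) M) (hΔ : L.HasDiscretePeriods)
    (s : L.H1 ⧸ L.periodGroup → L.kerPhiGroup) (hs : Continuous s)
    (hsec : ∀ a, L.flux (s a) = a) :
    ∃ _ : L.Ham.Normal,
      IsHomeomorph (fun p : L.Ham × Set.range s => (p.1 : L.kerPhiGroup) * (p.2 : L.kerPhiGroup)) ∧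
      ((∀ a b, s (a + b) = s a * s b) →
        ∃ K : Subgroup L.kerPhiGroup, (K : Set L.kerPhiGroup) = Set.range s ∧
          ∃ e : (L.Ham ⋊[(MulAut.conjNormal (H := L.Ham)).comp K.subtype] K) ≃* L.kerPhiGroup,
            (∀ (h : L.Ham) (k : K), e ⟨h, k⟩ = (h : L.kerPhiGroup) * (k : L.kerPhiGroup)) ∧
            IsHomeomorph (fun p : L.Ham × K => e ⟨p.1, p.2⟩)) := by
  have hnormal := L.Ham_normal
  refine ⟨hnormal, L.isHomeomorph_mul_of_section hs hsec rfl, fun hmul => ?_⟩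
  have hK : (L.sectionRange hmul : Set L.kerPhiGroup) = Set.range s := rfl
  have hhom := L.isHomeomorph_mul_of_section hs hsec hK
  let f : (L.Ham ⋊[(MulAut.conjNormal (H := L.Ham)).comp (L.sectionRange hmul).subtype]
      L.sectionRange hmul) →* L.kerPhiGroup :=
    SemidirectProduct.lift L.Ham.subtype (L.sectionRange hmul).subtype fun k => by
      ext h
      simp
  have hf : ∀ (h : L.Ham) (k : L.sectionRange hmul),
      f ⟨h, k⟩ = (h : L.kerPhiGroup) * (k : L.kerPhiGroup) := fun h k => rfl
  have hbij : Function.Bijective f := by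
    refine ⟨fun a b hab => ?_, fun g => ?_⟩
    · have h := hhom.injective (a₁ := (a.left, a.right)) (a₂ := (b.left, b.right)) hab
      exact SemidirectProduct.ext (congrArg Prod.fst h) (congrArg Prod.snd h)
    · obtain ⟨p, hp⟩ := hhom.surjective g
      exact ⟨⟨p.1, p.2⟩, hp⟩
  exact ⟨L.sectionRange hmul, hK, MulEquiv.ofBijective f hbij, hf, hhom⟩
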